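/- Let $\Bbbk$ be a commutative ring. Bigraded $\Bbbk$-modules carry the symmetric monoidal structure with the Koszul sign rule for the total degree $|x|=p+q$ of an element of bidegree $(p,q)$ (horizontal, vertical); graded modules are regarded as bigraded modules concentrated in horizontal degree $0$. All operads are symmetric operads in bigraded $\Bbbk$-modules, with trivial differential. For an $\mathbb S$-module $E$ with $E(0)=0$ and a sub-$\mathbb S$-module $R\subset E\circ_{(1)}E=\mathcal F(E)^{(2)}$ of the weight $2$ part of the free operad $\mathcal F(E)$, the reduced quadratic operad $\mathcal P(E,R)$ is the quotient $\mathcal F(E)/(R)$ by the operadic ideal generated by $R$. Let $\mathcal D=\Bbbk[\epsilon]/(\epsilon^2)$, with $\epsilon$ in bidegree $(-1,0)$, regarded as an operad concentrated in arity $1$. For an operad $\mathcal O$, the derived operad $D(\mathcal O)=\mathcal O\circ_\varphi\mathcal D$ has underlying $\mathbb S$-module $\mathcal O\circ\mathcal D$, that is, $D(\mathcal O)(r)=\mathcal O(r)\otimes\mathcal D^{\otimes r}$ with the diagonal action of $\mathbb S_r$ (by signed permutations on $\mathcal D^{\otimes r}$), unit $(1;1)$, and the composition $(\gamma_{\mathcal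 O}\circ\gamma_{\mathcal D})(\mathrm{id}\circ\varphi\circ\mathrm{id})$ determined by the distributive law $\varphi\colon\mathcal D\circ\mathcal O\to\mathcal O\circ\mathcal D$ given, for $\mu\in\mathcal O(r)$, by $$\varphi(1;\mu)=(\mu;1,\dots,1),\qquad \varphi(\epsilon;\mu)=(-1)^{|\mu|}\sum_{i=1}^r(\mu;1,\dots,1,\underset{i}{\epsilon},1,\dots,1).$$ **Proposition.** Let $\mathcal O=\mathcal P(E,R)$ be a reduced quadratic operad. Then $D(\mathcal O)$ is an operad, it is quadratic, and it has the presentation $$D(\mathcal O)\cong\mathcal P\big(E\oplus\Bbbk\cdot\epsilon,\;R\oplus D\oplus\Bbbk\cdot\epsilon^2\big),$$ where $\Bbbk\cdot\epsilon$ is the $\mathbb S$-module free on one generator $\epsilon$ of arity $1$ and bidegree $(-1,0)$, $\epsilon^2=\epsilon\circ_1\epsilon$, and $D\subset(\Bbbk\cdot\epsilon\circ_{(1)}E)\oplus(E\circ_{(1)}\Bbbk\cdot\epsilon)$ is the sub-$\mathbb S$-module $$D(r)=\Big\{\epsilon\circ_1\mu-(-1)^{|\mu|}\sum_{i=1}^r\mu\circ_i\epsilon\;:\;\mu\in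 E(r)\text{ homogeneous}\Big\}$$ in each bidegree. The sum of (the images of) $R$, $D$ and $\Bbbk\cdot\epsilon^2$ in $\mathcal F(E\oplus\Bbbk\cdot\epsilon)^{(2)}$ is direct. The isomorphism sends each generator $\mu\in E(r)$ to $(\mu;1,\dots,1)$ and $\epsilon$ to $(1;\epsilon)$. -/

import Mathlib

universe u v w

/-! ## Bidegrees and signs -/

namespace DerivedOperad

/-- Bidegrees `(horizontal degree, vertical degree)`. -/
abbrev Deg : Type := ℤ × ℤ

/-- The total degree of a bidegree. -/
def tot (d : Deg) : ℤ := d.1 + d.2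

/-- The Koszul sign `(-1) ^ (|x| |y|)` of elements of bidegrees `d` and `e`. -/
def koszul (d e : Deg) : ℤˣ := Int.negOnePow (tot d * tot e)

/-! ## Inputs of a partial composite

When an operation with `n` inputs is inserted in the `i`-th input of an operation with `m` inputs,
the result has `l = m + n - 1` inputs: the inputs of the first operation other than `i`,
and the inputs of the second operation. -/

/-- The position of the inputs in a partial composite (counted from `0`). -/
def slotFun {m n l : ℕ} (h : l + 1 = m + n) (i : Fin m) : {a : Fin m // a ≠ i} ⊕ Fin n → Fin l
  | Sum.inl a => ⟨if a.1 < i then a.1 else a.1 + n - 1, by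
      have h1 := a.1.2
      have h2 : (a.1 : ℕ) ≠ i := fun e => a.2 (Fin.ext e)
      have h3 := i.2
      split_ifs with h4
      · have : (a.1 : ℕ) < i := h4
        omega
      · have : ¬ (a.1 : ℕ) < i := h4
        omega⟩
  | Sum.inr b => ⟨i + b, by have := i.2; have := b.2; omega⟩

theorem slotFun_bijective {m n l : ℕ} (h : l + 1 = m + n) (i : Fin m) :
    Function.Bijective (slotFun h i) := by
  rw [Fintype.bijective_iff_injective_and_card]
  constructor
  · have key : ∀ a : {a : Fin m // a ≠ i}, (a.1 : ℕ) ≠ i := fun a e => a.2 (Fin.ext e)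
    rintro (a | b) (a' | b') hab
    · have h1 := key a
      have h2 := key a'
      congr 1
      apply Subtype.ext
      apply Fin.ext
      simp only [slotFun, Fin.mk.injEq, Fin.lt_def] at hab
      split_ifs at hab <;> omega
    · exfalso
      have h1 := key a
      have h2 := b'.2
      simp only [slotFun, Fin.mk.injEq, Fin.lt_def] at hab
      split_ifs at hab <;> omega
    · exfalso
      have h1 := key a'
      have h2 := b.2
      simp only [slotFun, Fin.mk.injEq, Fin.lt_def] at hab
      split_ifs at hab <;> omega
    · congr 1
      apply Fin.ext
      simp only [slotFun, Fin.mk.injEq] at hab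
      omega
  · have : 0 < m := i.pos
    simp only [ne_eq, Fintype.card_sum, Fintype.card_subtype_compl, Fintype.card_fin,
      Fintype.card_subtype_eq]
    omega

/-- The bijection between the inputs of two operations (except for the input `i` of the first one)
and the inputs of their `i`-th partial composite. -/
noncomputable def slot {m n l : ℕ} (h : l + 1 = m + n) (i : Fin m) :
    {a : Fin m // a ≠ i} ⊕ Fin n ≃ Fin l :=
  Equiv.ofBijective (slotFun h i) (slotFun_bijective h i)

/-- The permutation of the inputs of an `i`-th partial composite induced by permutations `σ` and
`τ` of the inputs of the two factors (it becomes a `σ i`-th partial composite). -/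
noncomputable def blockPerm {m n l : ℕ} (h : l + 1 = m + n) (i : Fin m)
    (σ : Equiv.Perm (Fin m)) (τ : Equiv.Perm (Fin n)) : Equiv.Perm (Fin l) :=
  (slot h i).symm.trans
    ((Equiv.sumCongr
      (σ.subtypeEquiv (fun _ => not_congr σ.injective.eq_iff.symm) :
        {a : Fin m // a ≠ i} ≃ {a : Fin m // a ≠ σ i}) τ).trans (slot h (σ i)))

/-! ## Symmetric sequences and operads in bigraded modules -/

/-- An `𝕊`-module in bigraded `k`-modules: for every arity `r`, a bigraded module with an action of
the symmetric group on `r` letters. The action is written on the left: `perm σ x` is `x` with its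
`j`-th input moved to the position `σ j`, i.e. it is `x · σ⁻¹` for the usual right action. -/
structure SMod (k : Type u) [CommRing k] where
  carrier : ℕ → Deg → Type v
  [addCommGroup : ∀ r d, AddCommGroup (carrier r d)]
  [module : ∀ r d, Module k (carrier r d)]
  perm : ∀ r d, Equiv.Perm (Fin r) →* Module.End k (carrier r d)

attribute [instance] SMod.addCommGroup SMod.module

/-- Morphisms of `𝕊`-modules (of bidegree `(0,0)`). -/
structure SMod.Hom {k : Type u} [CommRing k] (E : SMod.{u, v} k) (F : SMod.{u, w} k) where
  toFun : ∀ r d, E.carrier r d →ₗ[k] F.carrier r d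
  map_perm : ∀ {r d} (σ : Equiv.Perm (Fin r)) (x : E.carrier r d),
    toFun r d (E.perm r d σ x) = F.perm r d σ (toFun r d x)

/-- The structure maps of an operad in bigraded `k`-modules (with trivial differential), in terms
of partial composites. Elements are homogeneous by construction. The partial composite of `x` and
`y` at the input `i` is `comp h hd i x y`; the equations `h` and `hd` record its arity and its
bidegree. The action of the symmetric groups is written on the left, as for `SMod`. -/
structure OperadData (k : Type u) [CommRing k] where
  carrier : ℕ → Deg → Type v
  [addCommGroup : ∀ r d, AddCommGroup (carrier r d)]
  [module : ∀ r d, Module k (carrier r d)]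
  perm : ∀ {r : ℕ} {d : Deg}, Equiv.Perm (Fin r) → carrier r d →ₗ[k] carrier r d
  one : carrier 1 0
  comp : ∀ {m n l : ℕ} {d e f : Deg}, l + 1 = m + n → f = d + e → Fin m →
    (carrier m d →ₗ[k] carrier n e →ₗ[k] carrier l f)

attribute [instance] OperadData.addCommGroup OperadData.module

/-- The laws of a symmetric operad in bigraded modules, for the symmetry constraint given by the
Koszul sign rule with respect to the total degree. -/
structure IsOperad {k : Type u} [CommRing k] (P : OperadData.{u, v} k) : Prop where
  perm_one : ∀ {r d} (x : P.carrier r d), P.perm 1 x = x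
  perm_mul : ∀ {r d} (σ τ : Equiv.Perm (Fin r)) (x : P.carrier r d),
    P.perm (σ * τ) x = P.perm σ (P.perm τ x)
  comp_perm : ∀ {m n l d e f} (h : l + 1 = m + n) (hd : f = d + e) (i : Fin m)
    (σ : Equiv.Perm (Fin m)) (τ : Equiv.Perm (Fin n)) (x : P.carrier m d) (y : P.carrier n e),
    P.comp h hd (σ i) (P.perm σ x) (P.perm τ y) = P.perm (blockPerm h i σ τ) (P.comp h hd i x y)
  one_comp : ∀ {r d} (h : r + 1 = 1 + r) (hd : d = 0 + d) (i : Fin 1) (x : P.carrier r d),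
    P.comp h hd i P.one x = x
  comp_one : ∀ {r d} (h : r + 1 = r + 1) (hd : d = d + 0) (i : Fin r) (x : P.carrier r d),
    P.comp h hd i x P.one = x
  assoc_seq : ∀ {m n r p q l d e g a b f} (h₁ : p + 1 = m + n) (h₂ : l + 1 = p + r)
    (h₃ : q + 1 = n + r) (h₄ : l + 1 = m + q) (hd₁ : a = d + e) (hd₂ : f = a + g)
    (hd₃ : b = e + g) (hd₄ : f = d + b) (i : Fin m) (j : Fin n)
    (x : P.carrier m d) (y : P.carrier n e) (z : P.carrier r g),
    P.comp h₂ hd₂ (slot h₁ i (Sum.inr j)) (P.comp h₁ hd₁ i x y) z =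
      P.comp h₄ hd₄ i x (P.comp h₃ hd₃ j y z)
  assoc_par : ∀ {m n r p q l d e g a b f} (h₁ : p + 1 = m + n) (h₂ : l + 1 = p + r)
    (h₃ : q + 1 = m + r) (h₄ : l + 1 = q + n) (hd₁ : a = d + e) (hd₂ : f = a + g)
    (hd₃ : b = d + g) (hd₄ : f = b + e) (i j : Fin m) (hji : j ≠ i) (hij : i ≠ j)
    (x : P.carrier m d) (y : P.carrier n e) (z : P.carrier r g),
    P.comp h₂ hd₂ (slot h₁ i (Sum.inl ⟨j, hji⟩)) (P.comp h₁ hd₁ i x y) z =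
      koszul e g • P.comp h₄ hd₄ (slot h₃ j (Sum.inl ⟨i, hij⟩)) (P.comp h₃ hd₃ j x z) y

/-- Isomorphisms of operads. -/
structure OperadIso {k : Type u} [CommRing k] (P : OperadData.{u, v} k)
    (Q : OperadData.{u, w} k) where
  toEquiv : ∀ r d, P.carrier r d ≃ₗ[k] Q.carrier r d
  map_one : toEquiv 1 0 P.one = Q.one
  map_perm : ∀ {r d} (σ : Equiv.Perm (Fin r)) (x : P.carrier r d),
    toEquiv r d (P.perm σ x) = Q.perm σ (toEquiv r d x)
  map_comp : ∀ {m n l d e f} (h : l + 1 = m + n) (hd : f = d + e) (i : Fin m)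
    (x : P.carrier m d) (y : P.carrier n e),
    toEquiv l f (P.comp h hd i x y) = Q.comp h hd i (toEquiv m d x) (toEquiv n e y)

/-- Identification of components of the same bidegree. -/
def OperadData.castDeg {k : Type u} [CommRing k] (P : OperadData.{u, v} k) {r : ℕ} {d e : Deg}
    (h : d = e) : P.carrier r d →ₗ[k] P.carrier r e :=
  h ▸ LinearMap.id

/-! ## Operadic ideals and quotient operads -/

/-- Operadic ideals. -/
structure OperadIdeal {k : Type u} [CommRing k] (P : OperadData.{u, v} k) where
  carrier : ∀ r d, Submodule k (P.carrier r d)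
  perm_mem : ∀ {r d} (σ : Equiv.Perm (Fin r)) {x : P.carrier r d},
    x ∈ carrier r d → P.perm σ x ∈ carrier r d
  comp_mem_left : ∀ {m n l d e f} (h : l + 1 = m + n) (hd : f = d + e) (i : Fin m)
    {x : P.carrier m d} (y : P.carrier n e),
    x ∈ carrier m d → P.comp h hd i x y ∈ carrier l f
  comp_mem_right : ∀ {m n l d e f} (h : l + 1 = m + n) (hd : f = d + e) (i : Fin m)
    (x : P.carrier m d) {y : P.carrier n e},
    y ∈ carrier n e → P.comp h hd i x y ∈ carrier l f

/-- The operadic ideal `(R)` generated by `R`: the intersection of all ideals containing `R`. -/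
def idealSpan {k : Type u} [CommRing k] (P : OperadData.{u, v} k)
    (R : ∀ r d, Submodule k (P.carrier r d)) : OperadIdeal P where
  carrier r d := ⨅ (I : OperadIdeal P) (_ : ∀ r d, R r d ≤ I.carrier r d), I.carrier r d
  perm_mem σ x hx := by
    simp only [Submodule.mem_iInf] at hx ⊢
    exact fun I hI => I.perm_mem σ (hx I hI)
  comp_mem_left h hd i x y hx := by
    simp only [Submodule.mem_iInf] at hx ⊢
    exact fun I hI => I.comp_mem_left h hd i y (hx I hI)
  comp_mem_right h hd i x y hy := by
    simp only [Submodule.mem_iInf] at hy ⊢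
    exact fun I hI => I.comp_mem_right h hd i x (hy I hI)

/-- The quotient of an operad by an operadic ideal. -/
def quotient {k : Type u} [CommRing k] (P : OperadData.{u, v} k) (I : OperadIdeal P) :
    OperadData.{u, v} k where
  carrier r d := P.carrier r d ⧸ I.carrier r d
  perm σ := Submodule.mapQ _ _ (P.perm σ) (fun _ hx => I.perm_mem σ hx)
  one := Submodule.Quotient.mk P.one
  comp {m n l d e f} h hd i :=
    (I.carrier m d).liftQ
      (((I.carrier n e).liftQ ((P.comp h hd i).compr₂ (I.carrier l f).mkQ).flip
        (fun y hy => by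
          ext x
          simpa using I.comp_mem_right h hd i x hy)).flip)
      (fun x hx => by
        ext y
        exact (Submodule.Quotient.mk_eq_zero _).2 (I.comp_mem_left h hd i y hx))

theorem quotient_isOperad {k : Type u} [CommRing k] {P : OperadData.{u, v} k} (hP : IsOperad P)
    (I : OperadIdeal P) : IsOperad (quotient P I) where
  perm_one {r d} x := by
    obtain ⟨x, rfl⟩ := Submodule.Quotient.mk_surjective _ x
    exact congrArg Submodule.Quotient.mk (hP.perm_one x)
  perm_mul {r d} σ τ x := by
    obtain ⟨x, rfl⟩ := Submodule.Quotient.mk_surjective _ x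
    exact congrArg Submodule.Quotient.mk (hP.perm_mul σ τ x)
  comp_perm {m n l d e f} h hd i σ τ x y := by
    obtain ⟨x, rfl⟩ := Submodule.Quotient.mk_surjective _ x
    obtain ⟨y, rfl⟩ := Submodule.Quotient.mk_surjective _ y
    exact congrArg Submodule.Quotient.mk (hP.comp_perm h hd i σ τ x y)
  one_comp {r d} h hd i x := by
    obtain ⟨x, rfl⟩ := Submodule.Quotient.mk_surjective _ x
    exact congrArg Submodule.Quotient.mk (hP.one_comp h hd i x)
  comp_one {r d} h hd i x := by
    obtain ⟨x, rfl⟩ := Submodule.Quotient.mk_surjective _ x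
    exact congrArg Submodule.Quotient.mk (hP.comp_one h hd i x)
  assoc_seq {m n r p q l d e g a b f} h₁ h₂ h₃ h₄ hd₁ hd₂ hd₃ hd₄ i j x y z := by
    obtain ⟨x, rfl⟩ := Submodule.Quotient.mk_surjective _ x
    obtain ⟨y, rfl⟩ := Submodule.Quotient.mk_surjective _ y
    obtain ⟨z, rfl⟩ := Submodule.Quotient.mk_surjective _ z
    exact congrArg Submodule.Quotient.mk
      (hP.assoc_seq h₁ h₂ h₃ h₄ hd₁ hd₂ hd₃ hd₄ i j x y z)
  assoc_par {m n r p q l d e g a b f} h₁ h₂ h₃ h₄ hd₁ hd₂ hd₃ hd₄ i j hji hij x y z := by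
    obtain ⟨x, rfl⟩ := Submodule.Quotient.mk_surjective _ x
    obtain ⟨y, rfl⟩ := Submodule.Quotient.mk_surjective _ y
    obtain ⟨z, rfl⟩ := Submodule.Quotient.mk_surjective _ z
    exact congrArg Submodule.Quotient.mk
      (hP.assoc_par h₁ h₂ h₃ h₄ hd₁ hd₂ hd₃ hd₄ i j hji hij x y z)

/-! ## The free operad -/

section Free

variable {k : Type u} [CommRing k]

/-- Formal expressions in the generators `E`, the unit, partial composites, permutations of inputs
and linear combinations. -/
inductive Pre (E : SMod.{u, v} k) : ℕ → Deg → Type (max u v)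
  | gen {r : ℕ} {d : Deg} (x : E.carrier r d) : Pre E r d
  | one : Pre E 1 0
  | perm {r : ℕ} {d : Deg} (σ : Equiv.Perm (Fin r)) (a : Pre E r d) : Pre E r d
  | comp {m n l : ℕ} {d e f : Deg} (h : l + 1 = m + n) (hd : f = d + e) (i : Fin m)
      (a : Pre E m d) (b : Pre E n e) : Pre E l f
  | zero {r : ℕ} {d : Deg} : Pre E r d
  | add {r : ℕ} {d : Deg} (a b : Pre E r d) : Pre E r d
  | smul {r : ℕ} {d : Deg} (c : k) (a : Pre E r d) : Pre E r d

/-- The relations imposed on formal expressions: compatibility with all operations, the laws of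
modules, linearity of the operations, equivariant linearity of the inclusion of generators, and the
laws of operads. -/
inductive Rel (E : SMod.{u, v} k) : ∀ {r : ℕ} {d : Deg}, Pre E r d → Pre E r d → Prop
  -- compatibility with the operations
  | perm_congr {r d} (σ : Equiv.Perm (Fin r)) {a a' : Pre E r d} :
      Rel E a a' → Rel E (.perm σ a) (.perm σ a')
  | comp_congr_left {m n l d e f} (h : l + 1 = m + n) (hd : f = d + e) (i : Fin m)
      {a a' : Pre E m d} (b : Pre E n e) : Rel E a a' → Rel E (.comp h hd i a b) (.comp h hd i a' b)
  | comp_congr_right {m n l d e f} (h : l + 1 = m + n) (hd : f = d + e) (i : Fin m)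
      (a : Pre E m d) {b b' : Pre E n e} : Rel E b b' → Rel E (.comp h hd i a b) (.comp h hd i a b')
  | add_congr_left {r d} {a a' : Pre E r d} (b : Pre E r d) :
      Rel E a a' → Rel E (.add a b) (.add a' b)
  | add_congr_right {r d} (a : Pre E r d) {b b' : Pre E r d} :
      Rel E b b' → Rel E (.add a b) (.add a b')
  | smul_congr {r d} (c : k) {a a' : Pre E r d} : Rel E a a' → Rel E (.smul c a) (.smul c a')
  -- laws of modules
  | add_comm {r d} (a b : Pre E r d) : Rel E (.add a b) (.add b a)
  | add_assoc {r d} (a b c : Pre E r d) : Rel E (.add (.add a b) c) (.add a (.add b c))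
  | zero_add {r d} (a : Pre E r d) : Rel E (.add .zero a) a
  | one_smul {r d} (a : Pre E r d) : Rel E (.smul 1 a) a
  | zero_smul {r d} (a : Pre E r d) : Rel E (.smul 0 a) .zero
  | mul_smul {r d} (c c' : k) (a : Pre E r d) : Rel E (.smul (c * c') a) (.smul c (.smul c' a))
  | smul_add {r d} (c : k) (a b : Pre E r d) :
      Rel E (.smul c (.add a b)) (.add (.smul c a) (.smul c b))
  | add_smul {r d} (c c' : k) (a : Pre E r d) :
      Rel E (.smul (c + c') a) (.add (.smul c a) (.smul c' a))
  -- linearity of the operations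
  | gen_add {r d} (x y : E.carrier r d) : Rel E (.gen (x + y)) (.add (.gen x) (.gen y))
  | gen_smul {r d} (c : k) (x : E.carrier r d) : Rel E (.gen (c • x)) (.smul c (.gen x))
  | gen_perm {r d} (σ : Equiv.Perm (Fin r)) (x : E.carrier r d) :
      Rel E (.gen (E.perm r d σ x)) (.perm σ (.gen x))
  | perm_add {r d} (σ : Equiv.Perm (Fin r)) (a b : Pre E r d) :
      Rel E (.perm σ (.add a b)) (.add (.perm σ a) (.perm σ b))
  | perm_smul {r d} (σ : Equiv.Perm (Fin r)) (c : k) (a : Pre E r d) :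
      Rel E (.perm σ (.smul c a)) (.smul c (.perm σ a))
  | comp_add_left {m n l d e f} (h : l + 1 = m + n) (hd : f = d + e) (i : Fin m)
      (a a' : Pre E m d) (b : Pre E n e) :
      Rel E (.comp h hd i (.add a a') b) (.add (.comp h hd i a b) (.comp h hd i a' b))
  | comp_smul_left {m n l d e f} (h : l + 1 = m + n) (hd : f = d + e) (i : Fin m)
      (c : k) (a : Pre E m d) (b : Pre E n e) :
      Rel E (.comp h hd i (.smul c a) b) (.smul c (.comp h hd i a b))
  | comp_add_right {m n l d e f} (h : l + 1 = m + n) (hd : f = d + e) (i : Fin m)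
      (a : Pre E m d) (b b' : Pre E n e) :
      Rel E (.comp h hd i a (.add b b')) (.add (.comp h hd i a b) (.comp h hd i a b'))
  | comp_smul_right {m n l d e f} (h : l + 1 = m + n) (hd : f = d + e) (i : Fin m)
      (c : k) (a : Pre E m d) (b : Pre E n e) :
      Rel E (.comp h hd i a (.smul c b)) (.smul c (.comp h hd i a b))
  -- laws of operads
  | perm_one {r d} (a : Pre E r d) : Rel E (.perm 1 a) a
  | perm_mul {r d} (σ τ : Equiv.Perm (Fin r)) (a : Pre E r d) :
      Rel E (.perm (σ * τ) a) (.perm σ (.perm τ a))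
  | comp_perm {m n l d e f} (h : l + 1 = m + n) (hd : f = d + e) (i : Fin m)
      (σ : Equiv.Perm (Fin m)) (τ : Equiv.Perm (Fin n)) (a : Pre E m d) (b : Pre E n e) :
      Rel E (.comp h hd (σ i) (.perm σ a) (.perm τ b))
        (.perm (blockPerm h i σ τ) (.comp h hd i a b))
  | one_comp {r d} (h : r + 1 = 1 + r) (hd : d = 0 + d) (i : Fin 1) (a : Pre E r d) :
      Rel E (.comp h hd i .one a) a
  | comp_one {r d} (h : r + 1 = r + 1) (hd : d = d + 0) (i : Fin r) (a : Pre E r d) :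
      Rel E (.comp h hd i a .one) a
  | assoc_seq {m n r p q l d e g a b f} (h₁ : p + 1 = m + n) (h₂ : l + 1 = p + r)
      (h₃ : q + 1 = n + r) (h₄ : l + 1 = m + q) (hd₁ : a = d + e) (hd₂ : f = a + g)
      (hd₃ : b = e + g) (hd₄ : f = d + b) (i : Fin m) (j : Fin n)
      (x : Pre E m d) (y : Pre E n e) (z : Pre E r g) :
      Rel E (.comp h₂ hd₂ (slot h₁ i (Sum.inr j)) (.comp h₁ hd₁ i x y) z)
        (.comp h₄ hd₄ i x (.comp h₃ hd₃ j y z))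
  | assoc_par {m n r p q l d e g a b f} (h₁ : p + 1 = m + n) (h₂ : l + 1 = p + r)
      (h₃ : q + 1 = m + r) (h₄ : l + 1 = q + n) (hd₁ : a = d + e) (hd₂ : f = a + g)
      (hd₃ : b = d + g) (hd₄ : f = b + e) (i j : Fin m) (hji : j ≠ i) (hij : i ≠ j)
      (x : Pre E m d) (y : Pre E n e) (z : Pre E r g) :
      Rel E (.comp h₂ hd₂ (slot h₁ i (Sum.inl ⟨j, hji⟩)) (.comp h₁ hd₁ i x y) z)
        (.smul (((koszul e g : ℤˣ) : ℤ) : k)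
          (.comp h₄ hd₄ (slot h₃ j (Sum.inl ⟨i, hij⟩)) (.comp h₃ hd₃ j x z) y))

/-- The components of the free operad. -/
def FreeCarrier (E : SMod.{u, v} k) (r : ℕ) (d : Deg) : Type (max u v) :=
  Quot (fun a b : Pre E r d => Rel E a b)

instance (E : SMod.{u, v} k) (r : ℕ) (d : Deg) : Add (FreeCarrier E r d) where
  add := Quot.map₂ Pre.add (fun a _ _ h => Rel.add_congr_right a h)
    (fun _ _ b h => Rel.add_congr_left b h)

instance (E : SMod.{u, v} k) (r : ℕ) (d : Deg) : Zero (FreeCarrier E r d) where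
  zero := Quot.mk _ Pre.zero

instance (E : SMod.{u, v} k) (r : ℕ) (d : Deg) : Neg (FreeCarrier E r d) where
  neg := Quot.map (Pre.smul (-1)) (fun _ _ h => Rel.smul_congr (-1) h)

instance (E : SMod.{u, v} k) (r : ℕ) (d : Deg) : AddCommGroup (FreeCarrier E r d) where
  add_assoc := by rintro ⟨a⟩ ⟨b⟩ ⟨c⟩; exact Quot.sound (Rel.add_assoc a b c)
  zero_add := by rintro ⟨a⟩; exact Quot.sound (Rel.zero_add a)
  add_zero := by
    rintro ⟨a⟩
    exact (Quot.sound (Rel.add_comm a Pre.zero)).trans (Quot.sound (Rel.zero_add a))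
  add_comm := by rintro ⟨a⟩ ⟨b⟩; exact Quot.sound (Rel.add_comm a b)
  neg_add_cancel := by
    rintro ⟨a⟩
    have h1 : Quot.mk (fun a b : Pre E r d => Rel E a b) (Pre.add (Pre.smul (-1) a) a) =
        Quot.mk _ (Pre.add (Pre.smul (-1) a) (Pre.smul 1 a)) :=
      (congrArg (Quot.map (Pre.add (Pre.smul (-1) a))
        (fun _ _ h => Rel.add_congr_right _ h)) (Quot.sound (Rel.one_smul a))).symm
    have h2 := Quot.sound (Rel.add_smul (-1) 1 a)
    have h3 := Quot.sound (Rel.zero_smul a)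
    rw [neg_add_cancel] at h2
    exact h1.trans (h2.symm.trans h3)
  nsmul := nsmulRec
  zsmul := zsmulRec

instance (E : SMod.{u, v} k) (r : ℕ) (d : Deg) : Module k (FreeCarrier E r d) where
  smul c := Quot.map (Pre.smul c) (fun _ _ h => Rel.smul_congr c h)
  one_smul := by rintro ⟨a⟩; exact Quot.sound (Rel.one_smul a)
  mul_smul := by rintro c c' ⟨a⟩; exact Quot.sound (Rel.mul_smul c c' a)
  smul_zero := by
    intro c
    have h1 := Quot.sound (Rel.mul_smul c 0 (Pre.zero : Pre E r d))
    rw [mul_zero] at h1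
    have h2 := Quot.sound (Rel.zero_smul (Pre.zero : Pre E r d))
    have h3 := congrArg (Quot.map (Pre.smul c) (fun _ _ h => Rel.smul_congr c h)) h2
    exact h3.symm.trans (h1.symm.trans h2)
  smul_add := by rintro c ⟨a⟩ ⟨b⟩; exact Quot.sound (Rel.smul_add c a b)
  add_smul := by rintro c c' ⟨a⟩; exact Quot.sound (Rel.add_smul c c' a)
  zero_smul := by rintro ⟨a⟩; exact Quot.sound (Rel.zero_smul a)

/-- The free operad `F(E)` on an `𝕊`-module `E`. -/
def Free (E : SMod.{u, v} k) : OperadData.{u, max u v} k where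
  carrier := FreeCarrier E
  perm σ :=
    { toFun := Quot.map (Pre.perm σ) (fun _ _ h => Rel.perm_congr σ h)
      map_add' := by rintro ⟨a⟩ ⟨b⟩; exact Quot.sound (Rel.perm_add σ a b)
      map_smul' := by rintro c ⟨a⟩; exact Quot.sound (Rel.perm_smul σ c a) }
  one := Quot.mk _ Pre.one
  comp h hd i := LinearMap.mk₂ k
    (Quot.map₂ (Pre.comp h hd i) (fun a _ _ w => Rel.comp_congr_right h hd i a w)
      (fun _ _ b w => Rel.comp_congr_left h hd i b w))
    (by rintro ⟨a⟩ ⟨a'⟩ ⟨b⟩; exact Quot.sound (Rel.comp_add_left h hd i a a' b))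
    (by rintro c ⟨a⟩ ⟨b⟩; exact Quot.sound (Rel.comp_smul_left h hd i c a b))
    (by rintro ⟨a⟩ ⟨b⟩ ⟨b'⟩; exact Quot.sound (Rel.comp_add_right h hd i a b b'))
    (by rintro c ⟨a⟩ ⟨b⟩; exact Quot.sound (Rel.comp_smul_right h hd i c a b))

theorem free_isOperad (E : SMod.{u, v} k) : IsOperad (Free E) where
  perm_one := by rintro r d ⟨a⟩; exact Quot.sound (Rel.perm_one a)
  perm_mul := by rintro r d σ τ ⟨a⟩; exact Quot.sound (Rel.perm_mul σ τ a)
  comp_perm := by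
    rintro m n l d e f h hd i σ τ ⟨a⟩ ⟨b⟩; exact Quot.sound (Rel.comp_perm h hd i σ τ a b)
  one_comp := by rintro r d h hd i ⟨a⟩; exact Quot.sound (Rel.one_comp h hd i a)
  comp_one := by rintro r d h hd i ⟨a⟩; exact Quot.sound (Rel.comp_one h hd i a)
  assoc_seq := by
    rintro m n r p q l d e g a b f h₁ h₂ h₃ h₄ hd₁ hd₂ hd₃ hd₄ i j ⟨x⟩ ⟨y⟩ ⟨z⟩
    exact Quot.sound (Rel.assoc_seq h₁ h₂ h₃ h₄ hd₁ hd₂ hd₃ hd₄ i j x y z)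
  assoc_par := by
    rintro m n r p q l d e g a b f h₁ h₂ h₃ h₄ hd₁ hd₂ hd₃ hd₄ i j hji hij ⟨x⟩ ⟨y⟩ ⟨z⟩
    rw [Units.smul_def, ← Int.cast_smul_eq_zsmul k]
    exact Quot.sound (Rel.assoc_par h₁ h₂ h₃ h₄ hd₁ hd₂ hd₃ hd₄ i j hji hij x y z)

/-- The inclusion of generators `E → F(E)`. -/
def gen (E : SMod.{u, v} k) (r : ℕ) (d : Deg) : E.carrier r d →ₗ[k] (Free E).carrier r d where
  toFun x := Quot.mk _ (Pre.gen x)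
  map_add' x y := Quot.sound (Rel.gen_add x y)
  map_smul' c x := Quot.sound (Rel.gen_smul c x)

theorem gen_perm (E : SMod.{u, v} k) {r : ℕ} {d : Deg} (σ : Equiv.Perm (Fin r))
    (x : E.carrier r d) : gen E r d (E.perm r d σ x) = (Free E).perm σ (gen E r d x) :=
  Quot.sound (Rel.gen_perm σ x)

/-- Functoriality of formal expressions. -/
def Pre.map {E : SMod.{u, v} k} {F : SMod.{u, w} k} (φ : E.Hom F) :
    ∀ {r : ℕ} {d : Deg}, Pre E r d → Pre F r d
  | _, _, .gen x => .gen (φ.toFun _ _ x)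
  | _, _, .one => .one
  | _, _, .perm σ a => .perm σ (a.map φ)
  | _, _, .comp h hd i a b => .comp h hd i (a.map φ) (b.map φ)
  | _, _, .zero => .zero
  | _, _, .add a b => .add (a.map φ) (b.map φ)
  | _, _, .smul c a => .smul c (a.map φ)

theorem Rel.map {E : SMod.{u, v} k} {F : SMod.{u, w} k} (φ : E.Hom F) {r : ℕ} {d : Deg}
    {a b : Pre E r d} (h : Rel E a b) : Rel F (a.map φ) (b.map φ) := by
  induction h <;> simp only [Pre.map, map_add, map_smul, φ.map_perm] <;>
    constructor <;> assumption

/-- The operad morphism `F(E) → F(E')` induced by a morphism `E → E'`. -/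
def Free.map {E : SMod.{u, v} k} {F : SMod.{u, w} k} (φ : E.Hom F) (r : ℕ) (d : Deg) :
    (Free E).carrier r d →ₗ[k] (Free F).carrier r d where
  toFun := Quot.map (Pre.map φ) (fun _ _ h => h.map φ)
  map_add' := by rintro ⟨a⟩ ⟨b⟩; rfl
  map_smul' := by rintro c ⟨a⟩; rfl

/-- The weight `2` part `F(E)⁽²⁾ = E ∘₍₁₎ E` of the free operad: it is spanned by the partial
composites of two generators, with permuted inputs. -/
def weightTwo (E : SMod.{u, v} k) (r : ℕ) (d : Deg) : Submodule k ((Free E).carrier r d) :=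
  Submodule.span k {z | ∃ (m n : ℕ) (e f : Deg) (h : r + 1 = m + n) (hd : d = e + f) (i : Fin m)
    (x : E.carrier m e) (y : E.carrier n f) (σ : Equiv.Perm (Fin r)),
    z = (Free E).perm σ ((Free E).comp h hd i (gen E m e x) (gen E n f y))}

end Free

/-! ## Quadratic operads -/

/-- A quadratic presentation: a reduced `𝕊`-module `E` of generators together with a
sub-`𝕊`-module `R ⊆ F(E)⁽²⁾` of relations of weight `2`. -/
structure QuadraticData (k : Type u) [CommRing k] where
  E : SMod.{u, v} k
  reduced : ∀ d, Subsingleton (E.carrier 0 d)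
  R : ∀ r d, Submodule k ((Free E).carrier r d)
  R_le : ∀ r d, R r d ≤ weightTwo E r d
  R_perm : ∀ {r d} (σ : Equiv.Perm (Fin r)) {x : (Free E).carrier r d},
    x ∈ R r d → (Free E).perm σ x ∈ R r d

/-- The quadratic operad `P(E, R) = F(E) / (R)`. -/
def QuadraticData.operad {k : Type u} [CommRing k] (X : QuadraticData.{u, v} k) :
    OperadData.{u, max u v} k :=
  quotient (Free X.E) (idealSpan (Free X.E) X.R)

/-- The map from the generators `E` to `P(E, R)`. -/
def QuadraticData.ι {k : Type u} [CommRing k] (X : QuadraticData.{u, v} k) (r : ℕ) (d : Deg) :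
    X.E.carrier r d →ₗ[k] X.operad.carrier r d :=
  (((idealSpan (Free X.E) X.R).carrier r d).mkQ).comp (gen X.E r d)

/-! ## The derived operad

Let `𝒟 = k[ε]/(ε²)` be the algebra of dual numbers, with `ε` in bidegree `(-1, 0)`, regarded as an
operad concentrated in arity `1`. The `𝕊`-module `O ∘ 𝒟` is `O(r) ⊗ 𝒟^{⊗ r}` in arity `r`. The
module `𝒟^{⊗ r}` is free on the words `ε^S = ε^{s₁} ⊗ ⋯ ⊗ ε^{s_r}`, one for each set of positions
`S ⊆ {1, …, r}`, where `s_j = 1` if `j ∈ S` and `s_j = 0` otherwise. The word `ε^S` has bidegree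
`(-#S, 0)`. Hence an element of `O ∘ 𝒟` of bidegree `d` is a family of elements
`x_S ∈ O(r)` of bidegree `d + (#S, 0)`, which stands for `∑_S (x_S; ε^{s₁}, …, ε^{s_r})`. -/

section Derived

variable {k : Type u} [CommRing k]

/-- The bidegree of `μ` when `(μ; ε^S)` has bidegree `d`. -/
def shift {r : ℕ} (d : Deg) (S : Finset (Fin r)) : Deg := d + ((S.card : ℤ), 0)

/-- The component of `O ∘ 𝒟` of arity `r` and bidegree `d`. -/
abbrev DerivedCarrier (O : OperadData.{u, v} k) (r : ℕ) (d : Deg) : Type v :=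
  ∀ S : Finset (Fin r), O.carrier r (shift d S)

/-- The elementary tensor `(μ; ε^{s₁}, …, ε^{s_r})`. -/
def elementary (O : OperadData.{u, v} k) {r : ℕ} {d e : Deg} (S : Finset (Fin r))
    (h : e = shift d S) : O.carrier r e →ₗ[k] DerivedCarrier O r d :=
  (LinearMap.single k (fun S => O.carrier r (shift d S)) S).comp (O.castDeg h)

/-- The Koszul sign of the action of `σ` on the word `ε^S`, whose letters `ε` are odd. -/
def wordSign {r : ℕ} (σ : Equiv.Perm (Fin r)) (S : Finset (Fin r)) : ℤˣ :=
  (-1) ^ ((S ×ˢ S).filter (fun p => p.1 < p.2 ∧ σ p.2 < σ p.1)).card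

/-- The number of pairs `(b, t) ∈ B × T` with `t < b`. -/
def crossings {r : ℕ} (B T : Finset (Fin r)) : ℕ :=
  ((B ×ˢ T).filter (fun p => p.2 < p.1)).card

/-- The words `ε^B` which appear both in `φ(ε^{s_i}; ν)`, and with nonzero product `ε^B ε^T`.
Here `φ` is the distributive law, so `B = ∅` if `s_i = 0`, and `B` has one element if `s_i = 1`. -/
abbrev DistribIndex {m n : ℕ} (i : Fin m) (S : Finset (Fin m)) (T : Finset (Fin n)) : Type :=
  {B : Finset (Fin n) // B.card = (if i ∈ S then 1 else 0) ∧ Disjoint B T}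

/-- The positions of the letters `ε` in an `i`-th partial composite, if their positions are `S` in
the first factor (the letter at the position `i` having been removed) and `C` in the second one. -/
noncomputable def graft {m n l : ℕ} (h : l + 1 = m + n) (i : Fin m) (S : Finset (Fin m))
    (C : Finset (Fin n)) : Finset (Fin l) :=
  ((S.subtype (fun a => a ≠ i)).disjSum C).map (slot h i).toEmbedding

theorem card_graft {m n l : ℕ} (h : l + 1 = m + n) (i : Fin m) (S : Finset (Fin m))
    (T : Finset (Fin n)) (B : DistribIndex i S T) :
    (graft h i S (B.1 ∪ T)).card = S.card + T.card := by
  rw [graft, Finset.card_map, Finset.card_disjSum, Finset.card_subtype,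
    Finset.card_union_of_disjoint B.2.2, B.2.1, Finset.filter_ne']
  split_ifs with hi
  · have := Finset.card_pos.2 ⟨i, hi⟩
    rw [Finset.card_erase_of_mem hi]
    omega
  · rw [Finset.erase_eq_of_notMem hi]
    omega

theorem shift_graft {m n l : ℕ} {d e f : Deg} (h : l + 1 = m + n) (hd : f = d + e) (i : Fin m)
    (S : Finset (Fin m)) (T : Finset (Fin n)) (B : DistribIndex i S T) :
    shift f (graft h i S (B.1 ∪ T)) = shift d S + shift e T := by
  subst hd
  ext
  · simp [shift, card_graft h i S T B]
    ring
  · simp [shift]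

/-- The sign of the summand of `(μ; ε^S) ∘ᵢ (ν; ε^T)` indexed by `B`, where `v = |ν|`. It is the
product of the following signs, which arise from the composition of `O ∘ 𝒟` induced by the
distributive law `φ(1; ν) = (ν; 1, …, 1)`, `φ(ε; ν) = (-1)^{|ν|} ∑_b (ν; 1, …, ε, …, 1)`:
* `(ν; ε^T)` moves to the left past the letters `ε` of `ε^S` at positions `> i`;
* the sign `(-1)^{|ν|}` in `φ(ε; ν)`, if `ε^S` has a letter `ε` at the position `i`;
* `ν` moves to the left past the letters `ε` of `ε^S` at positions `< i`;
* the sign of the product `ε^B ε^T = ± ε^{B ∪ T}` in the algebra `𝒟^{⊗ n}`. -/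
def compSign {m n : ℕ} (v : ℤ) (i : Fin m) (S : Finset (Fin m)) (T B : Finset (Fin n)) : ℤˣ :=
  Int.negOnePow ((v + T.card) * (S.filter (fun s => i < s)).card) *
    Int.negOnePow (if i ∈ S then v else 0) *
    Int.negOnePow (v * (S.filter (fun s => s < i)).card) *
    Int.negOnePow (crossings B T)

/-- The partial composite of elementary tensors in `O ∘ 𝒟`,
`(μ; ε^S) ∘ᵢ (ν; ε^T) = ∑_B ± (μ ∘ᵢ ν; …, ε^B ε^T, …)`, as a bilinear map of `μ` and `ν`. -/
noncomputable def elementaryComp (O : OperadData.{u, v} k) {m n l : ℕ} {d e f : Deg}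
    (h : l + 1 = m + n) (hd : f = d + e) (i : Fin m) (S : Finset (Fin m)) (T : Finset (Fin n)) :
    O.carrier m (shift d S) →ₗ[k] O.carrier n (shift e T) →ₗ[k] DerivedCarrier O l f :=
  ∑ B : DistribIndex i S T, compSign (tot (shift e T)) i S T B.1 •
    (O.comp h (shift_graft h hd i S T B) i).compr₂
      (LinearMap.single k (fun U => O.carrier l (shift f U)) (graft h i S (B.1 ∪ T)))

/-- The diagonal action of a permutation, `σ (μ; ε^S) = ± (σ μ; ε^{σ S})`, extended linearly. -/
def derivedPerm (O : OperadData.{u, v} k) {r : ℕ} {d : Deg} (σ : Equiv.Perm (Fin r)) :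
    DerivedCarrier O r d →ₗ[k] DerivedCarrier O r d :=
  ∑ S : Finset (Fin r), wordSign σ S •
    (elementary O (d := d) (S.map σ.toEmbedding) (by simp [shift])).comp
      ((O.perm σ).comp (LinearMap.proj S))

/-- The partial composites of `O ∘_φ 𝒟`, extended bilinearly from elementary tensors. -/
noncomputable def derivedComp (O : OperadData.{u, v} k) {m n l : ℕ} {d e f : Deg}
    (h : l + 1 = m + n) (hd : f = d + e) (i : Fin m) :
    DerivedCarrier O m d →ₗ[k] DerivedCarrier O n e →ₗ[k] DerivedCarrier O l f :=
  ∑ S : Finset (Fin m), ∑ T : Finset (Fin n),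
    (elementaryComp O h hd i S T).compl₁₂ (LinearMap.proj S) (LinearMap.proj T)

/-- The derived operad `D(O) = O ∘_φ 𝒟`. -/
noncomputable def derived (O : OperadData.{u, v} k) : OperadData.{u, v} k where
  carrier := DerivedCarrier O
  perm := derivedPerm O
  one := elementary O ∅ (by ext <;> simp [shift]) O.one
  comp := derivedComp O

/-- The inclusion `O → D(O)`, `μ ↦ (μ; 1, …, 1)`. -/
def derivedInl (O : OperadData.{u, v} k) (r : ℕ) (d : Deg) :
    O.carrier r d →ₗ[k] (derived O).carrier r d :=
  elementary O ∅ (by simp [shift])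

/-- The element `ε = (1; ε)` of `D(O)`. -/
def derivedEps (O : OperadData.{u, v} k) : (derived O).carrier 1 (-1, 0) :=
  elementary O {0} (by ext <;> simp [shift]) O.one

end Derived

/-! ## The presentation -/

section Presentation

variable {k : Type u} [CommRing k]

/-- The components of the `𝕊`-module `k · ε`, free on a generator of arity `1` and bidegree
`(-1, 0)`. -/
def epsCarrier (k : Type u) [CommRing k] (r : ℕ) (d : Deg) : Submodule k k :=
  if r = 1 ∧ d = (-1, 0) then ⊤ else ⊥

/-- The `𝕊`-module `E ⊕ k · ε`. -/
def addEps (E : SMod.{u, v} k) : SMod.{u, max u v} k where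
  carrier r d := E.carrier r d × epsCarrier k r d
  perm r d :=
    { toFun := fun σ => LinearMap.prodMap (E.perm r d σ) LinearMap.id
      map_one' := by ext <;> simp
      map_mul' := fun σ τ => by ext <;> simp }

/-- The inclusion `E → E ⊕ k · ε`. -/
def inlHom (E : SMod.{u, v} k) : E.Hom (addEps E) where
  toFun _ _ := LinearMap.inl k _ _
  map_perm _ _ := Prod.ext rfl rfl

/-- The generator `ε` of `F(E ⊕ k · ε)`. -/
def eps (E : SMod.{u, v} k) : (Free (addEps E)).carrier 1 (-1, 0) :=
  gen (addEps E) 1 (-1, 0) (0, ⟨1, by simp [epsCarrier]⟩)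

/-- The generator of `F(E ⊕ k · ε)` given by an element of `E`. -/
def genInl (E : SMod.{u, v} k) (r : ℕ) (d : Deg) :
    E.carrier r d →ₗ[k] (Free (addEps E)).carrier r d :=
  (gen (addEps E) r d).comp ((inlHom E).toFun r d)

/-- The linear map `μ ↦ ε ∘₁ μ - (-1)^{|μ|} ∑ᵢ μ ∘ᵢ ε`. -/
def relMap (E : SMod.{u, v} k) (r : ℕ) (d : Deg) :
    E.carrier r (d + (1, 0)) →ₗ[k] (Free (addEps E)).carrier r d :=
  (((Free (addEps E)).comp (l := r) (n := r) (f := d) (e := d + (1, 0))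
      (Nat.add_comm r 1) (by ext <;> simp) 0 (eps E))
    - Int.negOnePow (tot (d + (1, 0))) • ∑ i : Fin r,
      ((Free (addEps E)).comp (l := r) (m := r) (f := d) (d := d + (1, 0))
        rfl (by ext <;> simp) i).flip (eps E)).comp (genInl E r (d + (1, 0)))

/-- The sub-`𝕊`-module `D` of `F(E ⊕ k · ε)⁽²⁾`. -/
def relD (E : SMod.{u, v} k) (r : ℕ) (d : Deg) : Submodule k ((Free (addEps E)).carrier r d) :=
  LinearMap.range (relMap E r d)

/-- The sub-`𝕊`-module `k · ε²` of `F(E ⊕ k · ε)⁽²⁾`, where `ε² = ε ∘₁ ε`. -/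
def relEpsSq (E : SMod.{u, v} k) (r : ℕ) (d : Deg) :
    Submodule k ((Free (addEps E)).carrier r d) :=
  Submodule.span k {z | ∃ (h : r + 1 = 1 + 1) (hd : d = (-1, 0) + (-1, 0)),
    z = (Free (addEps E)).comp h hd 0 (eps E) (eps E)}

/-- The image of `R` in `F(E ⊕ k · ε)`. -/
def relR (X : QuadraticData.{u, v} k) (r : ℕ) (d : Deg) :
    Submodule k ((Free (addEps X.E)).carrier r d) :=
  (X.R r d).map (Free.map (inlHom X.E) r d)

theorem blockPerm_one_left {r : ℕ} (h : r + 1 = 1 + r) (i : Fin 1) (σ : Equiv.Perm (Fin r)) :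
    blockPerm h i 1 σ = σ := by
  have key : ∀ (j : Fin 1) (b : Fin r), slot h j (Sum.inr b) = b := by
    intro j b
    apply Fin.ext
    simp [slot, slotFun]
  apply Equiv.ext
  intro b
  have hb : (slot h i).symm b = Sum.inr b := by
    rw [Equiv.symm_apply_eq, key]
  simp [blockPerm, hb, key]

theorem blockPerm_one_right {r : ℕ} (h : r + 1 = r + 1) (i : Fin r) (σ : Equiv.Perm (Fin r)) :
    blockPerm h i σ (1 : Equiv.Perm (Fin 1)) = σ := by
  have key : ∀ (i : Fin r) (b : Fin 1), slot h i (Sum.inr b) = i := by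
    intro j b
    apply Fin.ext
    simp [slot, slotFun]
  have key' : ∀ (i : Fin r) (a : {a : Fin r // a ≠ i}), slot h i (Sum.inl a) = a.1 := by
    intro i a
    apply Fin.ext
    simp [slot, slotFun]
  apply Equiv.ext
  intro b
  by_cases hb : b = i
  · subst hb
    have hb : (slot h b).symm b = Sum.inr 0 := by
      rw [Equiv.symm_apply_eq, key]
    simp [blockPerm, hb, key]
  · have hb : (slot h i).symm b = Sum.inl ⟨b, hb⟩ := by
      rw [Equiv.symm_apply_eq, key']
    simp [blockPerm, hb, key']

theorem relMap_apply (E : SMod.{u, v} k) (r : ℕ) (d : Deg) (x : E.carrier r (d + (1, 0))) :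
    relMap E r d x =
      (Free (addEps E)).comp (Nat.add_comm r 1) (by ext <;> simp) 0 (eps E)
        (genInl E r (d + (1, 0)) x) -
      Int.negOnePow (tot (d + (1, 0))) • ∑ i : Fin r,
        (Free (addEps E)).comp rfl (by ext <;> simp) i (genInl E r (d + (1, 0)) x) (eps E) := by
  simp [relMap]

theorem genInl_perm (E : SMod.{u, v} k) {r : ℕ} {d : Deg} (σ : Equiv.Perm (Fin r))
    (x : E.carrier r d) :
    genInl E r d (E.perm r d σ x) = (Free (addEps E)).perm σ (genInl E r d x) := by
  simp only [genInl, LinearMap.comp_apply, (inlHom E).map_perm, gen_perm]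

theorem relMap_perm (E : SMod.{u, v} k) {r : ℕ} {d : Deg} (σ : Equiv.Perm (Fin r))
    (x : E.carrier r (d + (1, 0))) :
    relMap E r d (E.perm r _ σ x) = (Free (addEps E)).perm σ (relMap E r d x) := by
  have hF := free_isOperad (addEps E)
  rw [relMap_apply, relMap_apply, map_sub]
  congr 1
  · have := hF.comp_perm (Nat.add_comm r 1) (show d = (-1, 0) + (d + (1, 0)) by ext <;> simp)
      0 1 σ (eps E) (genInl E r _ x)
    rw [hF.perm_one, blockPerm_one_left, ← genInl_perm] at this
    exact this
  · rw [Units.smul_def, Units.smul_def, map_zsmul, map_sum]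
    congr 1
    rw [← Equiv.sum_comp σ]
    refine Finset.sum_congr rfl fun i _ => ?_
    have := hF.comp_perm rfl (show d = (d + (1, 0)) + (-1, 0) by ext <;> simp)
      i σ 1 (genInl E r _ x) (eps E)
    rw [hF.perm_one, blockPerm_one_right, ← genInl_perm] at this
    exact this

theorem comp_mem_weightTwo (E : SMod.{u, v} k) {m n l : ℕ} {d e f : Deg} (h : l + 1 = m + n)
    (hd : f = d + e) (i : Fin m) (x : E.carrier m d) (y : E.carrier n e) :
    (Free E).comp h hd i (gen E m d x) (gen E n e y) ∈ weightTwo E l f :=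
  Submodule.subset_span ⟨m, n, d, e, h, hd, i, x, y, 1, ((free_isOperad E).perm_one _).symm⟩

theorem map_mem_weightTwo {E : SMod.{u, v} k} {F : SMod.{u, w} k} (φ : E.Hom F) {r : ℕ} {d : Deg}
    {z : (Free E).carrier r d} (hz : z ∈ weightTwo E r d) :
    Free.map φ r d z ∈ weightTwo F r d := by
  suffices h : weightTwo E r d ≤ (weightTwo F r d).comap (Free.map φ r d) from h hz
  refine Submodule.span_le.2 ?_
  rintro _ ⟨m, n, e, f, h, hd, i, x, y, σ, rfl⟩
  exact Submodule.subset_span ⟨m, n, e, f, h, hd, i, φ.toFun _ _ x, φ.toFun _ _ y, σ, rfl⟩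

theorem Free.map_perm {E : SMod.{u, v} k} {F : SMod.{u, w} k} (φ : E.Hom F) {r : ℕ} {d : Deg}
    (σ : Equiv.Perm (Fin r)) (z : (Free E).carrier r d) :
    Free.map φ r d ((Free E).perm σ z) = (Free F).perm σ (Free.map φ r d z) := by
  obtain ⟨a⟩ := z
  rfl

/-- The quadratic presentation with generators `E ⊕ k · ε` and relations `R ⊕ D ⊕ k · ε²`. -/
def QuadraticData.derived (X : QuadraticData.{u, v} k) : QuadraticData.{u, max u v} k where
  E := addEps X.E
  reduced d := by
    have := X.reduced d
    have h : Subsingleton (epsCarrier k 0 d) := by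
      simp only [epsCarrier, zero_ne_one, false_and, if_false]
      infer_instance
    exact inferInstanceAs (Subsingleton (X.E.carrier 0 d × epsCarrier k 0 d))
  R r d := relR X r d ⊔ relD X.E r d ⊔ relEpsSq X.E r d
  R_le r d := by
    refine sup_le (sup_le ?_ ?_) ?_
    · rintro _ ⟨z, hz, rfl⟩
      exact map_mem_weightTwo _ (X.R_le r d hz)
    · rintro _ ⟨x, rfl⟩
      rw [relMap_apply, Units.smul_def]
      refine Submodule.sub_mem _ (comp_mem_weightTwo _ _ _ _ _ _) (zsmul_mem ?_ _)
      exact Submodule.sum_mem _ fun i _ => comp_mem_weightTwo _ _ _ _ _ _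
    · refine Submodule.span_le.2 ?_
      rintro _ ⟨h, hd, rfl⟩
      exact comp_mem_weightTwo _ _ _ _ _ _
  R_perm {r d} σ x hx := by
    have key : relR X r d ⊔ relD X.E r d ⊔ relEpsSq X.E r d ≤
        (relR X r d ⊔ relD X.E r d ⊔ relEpsSq X.E r d).comap ((Free (addEps X.E)).perm σ) := by
      refine sup_le (sup_le ?_ ?_) ?_
      · rintro _ ⟨z, hz, rfl⟩
        refine Submodule.mem_sup_left (Submodule.mem_sup_left ?_)
        exact ⟨_, X.R_perm σ hz, Free.map_perm _ σ z⟩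
      · rintro _ ⟨z, rfl⟩
        refine Submodule.mem_sup_left (Submodule.mem_sup_right ?_)
        exact ⟨_, relMap_perm X.E σ z⟩
      · refine Submodule.span_le.2 ?_
        rintro _ ⟨h, hd, rfl⟩
        refine Submodule.mem_sup_right (Submodule.subset_span ⟨h, hd, ?_⟩)
        obtain rfl : r = 1 := by omega
        rw [Subsingleton.elim σ 1, (free_isOperad _).perm_one]
    exact key hx

end Presentation

end DerivedOperad

-- The module `𝒟^{⊗ r}` is the exterior algebra on `r` letters, with the words `ε^S` as a basis. In
-- these terms the explicit signs of the derived operad become a single Koszul sign. If `ω` has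
-- length `p`, then `(μ; ω) ∘ᵢ (ν; η)` is `(-1)^{p|ν|} (μ ∘ᵢ ν; outer(ω) inner(η))`. Here `outer`
-- and `inner` are algebra homomorphisms: `outer` replaces the `i`-th letter by the sum of the
-- letters in the block of the second factor, and `inner` includes that block (`derivedComp_tens`).
-- The operad laws of `D(O)` then follow from those of `O`, from identities of algebra homomorphisms
-- that are checked on letters, and from graded commutativity (`derived_isOperad`).
--
-- For the presentation, the universal property of the free operad gives a morphism from `F(E ⊕ k ·
-- ε)` to `D(P(E, R))`. It kills `R`, `D` and `ε²`, hence descends to the quotient (`toDerived`). No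
-- confluence argument is needed for bijectivity. In any operad, inserting an element `ε` of
-- bidegree `(-1, 0)` with `ε ∘ ε = 0` in the various inputs gives operators which square to zero
-- and anticommute, so the exterior algebra acts on the right (`rightAction`). Sending `(μ; ε^S)` to
-- `j(μ) · ε^S`, with `j` the map from `P(E, R)` to the presented operad, defines a linear map
-- `fromDerived`. Morphisms respect the actions, so this is a section of `toDerived`
-- (`apply_fromDerived`).
--
-- It remains to see that the section is onto. The relation `D` says that `ε` acts on generators
-- from `E` as a signed derivation, and this property passes to all composites (`Derives.comp`).
-- Hence every `ε` can be moved to the inputs, and the elements obtained from the image of `j` by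
-- insertions of `ε` and sums are closed under composition and fill the presented operad
-- (`Generated.comp`, `generated_operad`). A surjective section forces `toDerived` to be bijective.
--
-- The sum of the relations is direct because two morphisms separate them: the one killing `ε` is
-- injective on `R` and kills the other two summands, while the one killing `E` fixes `ε²` and kills
-- `R` and `D`.

universe x

namespace DerivedOperad

/-! ## Exterior algebras -/

section Exterior

/-- The exterior algebra `𝒟^{⊗ r}` on `r` letters. -/
abbrev Lam (k : Type u) [CommRing k] (r : ℕ) : Type u := ExteriorAlgebra k (Fin r → k)

variable (k : Type u) [CommRing k]

/-- The letter `ε` in the position `a`. -/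
noncomputable def letter {r : ℕ} (a : Fin r) : Lam k r := ExteriorAlgebra.ι k (Pi.single a 1)

/-- The basis of words of the exterior algebra. -/
noncomputable def wordBasis (r : ℕ) : Module.Basis (Finset (Fin r)) k (Lam k r) :=
  (Pi.basisFun k (Fin r)).ExteriorAlgebra

/-- The word `ε^S`. -/
noncomputable abbrev word {r : ℕ} (S : Finset (Fin r)) : Lam k r := wordBasis k r S

theorem word_eq_prod {r : ℕ} (S : Finset (Fin r)) :
    word k S = ((S.sort (· ≤ ·)).map (letter k)).prod := by
  rw [word, wordBasis, ExteriorAlgebra.basis_apply_ofCard _ rfl, ExteriorAlgebra.ιMulti_family,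
    ExteriorAlgebra.ιMulti_apply]
  congr 1
  apply List.ext_getElem
  · simp
  · intro i h1 h2
    simp only [List.getElem_ofFn, List.getElem_map, letter, Function.comp_apply,
      Pi.basisFun_apply]
    congr 2

theorem word_empty {r : ℕ} : word k (∅ : Finset (Fin r)) = 1 := by
  simp [word_eq_prod]

variable {k}

theorem word_insert_of_lt {r : ℕ} {a : Fin r} {S : Finset (Fin r)} (h : ∀ s ∈ S, a < s) :
    word k (insert a S) = letter k a * word k S := by
  rw [word_eq_prod, word_eq_prod, Finset.sort_insert _ (fun b hb => (h b hb).le)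
    (fun ha => lt_irrefl _ (h a ha)), List.map_cons, List.prod_cons]

theorem word_singleton {r : ℕ} (a : Fin r) : word k {a} = letter k a := by
  simpa [word_empty] using word_insert_of_lt (k := k) (a := a) (S := ∅) (by simp)

theorem letter_mul_self {r : ℕ} (a : Fin r) : letter k a * letter k a = 0 :=
  ExteriorAlgebra.ι_sq_zero _

theorem letter_mul_letter {r : ℕ} (a b : Fin r) :
    letter k a * letter k b = -(letter k b * letter k a) :=
  eq_neg_of_add_eq_zero_left (ExteriorAlgebra.ι_add_mul_swap _ _)

/-- The new letter is moved to its place in the sorted word: it passes the smaller letters of `T`,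
with one sign for each, and vanishes if it meets itself. -/
theorem letter_mul_word {r : ℕ} (a : Fin r) (T : Finset (Fin r)) :
    letter k a * word k T = if a ∈ T then 0 else
      Int.negOnePow ((T.filter (fun t => t < a)).card) • word k (insert a T) := by
  induction T using Finset.induction_on_min with
  | empty => simp [word_singleton, word_empty]
  | insert b T hb ih =>
    have hbT : b ∉ T := fun h => lt_irrefl _ (hb b h)
    rw [word_insert_of_lt hb]
    rcases lt_trichotomy a b with hab | rfl | hab
    · have h1 : ∀ t ∈ insert b T, a < t := by
        intro t ht
        rcases Finset.mem_insert.1 ht with rfl | ht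
        · exact hab
        · exact hab.trans (hb t ht)
      have h2 : a ∉ insert b T := fun h => lt_irrefl _ (h1 a h)
      have h3 : (insert b T).filter (fun t => t < a) = ∅ :=
        Finset.filter_eq_empty_iff.2 fun t ht => (h1 t ht).not_gt
      rw [if_neg h2, h3, word_insert_of_lt h1, word_insert_of_lt hb]
      simp
    · rw [← mul_assoc, letter_mul_self, zero_mul, if_pos (Finset.mem_insert_self _ _)]
    · rw [← mul_assoc, letter_mul_letter, neg_mul, mul_assoc, ih]
      by_cases ha : a ∈ T
      · simp [ha]
      · have h2 : a ∉ insert b T := by simp [ha, hab.ne']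
        have h4 : ∀ t ∈ insert a T, b < t := by
          intro t ht
          rcases Finset.mem_insert.1 ht with rfl | ht
          · exact hab
          · exact hb t ht
        rw [if_neg ha, if_neg h2, Finset.filter_insert, if_pos hab,
          Finset.card_insert_of_notMem (fun h => hbT (Finset.mem_filter.1 h).1),
          Finset.insert_comm, word_insert_of_lt h4, Nat.cast_succ, Int.negOnePow_succ,
          mul_smul_comm, Units.neg_smul]

theorem crossings_eq_sum {r : ℕ} (S T : Finset (Fin r)) :
    crossings S T = ∑ s ∈ S, ∑ t ∈ T, if t < s then 1 else 0 := by
  rw [crossings, Finset.card_filter, Finset.sum_product]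

theorem crossings_insert {r : ℕ} {a : Fin r} {S : Finset (Fin r)} (h : a ∉ S)
    (T : Finset (Fin r)) :
    crossings (insert a S) T = (T.filter (fun t => t < a)).card + crossings S T := by
  rw [crossings_eq_sum, crossings_eq_sum, Finset.sum_insert h, Finset.card_filter]

/-- The letters of `S` are multiplied onto `word k T` from the largest to the smallest; the sign
counts the transpositions that sort the product. This is the factor `crossings B T` of `compSign`.
-/
theorem word_mul_word {r : ℕ} (S T : Finset (Fin r)) :
    word k S * word k T = if Disjoint S T then
      Int.negOnePow (crossings S T) • word k (S ∪ T) else 0 := by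
  induction S using Finset.induction_on_min with
  | empty => simp [word_empty, crossings]
  | insert a S ha ih =>
    have haS : a ∉ S := fun h => lt_irrefl _ (ha a h)
    rw [word_insert_of_lt ha, mul_assoc, ih]
    by_cases hST : Disjoint S T
    · rw [if_pos hST, mul_smul_comm, letter_mul_word]
      by_cases haT : a ∈ T
      · simp [haT]
      -- The letter `a` precedes all of `S`, so it passes only letters of `T`.
      · have h1 : (S ∪ T).filter (fun t => t < a) = T.filter (fun t => t < a) := by
          rw [Finset.filter_union, Finset.filter_eq_empty_iff.2 fun t ht => (ha t ht).not_gt,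
            Finset.empty_union]
        rw [if_neg (by simp [haS, haT]), if_pos (by simp [haT, hST]), h1, crossings_insert haS,
          Nat.cast_add, Int.negOnePow_add, smul_smul, mul_comm, Finset.insert_union]
    · rw [if_neg hST, mul_zero, if_neg (by simp [hST])]

theorem word_mul_word_of_lt {r : ℕ} {S T : Finset (Fin r)} (h : ∀ s ∈ S, ∀ t ∈ T, s < t) :
    word k S * word k T = word k (S ∪ T) := by
  have h1 : crossings S T = 0 := by
    rw [crossings, Finset.card_eq_zero, Finset.filter_eq_empty_iff]
    rintro ⟨x, y⟩ hxy
    exact (h _ (Finset.mem_product.1 hxy).1 _ (Finset.mem_product.1 hxy).2).not_gt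
  have h2 : Disjoint S T := Finset.disjoint_left.2 fun s hs ht => lt_irrefl _ (h s hs s ht)
  rw [word_mul_word, if_pos h2, h1]
  simp

/-- In a pair of distinct positions exactly one precedes the other, so each pair is counted once.
Graded commutativity of words rests on this. -/
theorem crossings_add_crossings {r : ℕ} {S T : Finset (Fin r)} (h : Disjoint S T) :
    crossings S T + crossings T S = S.card * T.card := by
  rw [crossings_eq_sum, crossings_eq_sum, Finset.sum_comm (s := T), ← Finset.sum_add_distrib,
    ← smul_eq_mul, ← Finset.sum_const]
  refine Finset.sum_congr rfl fun s hs => ?_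
  rw [← Finset.sum_add_distrib, Finset.card_eq_sum_ones]
  refine Finset.sum_congr rfl fun t ht => ?_
  have : s ≠ t := fun e => Finset.disjoint_left.1 h hs (e ▸ ht)
  rcases lt_or_gt_of_ne this with h1 | h1 <;> simp [h1, h1.not_gt]

/-- The words of a given length span the graded piece. -/
noncomputable def gr (k : Type u) [CommRing k] (r p : ℕ) : Submodule k (Lam k r) :=
  Submodule.span k {ω | ∃ S : Finset (Fin r), S.card = p ∧ ω = word k S}

theorem word_mem_gr {r : ℕ} (S : Finset (Fin r)) : word k S ∈ gr k r S.card :=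
  Submodule.subset_span ⟨S, rfl, rfl⟩

theorem one_mem_gr {r : ℕ} : (1 : Lam k r) ∈ gr k r 0 := by
  simpa [word_empty] using word_mem_gr (k := k) (∅ : Finset (Fin r))

theorem letter_mem_gr {r : ℕ} (a : Fin r) : letter k a ∈ gr k r 1 := by
  simpa [word_singleton] using word_mem_gr (k := k) ({a} : Finset (Fin r))

theorem ι_eq_sum_letter {r : ℕ} (x : Fin r → k) :
    ExteriorAlgebra.ι k x = ∑ a, x a • letter k a := by
  conv_lhs => rw [pi_eq_sum_univ' x]
  simp [letter, map_sum, map_smul]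

theorem ι_mem_gr {r : ℕ} (x : Fin r → k) : ExteriorAlgebra.ι k x ∈ gr k r 1 := by
  rw [ι_eq_sum_letter]
  exact Submodule.sum_mem _ fun a _ => Submodule.smul_mem _ _ (letter_mem_gr a)

theorem smul_units_mem {M : Type*} [AddCommGroup M] [Module k M] (N : Submodule k M) (s : ℤˣ)
    {x : M} (hx : x ∈ N) : s • x ∈ N := by
  rw [Units.smul_def]
  exact zsmul_mem hx _

theorem mul_mem_gr {r p q : ℕ} {ω η : Lam k r} (hω : ω ∈ gr k r p) (hη : η ∈ gr k r q) :
    ω * η ∈ gr k r (p + q) := by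
  refine (Submodule.mul_le (P := gr k r (p + q))).1 ?_ ω hω η hη
  rw [gr, gr, Submodule.span_mul_span, Submodule.span_le]
  rintro _ ⟨_, ⟨S, rfl, rfl⟩, _, ⟨T, rfl, rfl⟩, rfl⟩
  dsimp only
  rw [word_mul_word]
  split_ifs with h
  · refine smul_units_mem _ _ ?_
    rw [← Finset.card_union_of_disjoint h]
    exact word_mem_gr _
  · exact Submodule.zero_mem _

/-- A homomorphism induced by a linear map of letters preserves length. The sign of a composite
depends on the length, so this is needed whenever composites are iterated. -/
theorem map_mem_gr {m n p : ℕ} (f : (Fin m → k) →ₗ[k] (Fin n → k)) {ω : Lam k m}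
    (hω : ω ∈ gr k m p) : ExteriorAlgebra.map f ω ∈ gr k n p := by
  suffices h : gr k m p ≤ (gr k n p).comap (ExteriorAlgebra.map f).toLinearMap from h hω
  rw [gr, Submodule.span_le]
  rintro _ ⟨S, rfl, rfl⟩
  clear hω
  rw [SetLike.mem_coe, Submodule.mem_comap, AlgHom.toLinearMap_apply]
  induction S using Finset.induction_on_min with
  | empty => simpa [word_empty] using one_mem_gr
  | insert a S ha ih =>
    rw [word_insert_of_lt ha, map_mul, Finset.card_insert_of_notMem
      (fun h => lt_irrefl _ (ha a h)), add_comm, letter, ExteriorAlgebra.map_apply_ι]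
    exact mul_mem_gr (ι_mem_gr _) ih

theorem gr_induction {r p : ℕ} {motive : Lam k r → Prop} {ω : Lam k r} (hω : ω ∈ gr k r p)
    (hword : ∀ S, S.card = p → motive (word k S))
    (hzero : motive 0) (hadd : ∀ x y, motive x → motive y → motive (x + y))
    (hsmul : ∀ (c : k) x, motive x → motive (c • x)) : motive ω := by
  induction hω using Submodule.span_induction with
  | mem x hx => obtain ⟨S, hS, rfl⟩ := hx; exact hword S hS
  | zero => exact hzero
  | add x y _ _ hx hy => exact hadd x y hx hy
  | smul c x _ hx => exact hsmul c x hx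

theorem mul_comm_gr {r p q : ℕ} {ω η : Lam k r} (hω : ω ∈ gr k r p) (hη : η ∈ gr k r q) :
    ω * η = Int.negOnePow (p * q) • (η * ω) := by
  refine gr_induction (motive := fun ω => ω * η = Int.negOnePow (p * q) • (η * ω)) hω
    (fun S hS => ?_) (by simp)
    (fun x y hx hy => by rw [add_mul, mul_add, smul_add, hx, hy])
    (fun c x hx => by rw [smul_mul_assoc, mul_smul_comm, hx, smul_comm])
  refine gr_induction (motive := fun η => word k S * η = Int.negOnePow (p * q) • (η * word k S))
    hη (fun T hT => ?_) (by simp)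
    (fun x y hx hy => by rw [add_mul, mul_add, smul_add, hx, hy])
    (fun c x hx => by rw [smul_mul_assoc, mul_smul_comm, hx, smul_comm])
  rw [word_mul_word, word_mul_word, Finset.union_comm T S]
  by_cases h : Disjoint S T
  · rw [if_pos h, if_pos h.symm]
    have := crossings_add_crossings h
    rw [smul_smul, ← Int.negOnePow_add]
    congr 1
    rw [Int.negOnePow_eq_iff, ← hS, ← hT, ← Nat.cast_mul, ← this]
    push_cast
    -- The two exponents differ by twice `crossings T S`.
    exact ⟨-crossings T S, by ring⟩
  · rw [if_neg h, if_neg (fun h' => h h'.symm), smul_zero]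

/-- The letters generate the exterior algebra, so the operadic identities below need only be checked
on letters. -/
theorem alg_hom_ext {m : ℕ} {A : Type*} [Semiring A] [Algebra k A] {f g : Lam k m →ₐ[k] A}
    (h : ∀ a, f (letter k a) = g (letter k a)) : f = g := by
  apply ExteriorAlgebra.hom_ext
  apply LinearMap.pi_ext'
  intro a
  apply LinearMap.ext_ring
  exact h a

end Exterior
end DerivedOperad

namespace DerivedOperad

/-! ### Positions of inputs in iterated partial composites -/

section Slots

theorem slot_inl_val {m n l : ℕ} (h : l + 1 = m + n) (i : Fin m) (a : {a : Fin m // a ≠ i}) :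
    (slot h i (Sum.inl a) : ℕ) = if (a.1 : ℕ) < i then (a.1 : ℕ) else a.1 + n - 1 := rfl

theorem slot_inr_val {m n l : ℕ} (h : l + 1 = m + n) (i : Fin m) (b : Fin n) :
    (slot h i (Sum.inr b) : ℕ) = i + b := rfl

theorem slot_inl_ne_inr {m n l : ℕ} (h : l + 1 = m + n) (i : Fin m) (a : {a : Fin m // a ≠ i})
    (b : Fin n) : slot h i (Sum.inl a) ≠ slot h i (Sum.inr b) :=
  fun e => Sum.inl_ne_inr ((slot h i).injective e)

theorem slot_inl_ne_inl {m n l : ℕ} (h : l + 1 = m + n) (i : Fin m) {a b : {a : Fin m // a ≠ i}}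
    (hab : a.1 ≠ b.1) : slot h i (Sum.inl a) ≠ slot h i (Sum.inl b) :=
  fun e => hab (congrArg Subtype.val (Sum.inl_injective ((slot h i).injective e)))

theorem slot_inr_ne_inr {m n l : ℕ} (h : l + 1 = m + n) (i : Fin m) {a b : Fin n}
    (hab : a ≠ b) : slot h i (Sum.inr a) ≠ slot h i (Sum.inr b) :=
  fun e => hab (Sum.inr_injective ((slot h i).injective e))

theorem slot_one_inr {r : ℕ} (h : r + 1 = 1 + r) (i : Fin 1) (b : Fin r) :
    slot h i (Sum.inr b) = b := by
  apply Fin.ext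
  simp [slot_inr_val]

theorem slot_inl_one {r : ℕ} (h : r + 1 = r + 1) (i : Fin r) (a : {a : Fin r // a ≠ i}) :
    slot h i (Sum.inl a : _ ⊕ Fin 1) = a.1 := by
  apply Fin.ext
  simp [slot_inl_val]

theorem slot_inr_one {r : ℕ} (h : r + 1 = r + 1) (i : Fin r) (b : Fin 1) :
    slot h i (Sum.inr b) = i := by
  apply Fin.ext
  simp [slot_inr_val]

section Seq

variable {m n r p q l : ℕ} (h₁ : p + 1 = m + n) (h₂ : l + 1 = p + r)
  (h₃ : q + 1 = n + r) (h₄ : l + 1 = m + q) (i : Fin m) (j : Fin n)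

theorem slot_seq_inl (a : {a : Fin m // a ≠ i})
    (ha : slot h₁ i (Sum.inl a) ≠ slot h₁ i (Sum.inr j)) :
    slot h₂ (slot h₁ i (Sum.inr j)) (Sum.inl ⟨slot h₁ i (Sum.inl a), ha⟩) =
      slot h₄ i (Sum.inl a) := by
  have h5 : (a.1 : ℕ) ≠ i := fun e => a.2 (Fin.ext e)
  have h6 := j.2
  apply Fin.ext
  simp only [slot_inl_val, slot_inr_val]
  split_ifs <;> omega

theorem slot_seq_mid (b : {b : Fin n // b ≠ j})
    (hb : slot h₁ i (Sum.inr b.1) ≠ slot h₁ i (Sum.inr j)) :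
    slot h₂ (slot h₁ i (Sum.inr j)) (Sum.inl ⟨slot h₁ i (Sum.inr b.1), hb⟩) =
      slot h₄ i (Sum.inr (slot h₃ j (Sum.inl b))) := by
  have h5 : (b.1 : ℕ) ≠ j := fun e => b.2 (Fin.ext e)
  apply Fin.ext
  rw [slot_inl_val, slot_inr_val h₄, slot_inl_val, slot_inr_val, slot_inr_val]
  rcases lt_or_gt_of_ne h5 with h6 | h6
  · rw [if_pos (by omega), if_pos h6]
  · rw [if_neg (by omega), if_neg (by omega)]
    omega

theorem slot_seq_inr (c : Fin r) :
    slot h₂ (slot h₁ i (Sum.inr j)) (Sum.inr c) = slot h₄ i (Sum.inr (slot h₃ j (Sum.inr c))) := by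
  apply Fin.ext
  simp only [slot_inr_val]
  omega

end Seq

section Par

variable {m n r p q l : ℕ} (h₁ : p + 1 = m + n) (h₂ : l + 1 = p + r)
  (h₃ : q + 1 = m + r) (h₄ : l + 1 = q + n) {i j : Fin m} (hji : j ≠ i) (hij : i ≠ j)

theorem slot_par_inl (a : Fin m) (hai : a ≠ i) (haj : a ≠ j)
    (h5 : slot h₁ i (Sum.inl ⟨a, hai⟩) ≠ slot h₁ i (Sum.inl ⟨j, hji⟩))
    (h6 : slot h₃ j (Sum.inl ⟨a, haj⟩) ≠ slot h₃ j (Sum.inl ⟨i, hij⟩)) :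
    slot h₂ (slot h₁ i (Sum.inl ⟨j, hji⟩)) (Sum.inl ⟨slot h₁ i (Sum.inl ⟨a, hai⟩), h5⟩) =
      slot h₄ (slot h₃ j (Sum.inl ⟨i, hij⟩)) (Sum.inl ⟨slot h₃ j (Sum.inl ⟨a, haj⟩), h6⟩) := by
  have h7 : (a : ℕ) ≠ i := fun e => hai (Fin.ext e)
  have h8 : (a : ℕ) ≠ j := fun e => haj (Fin.ext e)
  have h9 : (i : ℕ) ≠ j := fun e => hij (Fin.ext e)
  apply Fin.ext
  simp only [slot_inl_val]
  split_ifs <;> omega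

theorem slot_par_mid (b : Fin n)
    (h5 : slot h₁ i (Sum.inr b) ≠ slot h₁ i (Sum.inl ⟨j, hji⟩)) :
    slot h₂ (slot h₁ i (Sum.inl ⟨j, hji⟩)) (Sum.inl ⟨slot h₁ i (Sum.inr b), h5⟩) =
      slot h₄ (slot h₃ j (Sum.inl ⟨i, hij⟩)) (Sum.inr b) := by
  have h9 : (i : ℕ) ≠ j := fun e => hij (Fin.ext e)
  have := b.2
  apply Fin.ext
  simp only [slot_inl_val, slot_inr_val]
  split_ifs <;> omega

end Par

theorem blockPerm_slot_inl {m n l : ℕ} (h : l + 1 = m + n) (i : Fin m)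
    (σ : Equiv.Perm (Fin m)) (τ : Equiv.Perm (Fin n)) (a : Fin m) (ha : a ≠ i) :
    blockPerm h i σ τ (slot h i (Sum.inl ⟨a, ha⟩)) =
      slot h (σ i) (Sum.inl ⟨σ a, σ.injective.ne ha⟩) := by
  simp [blockPerm]

theorem blockPerm_slot_inr {m n l : ℕ} (h : l + 1 = m + n) (i : Fin m)
    (σ : Equiv.Perm (Fin m)) (τ : Equiv.Perm (Fin n)) (b : Fin n) :
    blockPerm h i σ τ (slot h i (Sum.inr b)) = slot h (σ i) (Sum.inr (τ b)) := by
  simp [blockPerm]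

end Slots

/-! ### Operadic identities between homomorphisms of exterior algebras -/

section ExteriorOperad

variable (k : Type u) [CommRing k]

/-- The homomorphism of exterior algebras which distributes the `i`-th letter over the inputs
of the second factor of an `i`-th partial composite. -/
noncomputable def outerAlg {m n l : ℕ} (h : l + 1 = m + n) (i : Fin m) : Lam k m →ₐ[k] Lam k l :=
  ExteriorAlgebra.map ((Pi.basisFun k (Fin m)).constr k (fun a =>
    if ha : a = i then ∑ b : Fin n, (Pi.single (slot h i (Sum.inr b)) 1 : Fin l → k)
    else Pi.single (slot h i (Sum.inl ⟨a, ha⟩)) 1))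

/-- The homomorphism of exterior algebras induced by the inclusion of the inputs
of the second factor of an `i`-th partial composite. -/
noncomputable def innerAlg {m n l : ℕ} (h : l + 1 = m + n) (i : Fin m) : Lam k n →ₐ[k] Lam k l :=
  ExteriorAlgebra.map ((Pi.basisFun k (Fin n)).constr k (fun b =>
    (Pi.single (slot h i (Sum.inr b)) 1 : Fin l → k)))

/-- The action of a permutation on the exterior algebra. -/
noncomputable def permAlg {r : ℕ} (σ : Equiv.Perm (Fin r)) : Lam k r →ₐ[k] Lam k r :=
  ExteriorAlgebra.map ((Pi.basisFun k (Fin r)).constr k (fun a =>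
    (Pi.single (σ a) 1 : Fin r → k)))

variable {k}

theorem constr_single {r : ℕ} {M : Type*} [AddCommGroup M] [Module k M] (g : Fin r → M)
    (a : Fin r) : (Pi.basisFun k (Fin r)).constr k g (Pi.single a 1) = g a := by
  rw [← Pi.basisFun_apply, Module.Basis.constr_basis]

theorem outerAlg_letter_self {m n l : ℕ} (h : l + 1 = m + n) (i : Fin m) :
    outerAlg k h i (letter k i) = ∑ b : Fin n, letter k (slot h i (Sum.inr b)) := by
  rw [outerAlg, letter, ExteriorAlgebra.map_apply_ι, constr_single, dif_pos rfl, map_sum]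
  rfl

theorem outerAlg_letter_of_ne {m n l : ℕ} (h : l + 1 = m + n) (i : Fin m) {a : Fin m}
    (ha : a ≠ i) :
    outerAlg k h i (letter k a) = letter k (slot h i (Sum.inl ⟨a, ha⟩)) := by
  rw [outerAlg, letter, ExteriorAlgebra.map_apply_ι, constr_single, dif_neg ha]
  rfl

theorem innerAlg_letter {m n l : ℕ} (h : l + 1 = m + n) (i : Fin m) (b : Fin n) :
    innerAlg k h i (letter k b) = letter k (slot h i (Sum.inr b)) := by
  rw [innerAlg, letter, ExteriorAlgebra.map_apply_ι, constr_single]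
  rfl

theorem permAlg_letter {r : ℕ} (σ : Equiv.Perm (Fin r)) (a : Fin r) :
    permAlg k σ (letter k a) = letter k (σ a) := by
  rw [permAlg, letter, ExteriorAlgebra.map_apply_ι, constr_single]
  rfl

theorem permAlg_one {r : ℕ} (ω : Lam k r) : permAlg k 1 ω = ω := by
  have : permAlg k (1 : Equiv.Perm (Fin r)) = AlgHom.id k _ :=
    alg_hom_ext fun a => by simp [permAlg_letter]
  rw [this]
  rfl

theorem permAlg_mul {r : ℕ} (σ τ : Equiv.Perm (Fin r)) (ω : Lam k r) :
    permAlg k (σ * τ) ω = permAlg k σ (permAlg k τ ω) := by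
  have : permAlg k (σ * τ) = (permAlg k σ).comp (permAlg k τ) :=
    alg_hom_ext fun a => by simp [permAlg_letter]
  rw [this]
  rfl

theorem outerAlg_permAlg {m n l : ℕ} (h : l + 1 = m + n) (i : Fin m)
    (σ : Equiv.Perm (Fin m)) (τ : Equiv.Perm (Fin n)) (ω : Lam k m) :
    outerAlg k h (σ i) (permAlg k σ ω) = permAlg k (blockPerm h i σ τ) (outerAlg k h i ω) := by
  have : (outerAlg k h (σ i)).comp (permAlg k σ) =
      (permAlg k (blockPerm h i σ τ)).comp (outerAlg k h i) := by
    refine alg_hom_ext fun a => ?_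
    rw [AlgHom.comp_apply, AlgHom.comp_apply, permAlg_letter]
    by_cases ha : a = i
    · subst ha
      rw [outerAlg_letter_self, outerAlg_letter_self, map_sum, ← Equiv.sum_comp τ]
      refine Finset.sum_congr rfl fun b _ => ?_
      rw [permAlg_letter, blockPerm_slot_inr]
    · rw [outerAlg_letter_of_ne h i ha, outerAlg_letter_of_ne h (σ i) (σ.injective.ne ha),
        permAlg_letter, blockPerm_slot_inl]
  exact DFunLike.congr_fun this ω

theorem innerAlg_permAlg {m n l : ℕ} (h : l + 1 = m + n) (i : Fin m)
    (σ : Equiv.Perm (Fin m)) (τ : Equiv.Perm (Fin n)) (η : Lam k n) :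
    innerAlg k h (σ i) (permAlg k τ η) = permAlg k (blockPerm h i σ τ) (innerAlg k h i η) := by
  have : (innerAlg k h (σ i)).comp (permAlg k τ) =
      (permAlg k (blockPerm h i σ τ)).comp (innerAlg k h i) := by
    refine alg_hom_ext fun b => ?_
    simp [permAlg_letter, innerAlg_letter, blockPerm_slot_inr]
  exact DFunLike.congr_fun this η

theorem innerAlg_one {r : ℕ} (h : r + 1 = 1 + r) (i : Fin 1) (η : Lam k r) :
    innerAlg k h i η = η := by
  have : innerAlg k h i = AlgHom.id k _ :=
    alg_hom_ext fun a => by simp [innerAlg_letter, slot_one_inr]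
  rw [this]
  rfl

theorem outerAlg_one {r : ℕ} (h : r + 1 = r + 1) (i : Fin r) (ω : Lam k r) :
    outerAlg k h i ω = ω := by
  have : outerAlg k h i = AlgHom.id k _ := by
    refine alg_hom_ext fun a => ?_
    by_cases ha : a = i
    · subst ha
      simp [outerAlg_letter_self, slot_inr_one]
    · simp [outerAlg_letter_of_ne h i ha, slot_inl_one]
  rw [this]
  rfl

section Seq

variable {m n r p q l : ℕ} (h₁ : p + 1 = m + n) (h₂ : l + 1 = p + r)
  (h₃ : q + 1 = n + r) (h₄ : l + 1 = m + q) (i : Fin m) (j : Fin n)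

theorem outerAlg_innerAlg_seq (η : Lam k n) :
    outerAlg k h₂ (slot h₁ i (Sum.inr j)) (innerAlg k h₁ i η) =
      innerAlg k h₄ i (outerAlg k h₃ j η) := by
  have : (outerAlg k h₂ (slot h₁ i (Sum.inr j))).comp (innerAlg k h₁ i) =
      (innerAlg k h₄ i).comp (outerAlg k h₃ j) := by
    refine alg_hom_ext fun b => ?_
    rw [AlgHom.comp_apply, AlgHom.comp_apply, innerAlg_letter]
    by_cases hb : b = j
    · subst hb
      rw [outerAlg_letter_self, outerAlg_letter_self, map_sum]
      refine Finset.sum_congr rfl fun c _ => ?_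
      rw [innerAlg_letter, slot_seq_inr h₁ h₂ h₃ h₄]
    · rw [outerAlg_letter_of_ne _ _ hb, outerAlg_letter_of_ne _ _ (slot_inr_ne_inr h₁ i hb),
        innerAlg_letter, slot_seq_mid h₁ h₂ h₃ h₄ i j ⟨b, hb⟩]
  exact DFunLike.congr_fun this η

theorem innerAlg_innerAlg_seq (ζ : Lam k r) :
    innerAlg k h₂ (slot h₁ i (Sum.inr j)) ζ = innerAlg k h₄ i (innerAlg k h₃ j ζ) := by
  have : innerAlg k h₂ (slot h₁ i (Sum.inr j)) = (innerAlg k h₄ i).comp (innerAlg k h₃ j) := by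
    refine alg_hom_ext fun c => ?_
    rw [AlgHom.comp_apply, innerAlg_letter, innerAlg_letter, innerAlg_letter,
      slot_seq_inr h₁ h₂ h₃ h₄]
  exact DFunLike.congr_fun this ζ

/-- Distributing the letter `i` over the middle factor, and then its `j`-th copy over the last
factor, is the same as distributing it at once over their composite. -/
theorem outerAlg_outerAlg_seq (ω : Lam k m) :
    outerAlg k h₂ (slot h₁ i (Sum.inr j)) (outerAlg k h₁ i ω) = outerAlg k h₄ i ω := by
  have : (outerAlg k h₂ (slot h₁ i (Sum.inr j))).comp (outerAlg k h₁ i) = outerAlg k h₄ i := by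
    refine alg_hom_ext fun a => ?_
    rw [AlgHom.comp_apply]
    by_cases ha : a = i
    · subst ha
      -- The arity of the inner composite has to be `n + r - 1`; the truncated subtraction is
      -- harmless, since `j` shows that `n` is positive.
      have h₃ : (n + r - 1) + 1 = n + r := by have := j.2; omega
      have hq : q = n + r - 1 := by have := j.2; omega
      subst hq
      -- The letter `i` is distributed as the image under `innerAlg` of the sum of all letters. The
      -- mixed identity applies to that sum, and `e2` shows that `outerAlg` at `j` carries it to the
      -- sum of all letters again.
      have e1 := outerAlg_innerAlg_seq (k := k) h₁ h₂ h₃ h₄ a j (∑ b, letter k b)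
      have e2 : ∑ x, letter k x = outerAlg k h₃ j (∑ b, letter k b) := by
        rw [← Equiv.sum_comp (slot h₃ j), Fintype.sum_sum_type, map_sum,
          ← Finset.add_sum_erase _ _ (Finset.mem_univ j), outerAlg_letter_self,
          add_comm (∑ a, letter k (slot h₃ j (Sum.inl a)))]
        congr 1
        refine Finset.sum_bij' (fun x _ => x.1) (fun y hy => ⟨y, (Finset.mem_erase.1 hy).1⟩)
          (fun x _ => by simp [x.2]) (fun _ _ => Finset.mem_univ _) (fun _ _ => rfl)
          (fun _ _ => rfl) (fun x _ => (outerAlg_letter_of_ne h₃ j x.2).symm)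
      rw [← e2, map_sum (innerAlg k h₁ a), map_sum (innerAlg k h₄ a)] at e1
      simp only [innerAlg_letter] at e1
      rw [outerAlg_letter_self, outerAlg_letter_self]
      exact e1
    · rw [outerAlg_letter_of_ne _ _ ha, outerAlg_letter_of_ne _ _ ha,
        outerAlg_letter_of_ne _ _ (slot_inl_ne_inr h₁ i _ j), slot_seq_inl h₁ h₂ h₄]
  exact DFunLike.congr_fun this ω

end Seq

section Par

variable {m n r p q l : ℕ} (h₁ : p + 1 = m + n) (h₂ : l + 1 = p + r)
  (h₃ : q + 1 = m + r) (h₄ : l + 1 = q + n) {i j : Fin m} (hji : j ≠ i) (hij : i ≠ j)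

theorem outerAlg_innerAlg_par (η : Lam k n) :
    outerAlg k h₂ (slot h₁ i (Sum.inl ⟨j, hji⟩)) (innerAlg k h₁ i η) =
      innerAlg k h₄ (slot h₃ j (Sum.inl ⟨i, hij⟩)) η := by
  have : (outerAlg k h₂ (slot h₁ i (Sum.inl ⟨j, hji⟩))).comp (innerAlg k h₁ i) =
      innerAlg k h₄ (slot h₃ j (Sum.inl ⟨i, hij⟩)) := by
    refine alg_hom_ext fun b => ?_
    rw [AlgHom.comp_apply, innerAlg_letter, innerAlg_letter,
      outerAlg_letter_of_ne _ _ (slot_inl_ne_inr h₁ i _ b).symm, slot_par_mid h₁ h₂ h₃ h₄ hji hij]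
  exact DFunLike.congr_fun this η

/-- Only the letters `i` and `j` need thought. Each is distributed as `innerAlg` of a sum of
letters, and the distribution at the other input does not touch that block, by
`outerAlg_innerAlg_par`. -/
theorem outerAlg_outerAlg_par (ω : Lam k m) :
    outerAlg k h₂ (slot h₁ i (Sum.inl ⟨j, hji⟩)) (outerAlg k h₁ i ω) =
      outerAlg k h₄ (slot h₃ j (Sum.inl ⟨i, hij⟩)) (outerAlg k h₃ j ω) := by
  have : (outerAlg k h₂ (slot h₁ i (Sum.inl ⟨j, hji⟩))).comp (outerAlg k h₁ i) =
      (outerAlg k h₄ (slot h₃ j (Sum.inl ⟨i, hij⟩))).comp (outerAlg k h₃ j) := by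
    refine alg_hom_ext fun a => ?_
    rw [AlgHom.comp_apply, AlgHom.comp_apply]
    by_cases hai : a = i
    · subst hai
      have e := outerAlg_innerAlg_par (k := k) h₁ h₂ h₃ h₄ hji hij (∑ b, letter k b)
      simp only [map_sum, innerAlg_letter] at e
      rw [outerAlg_letter_self, outerAlg_letter_of_ne _ _ hij, outerAlg_letter_self, map_sum]
      exact e
    · by_cases haj : a = j
      · subst haj
        have e := outerAlg_innerAlg_par (k := k) h₃ h₄ h₁ h₂ hij hji (∑ b, letter k b)
        simp only [map_sum, innerAlg_letter] at e
        rw [outerAlg_letter_self, outerAlg_letter_of_ne _ _ hji, outerAlg_letter_self, map_sum]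
        exact e.symm
      · rw [outerAlg_letter_of_ne _ _ hai, outerAlg_letter_of_ne _ _ haj,
          outerAlg_letter_of_ne _ _ (slot_inl_ne_inl h₁ i haj),
          outerAlg_letter_of_ne _ _ (slot_inl_ne_inl h₃ j hai),
          slot_par_inl h₁ h₂ h₃ h₄ hji hij a hai haj]
  exact DFunLike.congr_fun this ω

end Par

end ExteriorOperad
end DerivedOperad

namespace DerivedOperad

/-! ### Signs of words under permutations and grafting -/

section Words

theorem mem_graft {m n l : ℕ} (h : l + 1 = m + n) (i : Fin m) (S : Finset (Fin m))
    (C : Finset (Fin n)) (x : Fin l) :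
    x ∈ graft h i S C ↔ (∃ (a : Fin m) (ha : a ≠ i), a ∈ S ∧ slot h i (Sum.inl ⟨a, ha⟩) = x) ∨
      ∃ b ∈ C, slot h i (Sum.inr b) = x := by
  rw [graft, Finset.mem_map]
  constructor
  · rintro ⟨a | b, hs, rfl⟩
    · rw [Finset.inl_mem_disjSum, Finset.mem_subtype] at hs
      exact Or.inl ⟨a.1, a.2, hs, rfl⟩
    · rw [Finset.inr_mem_disjSum] at hs
      exact Or.inr ⟨b, hs, rfl⟩
  · rintro (⟨a, ha, hs, rfl⟩ | ⟨b, hb, rfl⟩)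
    · exact ⟨Sum.inl ⟨a, ha⟩, by rwa [Finset.inl_mem_disjSum, Finset.mem_subtype], rfl⟩
    · exact ⟨Sum.inr b, by rwa [Finset.inr_mem_disjSum], rfl⟩

theorem graft_union {m n l : ℕ} (h : l + 1 = m + n) (i : Fin m) (S S' : Finset (Fin m))
    (C C' : Finset (Fin n)) :
    graft h i S C ∪ graft h i S' C' = graft h i (S ∪ S') (C ∪ C') := by
  ext x
  simp only [Finset.mem_union, mem_graft]
  constructor
  · rintro ((⟨a, ha, hS, e⟩ | ⟨b, hb, e⟩) | (⟨a, ha, hS, e⟩ | ⟨b, hb, e⟩))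
    · exact Or.inl ⟨a, ha, Or.inl hS, e⟩
    · exact Or.inr ⟨b, Or.inl hb, e⟩
    · exact Or.inl ⟨a, ha, Or.inr hS, e⟩
    · exact Or.inr ⟨b, Or.inr hb, e⟩
  · rintro (⟨a, ha, hS | hS, e⟩ | ⟨b, hb | hb, e⟩)
    · exact Or.inl (Or.inl ⟨a, ha, hS, e⟩)
    · exact Or.inr (Or.inl ⟨a, ha, hS, e⟩)
    · exact Or.inl (Or.inr ⟨b, hb, e⟩)
    · exact Or.inr (Or.inr ⟨b, hb, e⟩)

theorem graft_filter {m n l : ℕ} (h : l + 1 = m + n) (i : Fin m) (S : Finset (Fin m))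
    (C : Finset (Fin n)) :
    graft h i (S.filter (fun s => s < i) ∪ S.filter (fun s => i < s)) C = graft h i S C := by
  ext x
  simp only [mem_graft, Finset.mem_union, Finset.mem_filter]
  refine or_congr_left (exists₂_congr fun a ha => and_congr_left fun _ => ?_)
  have := lt_or_gt_of_ne ha
  tauto

theorem graft_insert {m n l : ℕ} (h : l + 1 = m + n) {i a : Fin m} (ha : a ≠ i)
    (S : Finset (Fin m)) (C : Finset (Fin n)) :
    graft h i (insert a S) C = insert (slot h i (Sum.inl ⟨a, ha⟩)) (graft h i S C) := by
  ext x
  simp only [mem_graft, Finset.mem_insert]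
  constructor
  · rintro (⟨b, hb, rfl | hS, e⟩ | hC)
    · exact Or.inl e.symm
    · exact Or.inr (Or.inl ⟨b, hb, hS, e⟩)
    · exact Or.inr (Or.inr hC)
  · rintro (e | ⟨b, hb, hS, e⟩ | hC)
    · exact Or.inl ⟨a, ha, Or.inl rfl, e.symm⟩
    · exact Or.inl ⟨b, hb, Or.inr hS, e⟩
    · exact Or.inr hC

theorem graft_insert_right {m n l : ℕ} (h : l + 1 = m + n) (i : Fin m) (b : Fin n)
    (S : Finset (Fin m)) (C : Finset (Fin n)) :
    graft h i S (insert b C) = insert (slot h i (Sum.inr b)) (graft h i S C) := by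
  ext x
  simp only [mem_graft, Finset.mem_insert]
  constructor
  · rintro (hS | ⟨c, rfl | hC, e⟩)
    · exact Or.inr (Or.inl hS)
    · exact Or.inl e.symm
    · exact Or.inr (Or.inr ⟨c, hC, e⟩)
  · rintro (e | hS | ⟨c, hC, e⟩)
    · exact Or.inr ⟨b, Or.inl rfl, e.symm⟩
    · exact Or.inl hS
    · exact Or.inr ⟨c, Or.inr hC, e⟩

theorem graft_empty {m n l : ℕ} (h : l + 1 = m + n) (i : Fin m) :
    graft h i ∅ (∅ : Finset (Fin n)) = ∅ := by
  ext x
  simp [mem_graft]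

theorem slot_inl_lt_inl {m n l : ℕ} (h : l + 1 = m + n) (i : Fin m) {a b : Fin m}
    (ha : a ≠ i) (hb : b ≠ i) (hab : a < b) :
    slot h i (Sum.inl ⟨a, ha⟩) < slot h i (Sum.inl ⟨b, hb⟩) := by
  have h1 : (a : ℕ) ≠ i := fun e => ha (Fin.ext e)
  have h2 : (b : ℕ) ≠ i := fun e => hb (Fin.ext e)
  rw [Fin.lt_def] at hab ⊢
  simp only [slot_inl_val]
  split_ifs <;> omega

theorem slot_inr_lt_inr {m n l : ℕ} (h : l + 1 = m + n) (i : Fin m) {a b : Fin n}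
    (hab : a < b) : slot h i (Sum.inr a) < slot h i (Sum.inr b) := by
  rw [Fin.lt_def] at hab ⊢
  simp only [slot_inr_val]
  omega

theorem slot_inl_lt_inr {m n l : ℕ} (h : l + 1 = m + n) (i : Fin m) {a : Fin m} (ha : a ≠ i)
    (hai : a < i) (b : Fin n) :
    slot h i (Sum.inl ⟨a, ha⟩) < slot h i (Sum.inr b) := by
  rw [Fin.lt_def] at hai ⊢
  rw [slot_inl_val, slot_inr_val, if_pos hai]
  dsimp only
  omega

theorem slot_inr_lt_inl {m n l : ℕ} (h : l + 1 = m + n) (i : Fin m) {a : Fin m} (ha : a ≠ i)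
    (hai : i < a) (b : Fin n) :
    slot h i (Sum.inr b) < slot h i (Sum.inl ⟨a, ha⟩) := by
  rw [Fin.lt_def] at hai ⊢
  have := b.2
  rw [slot_inl_val, slot_inr_val, if_neg (by simpa using hai.le)]
  dsimp only
  omega

variable {k : Type u} [CommRing k]

/-- Since `a` comes first, the new inversions are exactly the pairs of `a` with some `s` for which
`σ s < σ a`. -/
theorem wordSign_insert {r : ℕ} (σ : Equiv.Perm (Fin r)) {a : Fin r} {S : Finset (Fin r)}
    (ha : ∀ s ∈ S, a < s) :
    wordSign σ (insert a S) = (-1) ^ (S.filter (fun s => σ s < σ a)).card * wordSign σ S := by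
  have haS : a ∉ S := fun h => lt_irrefl _ (ha a h)
  rw [wordSign, wordSign, ← pow_add]
  congr 1
  rw [Finset.card_filter, Finset.card_filter, Finset.card_filter, Finset.sum_product,
    Finset.sum_product, Finset.sum_insert haS]
  dsimp only
  congr 1
  · rw [Finset.sum_insert haS]
    simp only [lt_self_iff_false, and_self, if_false, zero_add]
    exact Finset.sum_congr rfl fun s hs => by simp [ha s hs]
  · refine Finset.sum_congr rfl fun s hs => ?_
    rw [Finset.sum_insert haS, if_neg (fun h => (ha s hs).not_gt h.1), zero_add]

theorem permAlg_word {r : ℕ} (σ : Equiv.Perm (Fin r)) (S : Finset (Fin r)) :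
    permAlg k σ (word k S) = wordSign σ S • word k (S.map σ.toEmbedding) := by
  induction S using Finset.induction_on_min with
  | empty => simp [word_empty, wordSign]
  | insert a S ha ih =>
    have haS : a ∉ S := fun h => lt_irrefl _ (ha a h)
    have h1 : (S.map σ.toEmbedding).filter (fun t => t < σ a) =
        (S.filter (fun s => σ s < σ a)).map σ.toEmbedding := by
      rw [Finset.filter_map]
      rfl
    rw [word_insert_of_lt ha, map_mul, ih, permAlg_letter, mul_smul_comm, letter_mul_word,
      if_neg (by simpa using haS), h1, Finset.card_map, wordSign_insert σ ha, smul_smul,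
      Finset.map_insert, mul_comm]
    rfl

/-- Away from `i` the positions are mapped in increasing order, so a sorted word stays sorted and no
sign arises. -/
theorem outerAlg_word {m n l : ℕ} (h : l + 1 = m + n) {i : Fin m} (S : Finset (Fin m))
    (hS : i ∉ S) : outerAlg k h i (word k S) = word k (graft h i S ∅) := by
  induction S using Finset.induction_on_min with
  | empty => simp [word_empty, graft_empty]
  | insert a S ha ih =>
    rw [Finset.mem_insert, not_or] at hS
    rw [word_insert_of_lt ha, map_mul, ih hS.2, outerAlg_letter_of_ne h i (Ne.symm hS.1),
      graft_insert h (Ne.symm hS.1), word_insert_of_lt]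
    intro x hx
    rcases (mem_graft _ _ _ _ _).1 hx with ⟨b, hb, hbS, rfl⟩ | ⟨b, hb, -⟩
    · exact slot_inl_lt_inl h i _ _ (ha b hbS)
    · simp at hb

theorem innerAlg_word {m n l : ℕ} (h : l + 1 = m + n) (i : Fin m) (T : Finset (Fin n)) :
    innerAlg k h i (word k T) = word k (graft h i ∅ T) := by
  induction T using Finset.induction_on_min with
  | empty => simp [word_empty, graft_empty]
  | insert b T hb ih =>
    rw [word_insert_of_lt hb, map_mul, ih, innerAlg_letter, graft_insert_right, word_insert_of_lt]
    intro x hx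
    rcases (mem_graft _ _ _ _ _).1 hx with ⟨b, _, hbS, -⟩ | ⟨c, hc, rfl⟩
    · simp at hbS
    · exact slot_inr_lt_inr h i (hb c hc)

theorem outerAlg_mem_gr {m n l p : ℕ} (h : l + 1 = m + n) (i : Fin m) {ω : Lam k m}
    (hω : ω ∈ gr k m p) : outerAlg k h i ω ∈ gr k l p := map_mem_gr _ hω

theorem innerAlg_mem_gr {m n l p : ℕ} (h : l + 1 = m + n) (i : Fin m) {ω : Lam k n}
    (hω : ω ∈ gr k n p) : innerAlg k h i ω ∈ gr k l p := map_mem_gr _ hω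

theorem permAlg_mem_gr {r p : ℕ} (σ : Equiv.Perm (Fin r)) {ω : Lam k r}
    (hω : ω ∈ gr k r p) : permAlg k σ ω ∈ gr k r p := map_mem_gr _ hω

/-- This is the distributive law `φ` without its sign: an `ε` at the input `i` is spread over the
one-element sets `B`, and its absence leaves only `B = ∅`. -/
theorem outerAlg_word_inter {m n l : ℕ} (h : l + 1 = m + n) (i : Fin m) (S : Finset (Fin m)) :
    outerAlg k h i (word k (S.filter (fun s => s = i))) =
      ∑ B : Finset (Fin n) with B.card = (if i ∈ S then 1 else 0), innerAlg k h i (word k B) := by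
  by_cases hi : i ∈ S
  · have e : S.filter (fun s => s = i) = {i} := by
      ext x
      simp only [Finset.mem_filter, Finset.mem_singleton, and_iff_right_iff_imp]
      rintro rfl
      exact hi
    simp only [hi, if_true]
    rw [e, word_singleton, outerAlg_letter_self]
    refine Finset.sum_bij (fun b _ => {b}) (by simp) (by simp) ?_ ?_
    · intro B hB
      obtain ⟨b, rfl⟩ := Finset.card_eq_one.1 (Finset.mem_filter.1 hB).2
      exact ⟨b, Finset.mem_univ _, rfl⟩
    · intro b _
      rw [word_singleton, innerAlg_letter]
  · have e : S.filter (fun s => s = i) = ∅ := by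
      refine Finset.filter_eq_empty_iff.2 ?_
      rintro x hx rfl
      exact hi hx
    have e' : (Finset.univ.filter fun B : Finset (Fin n) => B.card = 0) = {∅} := by
      ext B
      simp
    simp only [hi, if_false]
    rw [e, e', word_empty, Finset.sum_singleton, word_empty, map_one, map_one]

theorem word_split {m : ℕ} (i : Fin m) (S : Finset (Fin m)) :
    word k S = word k (S.filter (fun s => s < i)) *
      (word k (S.filter (fun s => s = i)) * word k (S.filter (fun s => i < s))) := by
  rw [word_mul_word_of_lt, word_mul_word_of_lt]
  · congr 1
    ext x
    simp only [Finset.mem_union, Finset.mem_filter]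
    have := lt_trichotomy x i
    tauto
  · intro s hs t ht
    simp only [Finset.mem_union, Finset.mem_filter] at hs ht
    rcases ht with ht | ht
    · exact ht.2 ▸ hs.2
    · exact hs.2.trans ht.2
  · intro s hs t ht
    simp only [Finset.mem_filter] at hs ht
    exact hs.2 ▸ ht.2

/-- The letters before `i`, those of the inserted block and those after `i` occupy increasing
positions of the composite, so the product is already sorted. -/
theorem word_graft {m n l : ℕ} (h : l + 1 = m + n) (i : Fin m) (S : Finset (Fin m))
    (C : Finset (Fin n)) :
    outerAlg k h i (word k (S.filter (fun s => s < i))) * innerAlg k h i (word k C) *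
      outerAlg k h i (word k (S.filter (fun s => i < s))) = word k (graft h i S C) := by
  rw [outerAlg_word h _ (by simp), outerAlg_word h _ (by simp), innerAlg_word,
    word_mul_word_of_lt, word_mul_word_of_lt]
  · rw [graft_union, graft_union, ← graft_filter h i S]
    simp
  · intro x hx y hy
    obtain ⟨b, hb, hbS, rfl⟩ : ∃ (b : Fin m) (hb : b ≠ i), i < b ∧
        slot h i (Sum.inl ⟨b, hb⟩) = y := by
      simp only [mem_graft, Finset.mem_filter] at hy
      rcases hy with ⟨b, hb, hbS, e⟩ | ⟨b, hb, -⟩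
      · exact ⟨b, hb, hbS.2, e⟩
      · simp at hb
    simp only [graft_union, mem_graft] at hx
    rcases hx with ⟨a, ha, haS, rfl⟩ | ⟨c, hc, rfl⟩
    · exact slot_inl_lt_inl h i _ _
        ((show a < i from (by simpa using haS : a ∈ S ∧ a < i).2).trans hbS)
    · exact slot_inr_lt_inl h i _ hbS c
  · intro x hx y hy
    simp only [mem_graft] at hx hy
    rcases hx with ⟨a, ha, haS, rfl⟩ | ⟨c, hc, rfl⟩
    · rcases hy with ⟨b, hb, hbS, rfl⟩ | ⟨d, hd, rfl⟩
      · simp at hbS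
      · exact slot_inl_lt_inr h i _ (Finset.mem_filter.1 haS).2 d
    · simp at hc

/-- The purely exterior part of `compSign`, that is, its value at `v = 0`, is exactly what is needed
to sort this product: the letters of `T` pass those of `S` after `i`, and then `ε^B ε^T` is sorted
inside the block. -/
theorem outerAlg_mul_innerAlg {m n l : ℕ} (h : l + 1 = m + n) (i : Fin m) (S : Finset (Fin m))
    (T : Finset (Fin n)) :
    outerAlg k h i (word k S) * innerAlg k h i (word k T) =
      ∑ B : DistribIndex i S T, compSign 0 i S T B.1 • word k (graft h i S (B.1 ∪ T)) := by
  have e1 := mul_comm_gr (outerAlg_mem_gr h i (word_mem_gr (k := k) (S.filter (fun s => i < s))))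
    (innerAlg_mem_gr h i (word_mem_gr (k := k) T))
  rw [word_split i S, map_mul, map_mul, mul_assoc, mul_assoc, e1, outerAlg_word_inter,
    mul_smul_comm, mul_smul_comm, Finset.sum_mul, Finset.mul_sum]
  -- The sum over all `B` of the right size is cut down to those disjoint from `T`; the other terms
  -- contain a repeated letter.
  rw [← Finset.sum_subtype ((Finset.univ.filter fun B : Finset (Fin n) =>
    B.card = (if i ∈ S then 1 else 0)).filter (fun B => Disjoint B T)) (by simp)
    (fun B => compSign 0 i S T B • word k (graft h i S (B ∪ T))),
    Finset.sum_filter (fun B => Disjoint B T),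
    Finset.smul_sum]
  refine Finset.sum_congr rfl fun B _ => ?_
  rw [← mul_assoc (innerAlg k h i _), ← map_mul, word_mul_word]
  split_ifs with hB
  · rw [Units.smul_def (Int.negOnePow (crossings B T)), map_zsmul, ← Units.smul_def, smul_mul_assoc,
      mul_smul_comm, smul_smul, ← mul_assoc, word_graft]
    congr 1
    simp [compSign, mul_comm]
  · simp

end Words
end DerivedOperad

namespace DerivedOperad

/-! ### Composition and permutation of tensors `(μ; ω)` in the derived operad -/

section Tensors

variable {k : Type u} [CommRing k]

/-- The element `(μ; ω)` of `O ∘ 𝒟`, or rather its component of bidegree `d`. -/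
noncomputable def tens (O : OperadData.{u, v} k) {r : ℕ} (d : Deg) {e : Deg} :
    O.carrier r e →ₗ[k] Lam k r →ₗ[k] DerivedCarrier O r d :=
  ((wordBasis k r).constr k
    -- Words whose length does not fit the bidegrees go to `0`. This makes the map linear on the
    -- whole exterior algebra.
    (fun S => if h : e = shift d S then elementary O S h else 0)).flip

variable {O : OperadData.{u, v} k}

theorem tens_word {r : ℕ} {d e : Deg} {S : Finset (Fin r)} (h : e = shift d S)
    (μ : O.carrier r e) : tens O d μ (word k S) = elementary O S h μ := by
  rw [tens, LinearMap.flip_apply, word, Module.Basis.constr_basis, dif_pos h]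

theorem tens_word_of_ne {r : ℕ} {d e : Deg} {S : Finset (Fin r)} (h : e ≠ shift d S)
    (μ : O.carrier r e) : tens O d μ (word k S) = 0 := by
  rw [tens, LinearMap.flip_apply, word, Module.Basis.constr_basis, dif_neg h,
    LinearMap.zero_apply]

theorem derived_induction' {r : ℕ} {d : Deg} {motive : DerivedCarrier O r d → Prop}
    (x : DerivedCarrier O r d) (hzero : motive 0)
    (hadd : ∀ x y, motive x → motive y → motive (x + y))
    (helem : ∀ (S : Finset (Fin r)) (μ : O.carrier r (shift d S)),
      motive (elementary O S rfl μ)) : motive x := by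
  have hx : x = ∑ S, elementary O S rfl (x S) := (LinearMap.sum_single_apply _ x).symm
  rw [hx]
  exact Finset.sum_induction _ motive hadd hzero fun S _ => helem S _

/-- Passing from words to arbitrary `ω` of fixed length matters because the homomorphisms `outerAlg`
do not send words to words. -/
theorem derived_induction {r : ℕ} {d : Deg} {motive : DerivedCarrier O r d → Prop}
    (x : DerivedCarrier O r d) (hzero : motive 0)
    (hadd : ∀ x y, motive x → motive y → motive (x + y))
    (htens : ∀ (p : ℕ) (e : Deg) (_ : e = d + ((p : ℤ), 0)) (μ : O.carrier r e) (ω : Lam k r)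
      (_ : ω ∈ gr k r p), motive (tens O d μ ω)) : motive x := by
  refine derived_induction' x hzero hadd fun S μ => ?_
  rw [← tens_word]
  exact htens S.card _ rfl _ _ (word_mem_gr S)

theorem units_smul_map {M N : Type*} [AddCommGroup M] [AddCommGroup N] [Module k M] [Module k N]
    (f : M →ₗ[k] N) (s : ℤˣ) (x : M) : f (s • x) = s • f x := by
  rw [Units.smul_def, Units.smul_def, map_zsmul]

theorem units_smul_map₂ {M N Q : Type*} [AddCommGroup M] [AddCommGroup N] [AddCommGroup Q]
    [Module k M] [Module k N] [Module k Q]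
    (f : M →ₗ[k] N →ₗ[k] Q) (s : ℤˣ) (x : M) (y : N) : f (s • x) y = s • f x y := by
  rw [Units.smul_def, Units.smul_def, map_zsmul, LinearMap.smul_apply]

theorem units_smul_apply {M N : Type*} [AddCommGroup M] [AddCommGroup N] [Module k M] [Module k N]
    (f : M →ₗ[k] N) (s : ℤˣ) (x : M) : (s • f) x = s • f x := rfl

/-- The letters of `S` before, at and after `i` each contribute one factor `(-1)^v`. Together they
form the Koszul sign for moving `ν` past the whole word `ε^S`. -/
theorem compSign_eq {m n : ℕ} (v : ℤ) (i : Fin m) (S : Finset (Fin m)) (T B : Finset (Fin n)) :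
    compSign v i S T B = Int.negOnePow (S.card * v) * compSign 0 i S T B := by
  have h : S.card = (S.filter (fun s => i < s)).card + (if i ∈ S then 1 else 0) +
      (S.filter (fun s => s < i)).card := by
    have e : (if i ∈ S then 1 else 0) = (S.filter (fun s => s = i)).card := by
      rw [Finset.filter_eq']
      split_ifs <;> simp
    rw [e, Finset.card_filter, Finset.card_filter, Finset.card_filter, ← Finset.sum_add_distrib,
      ← Finset.sum_add_distrib, Finset.card_eq_sum_ones]
    refine Finset.sum_congr rfl fun s _ => ?_
    rcases lt_trichotomy s i with h | h | h
    · simp [h, h.not_gt, h.ne]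
    · simp [h]
    · simp [h, h.not_gt, h.ne']
  rw [compSign, compSign]
  simp only [← Int.negOnePow_add]
  rw [Int.negOnePow_eq_iff, h]
  refine ⟨0, ?_⟩
  split_ifs <;> push_cast <;> ring

theorem derivedComp_elementary {m n l : ℕ} {d e f e₁ e₂ f₁ : Deg} (h : l + 1 = m + n)
    (hd : f = d + e) (i : Fin m) {S : Finset (Fin m)} {T : Finset (Fin n)}
    (hS : e₁ = shift d S) (hT : e₂ = shift e T) (hf : f₁ = e₁ + e₂)
    (μ : O.carrier m e₁) (ν : O.carrier n e₂) :
    derivedComp O h hd i (elementary O S hS μ) (elementary O T hT ν) =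
      ∑ B : DistribIndex i S T, compSign (tot e₂) i S T B.1 •
        elementary O (graft h i S (B.1 ∪ T))
          (hf.trans ((congrArg₂ (· + ·) hS hT).trans (shift_graft h hd i S T B).symm))
          (O.comp h hf i μ ν) := by
  subst hS hT
  have e1 : ∀ S', (elementary O (d := d) S rfl μ) S' =
    Pi.single (M := fun S => O.carrier m (shift d S)) S μ S' := fun _ => rfl
  have e2 : ∀ T', (elementary O (d := e) T rfl ν) T' =
    Pi.single (M := fun S => O.carrier n (shift e S)) T ν T' := fun _ => rfl
  rw [derivedComp, LinearMap.sum_apply, LinearMap.sum_apply, Finset.sum_eq_single S]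
  · rw [LinearMap.sum_apply, LinearMap.sum_apply, Finset.sum_eq_single T]
    · rw [LinearMap.compl₁₂_apply, LinearMap.proj_apply, LinearMap.proj_apply, e1, e2,
        Pi.single_eq_same, Pi.single_eq_same, elementaryComp, LinearMap.sum_apply,
        LinearMap.sum_apply]
      refine Finset.sum_congr rfl fun B _ => ?_
      rw [units_smul_apply, units_smul_apply, LinearMap.compr₂_apply]
      congr 1
      -- The two composites differ only in the name of their bidegree, and agree by definition once
      -- these are identified.
      have key : ∀ {U : Finset (Fin l)} (hU : f₁ = shift f U)
          (hU' : shift f U = shift d S + shift e T),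
          (LinearMap.single k (fun U => O.carrier l (shift f U)) U) (O.comp h hU' i μ ν) =
          elementary O U hU (O.comp h hf i μ ν) := by
        intro U hU hU'
        subst hU
        rfl
      exact key _ _
    · intro T' _ hT'
      rw [LinearMap.compl₁₂_apply, LinearMap.proj_apply, LinearMap.proj_apply, e2,
        Pi.single_eq_of_ne hT', map_zero]
    · simp
  · intro S' _ hS'
    rw [LinearMap.sum_apply, LinearMap.sum_apply]
    refine Finset.sum_eq_zero fun T' _ => ?_
    rw [LinearMap.compl₁₂_apply, LinearMap.proj_apply, LinearMap.proj_apply, e1,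
      Pi.single_eq_of_ne hS', map_zero, LinearMap.zero_apply]
  · simp

theorem derivedPerm_elementary {r : ℕ} {d e : Deg} (σ : Equiv.Perm (Fin r)) {S : Finset (Fin r)}
    (hS : e = shift d S) (μ : O.carrier r e) :
    derivedPerm O σ (elementary O S hS μ) = wordSign σ S •
      elementary O (S.map σ.toEmbedding) (by simp [hS, shift]) (O.perm σ μ) := by
  subst hS
  have e1 : ∀ S', (elementary O (d := d) S rfl μ) S' =
    Pi.single (M := fun S => O.carrier r (shift d S)) S μ S' := fun _ => rfl
  rw [derivedPerm, LinearMap.sum_apply, Finset.sum_eq_single S]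
  · rw [units_smul_apply, LinearMap.comp_apply, LinearMap.comp_apply, LinearMap.proj_apply, e1,
      Pi.single_eq_same]
  · intro S' _ hS'
    rw [units_smul_apply, LinearMap.comp_apply, LinearMap.comp_apply, LinearMap.proj_apply, e1,
      Pi.single_eq_of_ne hS', map_zero, map_zero, smul_zero]
  · simp

/-- By bilinearity it is enough to treat words, where `compSign_eq` splits off the Koszul sign and
`outerAlg_mul_innerAlg` accounts for the rest. All laws of the derived operad are deduced from this
formula. -/
theorem derivedComp_tens {m n l p q : ℕ} {d e f e₁ e₂ f₁ : Deg} (h : l + 1 = m + n)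
    (hd : f = d + e) (i : Fin m) (hp : e₁ = d + ((p : ℤ), 0)) (hq : e₂ = e + ((q : ℤ), 0))
    (hf : f₁ = e₁ + e₂) (μ : O.carrier m e₁) (ν : O.carrier n e₂) {ω : Lam k m} {η : Lam k n}
    (hω : ω ∈ gr k m p) (hη : η ∈ gr k n q) :
    derivedComp O h hd i (tens O d μ ω) (tens O e ν η) = Int.negOnePow (p * tot e₂) •
      tens O f (O.comp h hf i μ ν) (outerAlg k h i ω * innerAlg k h i η) := by
  refine gr_induction (motive := fun ω => derivedComp O h hd i (tens O d μ ω) (tens O e ν η) =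
    Int.negOnePow (p * tot e₂) •
      tens O f (O.comp h hf i μ ν) (outerAlg k h i ω * innerAlg k h i η)) hω
    (fun S hS => ?_) (by simp)
    (fun x y hx hy => by simp only [map_add, LinearMap.add_apply, add_mul, smul_add, hx, hy])
    (fun c x hx => by simp only [map_smul, LinearMap.smul_apply, smul_mul_assoc, hx, smul_comm c])
  refine gr_induction (motive := fun η => derivedComp O h hd i (tens O d μ (word k S))
    (tens O e ν η) = Int.negOnePow (p * tot e₂) •
      tens O f (O.comp h hf i μ ν) (outerAlg k h i (word k S) * innerAlg k h i η)) hη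
    (fun T hT => ?_) (by simp)
    (fun x y hx hy => by simp only [map_add, mul_add, smul_add, hx, hy])
    (fun c x hx => by simp only [map_smul, mul_smul_comm, hx, smul_comm c])
  subst hS hT
  have hp' : e₁ = shift d S := hp
  have hq' : e₂ = shift e T := hq
  rw [tens_word hp', tens_word hq', derivedComp_elementary h hd i hp' hq' hf, outerAlg_mul_innerAlg,
    map_sum, Finset.smul_sum]
  refine Finset.sum_congr rfl fun B _ => ?_
  rw [units_smul_map, tens_word, smul_smul, ← compSign_eq]

theorem derivedPerm_tens {r p : ℕ} {d e : Deg} (σ : Equiv.Perm (Fin r))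
    (hp : e = d + ((p : ℤ), 0)) (μ : O.carrier r e) {ω : Lam k r} (hω : ω ∈ gr k r p) :
    derivedPerm O σ (tens O d μ ω) = tens O d (O.perm σ μ) (permAlg k σ ω) := by
  refine gr_induction (motive := fun ω => derivedPerm O σ (tens O d μ ω) =
      tens O d (O.perm σ μ) (permAlg k σ ω)) hω (fun S hS => ?_) (by simp)
    (fun x y hx hy => by simp only [map_add, hx, hy])
    (fun c x hx => by simp only [map_smul, hx])
  subst hS
  have hp' : e = shift d S := hp
  rw [tens_word hp', derivedPerm_elementary, permAlg_word, units_smul_map, tens_word]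

theorem tens_one {r : ℕ} {d e : Deg} (h : e = shift d (∅ : Finset (Fin r))) (μ : O.carrier r e) :
    tens O d μ 1 = elementary O ∅ h μ := by
  rw [← word_empty, tens_word]

end Tensors
end DerivedOperad

namespace DerivedOperad

/-! ### The operad laws for the derived operad -/

section DerivedIsOperad

variable {k : Type u} [CommRing k] {O : OperadData.{u, v} k}

theorem deg_add {d e f e₁ e₂ : Deg} {p q : ℕ} (hd : f = d + e) (hp : e₁ = d + ((p : ℤ), 0))
    (hq : e₂ = e + ((q : ℤ), 0)) : e₁ + e₂ = f + (((p + q : ℕ) : ℤ), 0) := by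
  subst hd hp hq
  ext
  · simp
    ring
  · simp

theorem tot_add (d e : Deg) : tot (d + e) = tot d + tot e := by
  simp [tot]
  ring

theorem tot_shift {d e : Deg} {p : ℕ} (hp : e = d + ((p : ℤ), 0)) : tot e = tot d + p := by
  subst hp
  simp [tot]
  ring

theorem derived_one : (derived O).one = tens O 0 O.one 1 := (tens_one _ _).symm

theorem derivedPerm_one (hO : IsOperad O) {r : ℕ} {d : Deg} (x : DerivedCarrier O r d) :
    derivedPerm O 1 x = x := by
  induction x using derived_induction with
  | hzero => simp only [map_zero]
  | hadd x₁ x₂ h₁' h₂' => simp only [map_add, h₁', h₂']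
  | htens s d' hp μ ω hS =>
    rw [derivedPerm_tens 1 hp μ hS, hO.perm_one, permAlg_one]

theorem derivedPerm_mul (hO : IsOperad O) {r : ℕ} {d : Deg} (σ τ : Equiv.Perm (Fin r))
    (x : DerivedCarrier O r d) :
    derivedPerm O (σ * τ) x = derivedPerm O σ (derivedPerm O τ x) := by
  induction x using derived_induction with
  | hzero => simp only [map_zero]
  | hadd x₁ x₂ h₁' h₂' => simp only [map_add, h₁', h₂']
  | htens s d' hp μ ω hS =>
    rw [derivedPerm_tens _ hp μ hS, derivedPerm_tens _ hp μ hS,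
      derivedPerm_tens _ hp _ (permAlg_mem_gr τ hS), hO.perm_mul, permAlg_mul]

theorem derivedComp_perm (hO : IsOperad O) {m n l : ℕ} {d e f : Deg}
    (h : l + 1 = m + n) (hd : f = d + e)
    (i : Fin m) (σ : Equiv.Perm (Fin m)) (τ : Equiv.Perm (Fin n)) (x : DerivedCarrier O m d)
    (y : DerivedCarrier O n e) :
    derivedComp O h hd (σ i) (derivedPerm O σ x) (derivedPerm O τ y) =
      derivedPerm O (blockPerm h i σ τ) (derivedComp O h hd i x y) := by
  induction x using derived_induction with
  | hzero => simp only [map_zero, LinearMap.zero_apply]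
  | hadd x₁ x₂ h₁' h₂' => simp only [map_add, LinearMap.add_apply, h₁', h₂']
  | htens s d' hp μ ω hS =>
  induction y using derived_induction with
  | hzero => simp only [map_zero]
  | hadd x₁ x₂ h₁' h₂' => simp only [map_add, h₁', h₂']
  | htens t e' hq ν η hT =>
    rw [derivedPerm_tens σ hp μ hS, derivedPerm_tens τ hq ν hT,
      derivedComp_tens h hd _ hp hq rfl _ _ (permAlg_mem_gr σ hS) (permAlg_mem_gr τ hT),
      derivedComp_tens h hd _ hp hq rfl _ _ hS hT, units_smul_map,
      derivedPerm_tens _ (deg_add hd hp hq) _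
        (mul_mem_gr (outerAlg_mem_gr h i hS) (innerAlg_mem_gr h i hT)),
      hO.comp_perm, map_mul (permAlg k _), outerAlg_permAlg h i σ τ, innerAlg_permAlg h i σ τ]

theorem derivedComp_one_left (hO : IsOperad O) {r : ℕ} {d : Deg}
    (h : r + 1 = 1 + r) (hd : d = 0 + d) (i : Fin 1)
    (x : DerivedCarrier O r d) :
    derivedComp O h hd i (tens O 0 O.one 1) x = x := by
  induction x using derived_induction with
  | hzero => simp only [map_zero]
  | hadd x₁ x₂ h₁' h₂' => simp only [map_add, h₁', h₂']
  | htens s d' hp μ ω hS =>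
    rw [derivedComp_tens (p := 0) h hd i (by ext <;> simp) hp (zero_add _).symm _ _ one_mem_gr
      hS, hO.one_comp, map_one, innerAlg_one, one_mul]
    simp

theorem derivedComp_one_right (hO : IsOperad O) {r : ℕ} {d : Deg}
    (h : r + 1 = r + 1) (hd : d = d + 0) (i : Fin r)
    (x : DerivedCarrier O r d) :
    derivedComp O h hd i x (tens O 0 O.one 1) = x := by
  induction x using derived_induction with
  | hzero => simp only [map_zero, LinearMap.zero_apply]
  | hadd x₁ x₂ h₁' h₂' => simp only [map_add, LinearMap.add_apply, h₁', h₂']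
  | htens s d' hp μ ω hS =>
    rw [derivedComp_tens (q := 0) h hd i hp (by ext <;> simp) (add_zero _).symm _ _ hS
      one_mem_gr, hO.comp_one, map_one, outerAlg_one, mul_one]
    simp [tot]

theorem derivedComp_assoc_seq (hO : IsOperad O) {m n r p q l : ℕ} {d e g a b f : Deg}
    (h₁ : p + 1 = m + n) (h₂ : l + 1 = p + r)
    (h₃ : q + 1 = n + r) (h₄ : l + 1 = m + q) (hd₁ : a = d + e) (hd₂ : f = a + g)
    (hd₃ : b = e + g) (hd₄ : f = d + b) (i : Fin m) (j : Fin n)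
    (x : DerivedCarrier O m d) (y : DerivedCarrier O n e) (z : DerivedCarrier O r g) :
    derivedComp O h₂ hd₂ (slot h₁ i (Sum.inr j)) (derivedComp O h₁ hd₁ i x y) z =
      derivedComp O h₄ hd₄ i x (derivedComp O h₃ hd₃ j y z) := by
  induction x using derived_induction with
  | hzero => simp only [map_zero, LinearMap.zero_apply]
  | hadd x₁ x₂ h₁' h₂' => simp only [map_add, LinearMap.add_apply, h₁', h₂']
  | htens s d' hp μ ω hS =>
  induction y using derived_induction with
  | hzero => simp only [map_zero, LinearMap.zero_apply]
  | hadd x₁ x₂ h₁' h₂' => simp only [map_add, LinearMap.add_apply, h₁', h₂']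
  | htens t e' hq ν η hT =>
  induction z using derived_induction with
  | hzero => simp only [map_zero]
  | hadd x₁ x₂ h₁' h₂' => simp only [map_add, h₁', h₂']
  | htens u g' hr ρ ζ hU =>
    rw [derivedComp_tens h₁ hd₁ i hp hq rfl μ ν hS hT,
      derivedComp_tens h₃ hd₃ j hq hr rfl ν ρ hT hU, units_smul_map₂, units_smul_map,
      derivedComp_tens h₂ hd₂ _ (deg_add hd₁ hp hq) hr rfl _ _
        (mul_mem_gr (outerAlg_mem_gr h₁ i hS) (innerAlg_mem_gr h₁ i hT)) hU,
      derivedComp_tens h₄ hd₄ _ hp (deg_add hd₃ hq hr) (add_assoc _ _ _) _ _ hS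
        (mul_mem_gr (outerAlg_mem_gr h₃ j hT) (innerAlg_mem_gr h₃ j hU)),
      hO.assoc_seq h₁ h₂ h₃ h₄ rfl rfl rfl (add_assoc _ _ _), map_mul (outerAlg k h₂ _),
      map_mul (innerAlg k h₄ _),
      outerAlg_outerAlg_seq h₁ h₂ h₄, outerAlg_innerAlg_seq h₁ h₂ h₃ h₄,
      innerAlg_innerAlg_seq h₁ h₂ h₃ h₄, mul_assoc, smul_smul, smul_smul, ← Int.negOnePow_add,
      ← Int.negOnePow_add]
    -- Both exponents are `s|ν| + (s + t)|ρ|`, where `ν` and `ρ` are the parts of `y` and `z` in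
    -- `O`.
    congr 2
    rw [tot_add]
    push_cast
    ring

theorem derivedComp_assoc_par (hO : IsOperad O) {m n r p q l : ℕ} {d e g a b f : Deg}
    (h₁ : p + 1 = m + n) (h₂ : l + 1 = p + r)
    (h₃ : q + 1 = m + r) (h₄ : l + 1 = q + n) (hd₁ : a = d + e) (hd₂ : f = a + g)
    (hd₃ : b = d + g) (hd₄ : f = b + e) (i j : Fin m) (hji : j ≠ i) (hij : i ≠ j)
    (x : DerivedCarrier O m d) (y : DerivedCarrier O n e) (z : DerivedCarrier O r g) :
    derivedComp O h₂ hd₂ (slot h₁ i (Sum.inl ⟨j, hji⟩)) (derivedComp O h₁ hd₁ i x y) z =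
      koszul e g • derivedComp O h₄ hd₄ (slot h₃ j (Sum.inl ⟨i, hij⟩))
        (derivedComp O h₃ hd₃ j x z) y := by
  induction x using derived_induction with
  | hzero => simp only [map_zero, LinearMap.zero_apply, smul_zero]
  | hadd x₁ x₂ h₁' h₂' => simp only [map_add, LinearMap.add_apply, h₁', h₂', smul_add]
  | htens s d' hp μ ω hS =>
  induction y using derived_induction with
  | hzero => simp only [map_zero, LinearMap.zero_apply, smul_zero]
  | hadd x₁ x₂ h₁' h₂' => simp only [map_add, LinearMap.add_apply, h₁', h₂', smul_add]
  | htens t e' hq ν η hT =>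
  induction z using derived_induction with
  | hzero => simp only [map_zero, LinearMap.zero_apply, smul_zero]
  | hadd x₁ x₂ h₁' h₂' => simp only [map_add, LinearMap.add_apply, h₁', h₂', smul_add]
  | htens u g' hr ρ ζ hU =>
    rw [derivedComp_tens h₁ hd₁ i hp hq rfl μ ν hS hT,
      derivedComp_tens h₃ hd₃ j hp hr rfl μ ρ hS hU, units_smul_map₂, units_smul_map₂,
      derivedComp_tens h₂ hd₂ _ (deg_add hd₁ hp hq) hr rfl _ _
        (mul_mem_gr (outerAlg_mem_gr h₁ i hS) (innerAlg_mem_gr h₁ i hT)) hU,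
      derivedComp_tens h₄ hd₄ _ (deg_add hd₃ hp hr) hq (add_right_comm _ _ _) _ _
        (mul_mem_gr (outerAlg_mem_gr h₃ j hS) (innerAlg_mem_gr h₃ j hU)) hT,
      hO.assoc_par h₁ h₂ h₃ h₄ rfl rfl rfl (add_right_comm _ _ _) i j hji hij, units_smul_map₂,
      map_mul (outerAlg k h₂ _), map_mul (outerAlg k h₄ _),
      outerAlg_outerAlg_par h₁ h₂ h₃ h₄ hji hij, outerAlg_innerAlg_par h₁ h₂ h₃ h₄ hji hij,
      outerAlg_innerAlg_par h₃ h₄ h₁ h₂ hij hji, mul_assoc, mul_assoc,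
      -- The words of `y` and `z` come in opposite orders on the two sides; exchanging them costs
      -- `(-1)^{tu}`.
      mul_comm_gr (innerAlg_mem_gr h₄ _ hT) (innerAlg_mem_gr h₂ _ hU),
      mul_smul_comm, units_smul_map]
    simp only [smul_smul, koszul, ← Int.negOnePow_add]
    congr 1
    rw [Int.negOnePow_eq_iff, tot_shift hq, tot_shift hr]
    push_cast
    -- The Koszul sign of the law in `O` involves `|ν| = |y| + t` and `|ρ| = |z| + u`. The extra
    -- terms, the sign of the exchange and the signs of the composites cancel up to twice this
    -- number.
    exact ⟨t * tot g + t * u, by ring⟩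

theorem derived_isOperad (hO : IsOperad O) : IsOperad (derived O) where
  perm_one x := derivedPerm_one hO x
  perm_mul σ τ x := derivedPerm_mul hO σ τ x
  comp_perm h hd i σ τ x y := derivedComp_perm hO h hd i σ τ x y
  one_comp h hd i x := by
    rw [derived_one]
    exact derivedComp_one_left hO h hd i x
  comp_one h hd i x := by
    rw [derived_one]
    exact derivedComp_one_right hO h hd i x
  assoc_seq h₁ h₂ h₃ h₄ hd₁ hd₂ hd₃ hd₄ i j x y z :=
    derivedComp_assoc_seq hO h₁ h₂ h₃ h₄ hd₁ hd₂ hd₃ hd₄ i j x y z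
  assoc_par h₁ h₂ h₃ h₄ hd₁ hd₂ hd₃ hd₄ i j hji hij x y z :=
    derivedComp_assoc_par hO h₁ h₂ h₃ h₄ hd₁ hd₂ hd₃ hd₄ i j hji hij x y z

end DerivedIsOperad
end DerivedOperad

namespace DerivedOperad

/-! ## Morphisms of operads -/

/-- Morphisms of operads. -/
structure OperadHom {k : Type u} [CommRing k] (P : OperadData.{u, v} k)
    (Q : OperadData.{u, w} k) where
  toFun : ∀ r d, P.carrier r d →ₗ[k] Q.carrier r d
  map_one : toFun 1 0 P.one = Q.one
  map_perm : ∀ {r d} (σ : Equiv.Perm (Fin r)) (x : P.carrier r d),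
    toFun r d (P.perm σ x) = Q.perm σ (toFun r d x)
  map_comp : ∀ {m n l d e f} (h : l + 1 = m + n) (hd : f = d + e) (i : Fin m)
    (x : P.carrier m d) (y : P.carrier n e),
    toFun l f (P.comp h hd i x y) = Q.comp h hd i (toFun m d x) (toFun n e y)

section Morphisms

variable {k : Type u} [CommRing k]

/-- Composition of morphisms of operads. -/
def OperadHom.trans {P : OperadData.{u, v} k} {Q : OperadData.{u, w} k} {S : OperadData.{u, x} k}
    (φ : OperadHom P Q) (ψ : OperadHom Q S) : OperadHom P S where
  toFun r d := (ψ.toFun r d).comp (φ.toFun r d)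
  map_one := by simp [φ.map_one, ψ.map_one]
  map_perm σ x := by simp [φ.map_perm, ψ.map_perm]
  map_comp h hd i x y := by simp [φ.map_comp, ψ.map_comp]

/-- The kernel of a morphism of operads. -/
def OperadHom.ker {P : OperadData.{u, v} k} {Q : OperadData.{u, w} k} (φ : OperadHom P Q) :
    OperadIdeal P where
  carrier r d := LinearMap.ker (φ.toFun r d)
  perm_mem σ x hx := by
    rw [LinearMap.mem_ker] at hx ⊢
    rw [φ.map_perm, hx, map_zero]
  comp_mem_left h hd i x y hx := by
    rw [LinearMap.mem_ker] at hx ⊢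
    rw [φ.map_comp, hx, map_zero, LinearMap.zero_apply]
  comp_mem_right h hd i x y hy := by
    rw [LinearMap.mem_ker] at hy ⊢
    rw [φ.map_comp, hy, map_zero]

theorem le_idealSpan (P : OperadData.{u, v} k) (R : ∀ r d, Submodule k (P.carrier r d))
    (r : ℕ) (d : Deg) : R r d ≤ (idealSpan P R).carrier r d :=
  le_iInf₂ fun _ hI => hI r d

/-- The projection to a quotient operad. -/
def mkHom (P : OperadData.{u, v} k) (I : OperadIdeal P) : OperadHom P (quotient P I) where
  toFun r d := (I.carrier r d).mkQ
  map_one := rfl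
  map_perm _ _ := rfl
  map_comp _ _ _ _ _ := rfl

theorem mkHom_surjective {P : OperadData.{u, v} k} (I : OperadIdeal P) (r : ℕ) (d : Deg) :
    Function.Surjective ((mkHom P I).toFun r d) :=
  Submodule.mkQ_surjective _

theorem mkHom_eq_zero {P : OperadData.{u, v} k} {R : ∀ r d, Submodule k (P.carrier r d)}
    {r : ℕ} {d : Deg} {z : P.carrier r d} (hz : z ∈ R r d) :
    (mkHom P (idealSpan P R)).toFun r d z = 0 :=
  (Submodule.Quotient.mk_eq_zero _).2 (le_idealSpan P R r d hz)

/-- The morphism of operads out of a quotient. -/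
def quotientLift {P : OperadData.{u, v} k} {Q : OperadData.{u, w} k} (φ : OperadHom P Q)
    (R : ∀ r d, Submodule k (P.carrier r d))
    (h : ∀ r d, ∀ z ∈ R r d, φ.toFun r d z = 0) :
    OperadHom (quotient P (idealSpan P R)) Q where
  -- The kernel of `φ` is one of the ideals whose intersection is the generated ideal.
  toFun r d := Submodule.liftQ _ (φ.toFun r d) (iInf₂_le φ.ker fun r d => h r d)
  map_one := φ.map_one
  map_perm {r d} σ x := by
    obtain ⟨x, rfl⟩ := Submodule.Quotient.mk_surjective _ x
    exact φ.map_perm σ x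
  map_comp {m n l d e f} h hd i x y := by
    obtain ⟨x, rfl⟩ := Submodule.Quotient.mk_surjective _ x
    obtain ⟨y, rfl⟩ := Submodule.Quotient.mk_surjective _ y
    exact φ.map_comp h hd i x y

/-- Functoriality of free operads, as a morphism of operads. -/
def Free.mapHom {E : SMod.{u, v} k} {F : SMod.{u, w} k} (φ : E.Hom F) :
    OperadHom (Free E) (Free F) where
  toFun := Free.map φ
  map_one := rfl
  map_perm := by rintro r d σ ⟨x⟩; rfl
  map_comp := by rintro m n l d e f h hd i ⟨x⟩ ⟨y⟩; rfl

/-- The value of a formal expression in an operad. -/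
def Pre.eval {E : SMod.{u, v} k} {Q : OperadData.{u, w} k}
    (φ : ∀ r d, E.carrier r d →ₗ[k] Q.carrier r d) :
    ∀ {r : ℕ} {d : Deg}, Pre E r d → Q.carrier r d
  | _, _, .gen x => φ _ _ x
  | _, _, .one => Q.one
  | _, _, .perm σ a => Q.perm σ (a.eval φ)
  | _, _, .comp h hd i a b => Q.comp h hd i (a.eval φ) (b.eval φ)
  | _, _, .zero => 0
  | _, _, .add a b => a.eval φ + b.eval φ
  | _, _, .smul c a => c • a.eval φ

theorem Rel.eval {E : SMod.{u, v} k} {Q : OperadData.{u, w} k} (hQ : IsOperad Q)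
    (φ : ∀ r d, E.carrier r d →ₗ[k] Q.carrier r d)
    (hφ : ∀ r d (σ : Equiv.Perm (Fin r)) (x : E.carrier r d),
      φ r d (E.perm r d σ x) = Q.perm σ (φ r d x)) {r : ℕ} {d : Deg} {a b : Pre E r d}
    (h : Rel E a b) : a.eval φ = b.eval φ := by
  induction h with
  | perm_congr σ _ ih => simp only [Pre.eval, ih]
  | comp_congr_left h hd i b _ ih => simp only [Pre.eval, ih]
  | comp_congr_right h hd i a _ ih => simp only [Pre.eval, ih]
  | add_congr_left b _ ih => simp only [Pre.eval, ih]
  | add_congr_right a _ ih => simp only [Pre.eval, ih]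
  | smul_congr c _ ih => simp only [Pre.eval, ih]
  | add_comm a b => exact _root_.add_comm _ _
  | add_assoc a b c => exact _root_.add_assoc _ _ _
  | zero_add a => exact _root_.zero_add _
  | one_smul a => exact _root_.one_smul _ _
  | zero_smul a => exact _root_.zero_smul _ _
  | mul_smul c c' a => exact SemigroupAction.mul_smul _ _ _
  | smul_add c a b => exact _root_.smul_add _ _ _
  | add_smul c c' a => exact _root_.add_smul _ _ _
  | gen_add x y => exact map_add _ _ _
  | gen_smul c x => exact map_smul _ _ _
  | gen_perm σ x => exact hφ _ _ σ x
  | perm_add σ a b => exact map_add _ _ _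
  | perm_smul σ c a => exact map_smul _ _ _
  | comp_add_left h hd i a a' b => simp only [Pre.eval, map_add, LinearMap.add_apply]
  | comp_smul_left h hd i c a b => simp only [Pre.eval, map_smul, LinearMap.smul_apply]
  | comp_add_right h hd i a b b' => simp only [Pre.eval, map_add]
  | comp_smul_right h hd i c a b => simp only [Pre.eval, map_smul]
  | perm_one a => exact hQ.perm_one _
  | perm_mul σ τ a => exact hQ.perm_mul σ τ _
  | comp_perm h hd i σ τ a b => exact hQ.comp_perm h hd i σ τ _ _
  | one_comp h hd i a => exact hQ.one_comp h hd i _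
  | comp_one h hd i a => exact hQ.comp_one h hd i _
  | assoc_seq h₁ h₂ h₃ h₄ hd₁ hd₂ hd₃ hd₄ i j x y z =>
    exact hQ.assoc_seq h₁ h₂ h₃ h₄ hd₁ hd₂ hd₃ hd₄ i j _ _ _
  | assoc_par h₁ h₂ h₃ h₄ hd₁ hd₂ hd₃ hd₄ i j hji hij x y z =>
    simp only [Pre.eval]
    rw [hQ.assoc_par h₁ h₂ h₃ h₄ hd₁ hd₂ hd₃ hd₄ i j hji hij, Units.smul_def,
      Int.cast_smul_eq_zsmul]

/-- The universal property of free operads. -/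
def Free.lift {E : SMod.{u, v} k} {Q : OperadData.{u, w} k} (hQ : IsOperad Q)
    (φ : ∀ r d, E.carrier r d →ₗ[k] Q.carrier r d)
    (hφ : ∀ r d (σ : Equiv.Perm (Fin r)) (x : E.carrier r d),
      φ r d (E.perm r d σ x) = Q.perm σ (φ r d x)) : OperadHom (Free E) Q where
  toFun r d :=
    { toFun := Quot.lift (Pre.eval φ) (fun _ _ h => h.eval hQ φ hφ)
      map_add' := by rintro ⟨a⟩ ⟨b⟩; rfl
      map_smul' := by rintro c ⟨a⟩; rfl }
  map_one := rfl
  map_perm := by rintro r d σ ⟨x⟩; rfl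
  map_comp := by rintro m n l d e f h hd i ⟨x⟩ ⟨y⟩; rfl

/-- Induction on the elements of free operads. -/
theorem Free.induction {E : SMod.{u, v} k}
    {motive : ∀ {r : ℕ} {d : Deg}, (Free E).carrier r d → Prop}
    (hgen : ∀ {r d} (x : E.carrier r d), motive (gen E r d x))
    (hone : motive (Free E).one)
    (hperm : ∀ {r d} (σ : Equiv.Perm (Fin r)) (x : (Free E).carrier r d), motive x →
      motive ((Free E).perm σ x))
    (hcomp : ∀ {m n l d e f} (h : l + 1 = m + n) (hd : f = d + e) (i : Fin m)
      (x : (Free E).carrier m d) (y : (Free E).carrier n e), motive x → motive y →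
      motive ((Free E).comp h hd i x y))
    (hzero : ∀ {r d}, motive (0 : (Free E).carrier r d))
    (hadd : ∀ {r d} (x y : (Free E).carrier r d), motive x → motive y → motive (x + y))
    (hsmul : ∀ {r d} (c : k) (x : (Free E).carrier r d), motive x → motive (c • x))
    {r : ℕ} {d : Deg} (z : (Free E).carrier r d) : motive z := by
  refine Quot.ind (fun a => ?_) z
  clear z
  induction a with
  | gen x => exact hgen x
  | one => exact hone
  | perm σ a ih => exact hperm σ _ ih
  | comp h hd i a b iha ihb => exact hcomp h hd i _ _ iha ihb
  | zero => exact hzero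
  | add a b iha ihb => exact hadd _ _ iha ihb
  | smul c a ih => exact hsmul c _ ih

theorem Free.hom_ext {E : SMod.{u, v} k} {Q : OperadData.{u, w} k} {φ ψ : OperadHom (Free E) Q}
    (h : ∀ r d (x : E.carrier r d), φ.toFun r d (gen E r d x) = ψ.toFun r d (gen E r d x))
    {r : ℕ} {d : Deg} (z : (Free E).carrier r d) : φ.toFun r d z = ψ.toFun r d z := by
  refine Free.induction (motive := fun {r d} z => φ.toFun r d z = ψ.toFun r d z)
    (h _ _) ?_ ?_ ?_ ?_ ?_ ?_ z
  · rw [φ.map_one, ψ.map_one]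
  · intro r d σ x hx
    rw [φ.map_perm, ψ.map_perm, hx]
  · intro m n l d e f h hd i x y hx hy
    rw [φ.map_comp, ψ.map_comp, hx, hy]
  · intro r d
    rw [map_zero, map_zero]
  · intro r d x y hx hy
    rw [map_add, map_add, hx, hy]
  · intro r d c x hx
    rw [map_smul, map_smul, hx]

end Morphisms

/-! ### The relations satisfied by `ε` in the derived operad -/

section DerivedMorphisms

variable {k : Type u} [CommRing k] {O : OperadData.{u, v} k}

theorem derivedInl_eq_tens {r : ℕ} {d : Deg} (μ : O.carrier r d) :
    derivedInl O r d μ = tens O d μ 1 := (tens_one _ μ).symm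

theorem derivedEps_eq_tens : derivedEps O = tens O (-1, 0) O.one (letter k 0) := by
  rw [← word_singleton, tens_word]
  rfl

/-- The inclusion of an operad in its derived operad, as a morphism of operads. -/
def derivedInlHom (O : OperadData.{u, v} k) : OperadHom O (derived O) where
  toFun := derivedInl O
  map_one := by
    rw [derivedInl_eq_tens, derived_one]
  map_perm {r d} σ x := by
    rw [derivedInl_eq_tens, derivedInl_eq_tens]
    refine Eq.symm ((derivedPerm_tens (p := 0) σ (by ext <;> simp) x one_mem_gr).trans ?_)
    rw [map_one]
  map_comp {m n l d e f} h hd i x y := by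
    rw [derivedInl_eq_tens, derivedInl_eq_tens, derivedInl_eq_tens]
    refine Eq.symm ((derivedComp_tens (p := 0) (q := 0) h hd i (by ext <;> simp)
      (by ext <;> simp) hd x y one_mem_gr one_mem_gr).trans ?_)
    simp

/-- No sign appears, because the operadic part of `ε = (1; ε)` is the unit, of degree zero. -/
theorem derivedInl_comp_eps (hO : IsOperad O) {r : ℕ} {d e : Deg} (hd : d = e + (-1, 0))
    (i : Fin r) (μ : O.carrier r e) :
    (derived O).comp rfl hd i (derivedInl O r e μ) (derivedEps O) = tens O d μ (letter k i) := by
  rw [derivedInl_eq_tens, derivedEps_eq_tens]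
  refine (derivedComp_tens (p := 0) (q := 1) rfl hd i (by ext <;> simp)
      (by ext <;> simp) (add_zero e).symm μ O.one one_mem_gr (letter_mem_gr 0)).trans ?_
  rw [hO.comp_one, innerAlg_letter, slot_inr_one]
  simp

/-- Here `μ` passes one letter, whence the sign, and that letter is distributed over all inputs.
Comparison with `derivedInl_comp_eps` gives the relations `D`. -/
theorem derivedEps_comp_inl (hO : IsOperad O) {r : ℕ} {d e : Deg} (h : r + 1 = 1 + r)
    (hd : d = (-1, 0) + e) (μ : O.carrier r e) :
    (derived O).comp h hd 0 (derivedEps O) (derivedInl O r e μ) =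
      Int.negOnePow (tot e) • ∑ i, tens O d μ (letter k i) := by
  rw [derivedInl_eq_tens, derivedEps_eq_tens]
  refine (derivedComp_tens (p := 1) (q := 0) h hd 0 (by ext <;> simp)
      (by ext <;> simp) (zero_add e).symm O.one μ (letter_mem_gr 0) one_mem_gr).trans ?_
  rw [hO.one_comp, outerAlg_letter_self]
  simp [slot_one_inr]

theorem derivedEps_comp_eps {d : Deg} (h : 1 + 1 = 1 + 1)
    (hd : d = (-1, 0) + (-1, 0)) :
    (derived O).comp h hd 0 (derivedEps O) (derivedEps O) = 0 := by
  rw [derivedEps_eq_tens]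
  refine (derivedComp_tens (p := 1) (q := 1) h hd 0 (by ext <;> simp)
      (by ext <;> simp) (zero_add 0).symm O.one O.one (letter_mem_gr 0) (letter_mem_gr 0)).trans ?_
  rw [outerAlg_one, innerAlg_letter, slot_inr_one, letter_mul_self, map_zero, smul_zero]
  rfl

end DerivedMorphisms
end DerivedOperad

namespace DerivedOperad

/-! ### The exterior algebra acting by insertions of `ε` -/

section Action

variable {k : Type u} [CommRing k]

/-- The condition for extending a linear map to the exterior algebra. The squares have to be assumed
zero separately, since `2` may fail to be invertible. -/
theorem sum_smul_mul_self {A : Type*} [Ring A] [Algebra k A] {ι : Type*} (L : ι → A)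
    (h0 : ∀ a, L a * L a = 0) (h1 : ∀ a b, a ≠ b → L a * L b + L b * L a = 0) (c : ι → k)
    (s : Finset ι) : (∑ a ∈ s, c a • L a) * (∑ a ∈ s, c a • L a) = 0 := by
  classical
  induction s using Finset.induction_on with
  | empty => simp
  | insert b s hb ih =>
    have e : L b * (∑ a ∈ s, c a • L a) + (∑ a ∈ s, c a • L a) * L b = 0 := by
      rw [Finset.mul_sum, Finset.sum_mul, ← Finset.sum_add_distrib]
      refine Finset.sum_eq_zero fun a ha => ?_
      rw [mul_smul_comm, smul_mul_assoc, ← smul_add, h1 b a (fun e => hb (e ▸ ha)), smul_zero]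
    rw [Finset.sum_insert hb, add_mul, mul_add, mul_add, ih, add_zero, smul_mul_assoc,
      mul_smul_comm, h0, smul_zero, smul_zero, zero_add, mul_smul_comm, smul_mul_assoc, ← smul_add,
      e, smul_zero]

/-- The product of the components of an operad of a given arity. -/
abbrev Tot (Q : OperadData.{u, v} k) (r : ℕ) : Type v := ∀ d : Deg, Q.carrier r d

theorem deg_eps (d : Deg) : d = (d + (1, 0)) + (-1, 0) := by
  ext <;> simp

/-- The insertion of an element `ε` of arity `1` in the input `a`. -/
def insertEps (Q : OperadData.{u, v} k) (ε : Q.carrier 1 (-1, 0)) {r : ℕ} (a : Fin r) :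
    Module.End k (Tot Q r) :=
  -- Insertion lowers the horizontal degree by one, so it is an endomorphism only of the product
  -- over all bidegrees.
  LinearMap.pi fun d => ((Q.comp rfl (deg_eps d) a).flip ε).comp (LinearMap.proj (d + (1, 0)))

variable {Q : OperadData.{u, v} k}

theorem insertEps_apply (ε : Q.carrier 1 (-1, 0)) {r : ℕ} (a : Fin r) (z : Tot Q r) (d : Deg) :
    insertEps Q ε a z d = Q.comp rfl (deg_eps d) a (z (d + (1, 0))) ε := rfl

/-- By sequential associativity, two insertions in the same input amount to the insertion of `ε ∘
ε`. -/
theorem insertEps_mul_self (hQ : IsOperad Q) {ε : Q.carrier 1 (-1, 0)}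
    (hε : ∀ (d : Deg) (hd : d = (-1, 0) + (-1, 0)), Q.comp (l := 1) rfl hd 0 ε ε = 0)
    {r : ℕ} (a : Fin r) : insertEps Q ε a * insertEps Q ε a = 0 := by
  refine LinearMap.ext fun z => funext fun d => ?_
  rw [Module.End.mul_apply, insertEps_apply, insertEps_apply]
  have := hQ.assoc_seq (p := r) (q := 1) (l := r) rfl rfl rfl rfl (deg_eps (d + (1, 0))) (deg_eps d)
    rfl (show d = (d + (1, 0) + (1, 0)) + ((-1, 0) + (-1, 0)) by ext <;> simp; ring) a 0
    (z (d + (1, 0) + (1, 0))) ε ε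
  rw [slot_inr_one, hε _ rfl, map_zero] at this
  exact this

theorem koszul_eps : koszul (-1, 0) (-1, 0) = -1 := by
  simp [koszul, tot]

/-- Parallel associativity exchanges insertions in different inputs with the Koszul sign of two odd
elements. -/
theorem insertEps_mul (hQ : IsOperad Q) (ε : Q.carrier 1 (-1, 0)) {r : ℕ} {a b : Fin r}
    (hab : a ≠ b) :
    insertEps Q ε a * insertEps Q ε b + insertEps Q ε b * insertEps Q ε a = 0 := by
  refine LinearMap.ext fun z => funext fun d => ?_
  change insertEps Q ε a (insertEps Q ε b z) d + insertEps Q ε b (insertEps Q ε a z) d = 0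
  simp only [insertEps_apply]
  have := hQ.assoc_par (p := r) (q := r) (l := r) rfl rfl rfl rfl (deg_eps (d + (1, 0))) (deg_eps d)
    (deg_eps (d + (1, 0))) (deg_eps d) b a hab hab.symm (z (d + (1, 0) + (1, 0))) ε ε
  rw [slot_inl_one, slot_inl_one, koszul_eps, Units.neg_smul, one_smul] at this
  exact eq_neg_iff_add_eq_zero.1 this

/-- The right action of the exterior algebra by insertions of an element `ε` with `ε ∘ ε = 0`. -/
noncomputable def rightAction (hQ : IsOperad Q) {ε : Q.carrier 1 (-1, 0)}
    (hε : ∀ (d : Deg) (hd : d = (-1, 0) + (-1, 0)), Q.comp (l := 1) rfl hd 0 ε ε = 0) (r : ℕ) :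
    -- The opposite algebra appears because the leftmost letter of a word is inserted first.
    Lam k r →ₐ[k] (Module.End k (Tot Q r))ᵐᵒᵖ :=
  ExteriorAlgebra.lift k ⟨(Pi.basisFun k (Fin r)).constr k
    (fun a => MulOpposite.op (insertEps Q ε a)), fun v => by
      rw [Module.Basis.constr_apply_fintype]
      refine sum_smul_mul_self _ (fun a => ?_) (fun a b hab => ?_) _ _
      · rw [← MulOpposite.op_mul, insertEps_mul_self hQ hε, MulOpposite.op_zero]
      · rw [← MulOpposite.op_mul, ← MulOpposite.op_mul, ← MulOpposite.op_add,
          insertEps_mul hQ ε hab.symm, MulOpposite.op_zero]⟩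

/-- The right action of the exterior algebra, as a function. -/
noncomputable def ract (hQ : IsOperad Q) {ε : Q.carrier 1 (-1, 0)}
    (hε : ∀ (d : Deg) (hd : d = (-1, 0) + (-1, 0)), Q.comp (l := 1) rfl hd 0 ε ε = 0) {r : ℕ}
    (ω : Lam k r) : Module.End k (Tot Q r) :=
  (rightAction hQ hε r ω).unop

variable (hQ : IsOperad Q) {ε : Q.carrier 1 (-1, 0)}
  (hε : ∀ (d : Deg) (hd : d = (-1, 0) + (-1, 0)), Q.comp (l := 1) rfl hd 0 ε ε = 0)

theorem ract_one {r : ℕ} (z : Tot Q r) : ract hQ hε 1 z = z := by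
  rw [ract, map_one, MulOpposite.unop_one, Module.End.one_apply]

theorem ract_mul {r : ℕ} (ω η : Lam k r) (z : Tot Q r) :
    ract hQ hε (ω * η) z = ract hQ hε η (ract hQ hε ω z) := by
  rw [ract, map_mul, MulOpposite.unop_mul, Module.End.mul_apply]
  rfl

theorem ract_letter {r : ℕ} (a : Fin r) (z : Tot Q r) :
    ract hQ hε (letter k a) z = insertEps Q ε a z := by
  rw [ract, letter, rightAction, ExteriorAlgebra.lift_ι_apply, constr_single,
    MulOpposite.unop_op]

theorem ract_units_smul {r : ℕ} (s : ℤˣ) (ω : Lam k r) (z : Tot Q r) :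
    ract hQ hε (s • ω) z = s • ract hQ hε ω z := by
  rw [ract, Units.smul_def, map_zsmul]
  rfl

theorem ract_zero {r : ℕ} (z : Tot Q r) : ract hQ hε 0 z = 0 := by
  rw [ract, map_zero]
  rfl

/-- The map induced on products of components. -/
def totMap {P : OperadData.{u, w} k} (φ : OperadHom P Q) (r : ℕ) : Tot P r →ₗ[k] Tot Q r :=
  LinearMap.pi fun d => (φ.toFun r d).comp (LinearMap.proj d)

theorem totMap_single {P : OperadData.{u, w} k} (φ : OperadHom P Q) {r : ℕ} {d : Deg}
    (x : P.carrier r d) :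
    totMap φ r (Pi.single d x) = Pi.single d (φ.toFun r d x) := by
  funext e
  change φ.toFun r e (Pi.single d x e) = _
  exact Pi.apply_single (fun e => φ.toFun r e) (fun e => map_zero _) d x e

/-- A morphism of operads matching the two elements `ε` commutes with each insertion, hence with
words. -/
theorem totMap_ract {P : OperadData.{u, w} k} (hP : IsOperad P) {ε' : P.carrier 1 (-1, 0)}
    (hε' : ∀ (d : Deg) (hd : d = (-1, 0) + (-1, 0)), P.comp (l := 1) rfl hd 0 ε' ε' = 0)
    (φ : OperadHom P Q) (hφ : φ.toFun 1 (-1, 0) ε' = ε) {r : ℕ} (S : Finset (Fin r))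
    (z : Tot P r) :
    totMap φ r (ract hP hε' (word k S) z) = ract hQ hε (word k S) (totMap φ r z) := by
  induction S using Finset.induction_on_min generalizing z with
  | empty => rw [word_empty, ract_one, ract_one]
  | insert a S ha ih =>
    rw [word_insert_of_lt ha, ract_mul, ract_mul, ih, ract_letter, ract_letter]
    congr 1
    funext d
    rw [insertEps_apply]
    change φ.toFun r d (P.comp rfl _ _ _ _) = _
    rw [φ.map_comp, hφ]
    rfl

end Action

/-! ### The action on the derived operad is right multiplication -/

section DerivedAction

variable {k : Type u} [CommRing k] {O : OperadData.{u, v} k}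

theorem tens_eq_zero {r p : ℕ} {d e : Deg} (h : e ≠ d + ((p : ℤ), 0)) (μ : O.carrier r e)
    {ω : Lam k r} (hω : ω ∈ gr k r p) : tens O d μ ω = 0 := by
  refine gr_induction (motive := fun ω => tens O d μ ω = 0) hω (fun S hS => ?_) (map_zero _)
    (fun x y hx hy => by rw [map_add, hx, hy, add_zero])
    (fun c x hx => by rw [map_smul, hx, smul_zero])
  subst hS
  exact tens_word_of_ne h μ

/-- All components of `(μ; ω)`. -/
noncomputable def totTens {r : ℕ} {e : Deg} (μ : O.carrier r e) (ω : Lam k r) :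
    Tot (derived O) r := fun d => tens O d μ ω

theorem insertEps_totTens (hO : IsOperad O) {r p : ℕ} {e : Deg} (μ : O.carrier r e)
    {ω : Lam k r} (hω : ω ∈ gr k r p) (a : Fin r) :
    insertEps (derived O) (derivedEps O) a (totTens μ ω) = totTens μ (ω * letter k a) := by
  funext d
  rw [insertEps_apply, derivedEps_eq_tens]
  change derivedComp O rfl _ a (tens O _ μ ω) (tens O _ O.one (letter k 0)) =
    tens O d μ (ω * letter k a)
  -- If the bidegrees do not fit the length of `ω`, both sides vanish.
  by_cases h : e = (d + (1, 0)) + ((p : ℤ), 0)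
  · rw [derivedComp_tens (q := 1) rfl (deg_eps d) a h (by ext <;> simp) (add_zero e).symm μ O.one
      hω (letter_mem_gr 0), hO.comp_one, outerAlg_one, innerAlg_letter, slot_inr_one]
    simp [tot]
  · rw [tens_eq_zero h μ hω, map_zero, LinearMap.zero_apply,
      tens_eq_zero (fun h' => h (h'.trans (by ext <;> simp; ring))) μ
        (mul_mem_gr hω (letter_mem_gr a))]

theorem derivedEps_sq (d : Deg) (hd : d = (-1, 0) + (-1, 0)) :
    (derived O).comp (l := 1) rfl hd 0 (derivedEps O) (derivedEps O) = 0 :=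
  derivedEps_comp_eps _ hd

theorem ract_totTens (hO : IsOperad O) {r p : ℕ} {e : Deg} (μ : O.carrier r e)
    {ω : Lam k r} (hω : ω ∈ gr k r p) (S : Finset (Fin r)) :
    ract (derived_isOperad hO) derivedEps_sq (word k S) (totTens μ ω) =
      totTens μ (ω * word k S) := by
  induction S using Finset.induction_on_min generalizing p ω with
  | empty => rw [word_empty, ract_one, mul_one]
  | insert a S ha ih =>
    rw [word_insert_of_lt ha, ract_mul, ract_letter, insertEps_totTens hO μ hω,
      ih (mul_mem_gr hω (letter_mem_gr a)), mul_assoc]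

theorem single_derivedInl {r : ℕ} {e : Deg} (μ : O.carrier r e) :
    (Pi.single e (derivedInl O r e μ) : Tot (derived O) r) = totTens μ 1 := by
  funext d
  by_cases h : d = e
  · subst h
    rw [Pi.single_eq_same, derivedInl_eq_tens]
    rfl
  · rw [Pi.single_eq_of_ne h]
    refine Eq.symm (tens_eq_zero (p := 0) (fun h' => h ?_) μ one_mem_gr)
    rw [h']
    ext <;> simp

end DerivedAction

/-! ### The candidate inverse and its image -/

section Section

variable {k : Type u} [CommRing k] {O : OperadData.{u, v} k} {P : OperadData.{u, w} k}
  (hP : IsOperad P) {ε : P.carrier 1 (-1, 0)}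
  (hε : ∀ (d : Deg) (hd : d = (-1, 0) + (-1, 0)), P.comp (l := 1) rfl hd 0 ε ε = 0)
  (j : OperadHom O P)

/-- The linear map `(μ; ε^S) ↦ j(μ) · ε^S`. -/
noncomputable def fromDerived (r : ℕ) (d : Deg) : DerivedCarrier O r d →ₗ[k] P.carrier r d :=
  ∑ S : Finset (Fin r), (LinearMap.proj d).comp ((ract hP hε (word k S)).comp
    ((LinearMap.single k (fun d => P.carrier r d) (shift d S)).comp
      ((j.toFun r (shift d S)).comp (LinearMap.proj S))))

theorem fromDerived_apply {r : ℕ} {d : Deg} (x : DerivedCarrier O r d) :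
    fromDerived hP hε j r d x = ∑ S : Finset (Fin r),
      ract hP hε (word k S) (Pi.single (shift d S) (j.toFun r (shift d S) (x S))) d := by
  rw [fromDerived, LinearMap.sum_apply]
  rfl

theorem fromDerived_elementary {r : ℕ} {d e : Deg} {S : Finset (Fin r)} (h : e = shift d S)
    (μ : O.carrier r e) : fromDerived hP hε j r d (elementary O S h μ) =
      ract hP hε (word k S) (Pi.single e (j.toFun r e μ)) d := by
  subst h
  have e1 : ∀ S', (elementary O (d := d) S rfl μ) S' =
    Pi.single (M := fun S => O.carrier r (shift d S)) S μ S' := fun _ => rfl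
  rw [fromDerived_apply, Finset.sum_eq_single S]
  · rw [e1, Pi.single_eq_same]
  · intro S' _ hS'
    rw [e1, Pi.single_eq_of_ne hS', map_zero, Pi.single_zero, map_zero]
    rfl
  · simp

/-- The morphism `Φ` respects the actions, so `j(μ) · ε^S` goes to `(μ; 1) · ε^S`, which is `(μ;
ε^S)`. -/
theorem apply_fromDerived (hO : IsOperad O) (Φ : OperadHom P (derived O))
    (hΦε : Φ.toFun 1 (-1, 0) ε = derivedEps O)
    (hΦj : ∀ r d μ, Φ.toFun r d (j.toFun r d μ) = derivedInl O r d μ) {r : ℕ} {d : Deg}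
    (x : DerivedCarrier O r d) : Φ.toFun r d (fromDerived hP hε j r d x) = x := by
  induction x using derived_induction' with
  | hzero => rw [map_zero, map_zero]; rfl
  | hadd x y hx hy => rw [map_add, map_add, hx, hy]; rfl
  | helem S μ =>
    rw [fromDerived_elementary]
    have := congrFun (totMap_ract (derived_isOperad hO) derivedEps_sq hP hε Φ hΦε S
      (Pi.single (shift d S) (j.toFun r (shift d S) μ))) d
    rw [totMap_single, hΦj, single_derivedInl, ract_totTens hO μ one_mem_gr, one_mul] at this
    refine this.trans ?_
    exact tens_word rfl μ

/-- Inserting `ε` in the input `a` is the action of a letter, and a word times a letter is zero or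
another word up to sign. -/
theorem comp_eps_mem_range {r : ℕ} {d e : Deg} (hd : d = e + (-1, 0)) (a : Fin r)
    {y : P.carrier r e} (hy : y ∈ LinearMap.range (fromDerived hP hε j r e)) :
    P.comp rfl hd a y ε ∈ LinearMap.range (fromDerived hP hε j r d) := by
  obtain rfl : e = d + (1, 0) := by
    rw [hd]
    ext <;> simp
  obtain ⟨x, rfl⟩ := hy
  induction x using derived_induction' with
  | hzero =>
    rw [map_zero, map_zero, LinearMap.zero_apply]
    exact Submodule.zero_mem _
  | hadd x y hx hy =>
    rw [map_add, map_add, LinearMap.add_apply]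
    exact Submodule.add_mem _ hx hy
  | helem S μ =>
    rw [fromDerived_elementary]
    change insertEps P ε a (ract hP hε (word k S) (Pi.single _ _)) d ∈ _
    rw [← ract_letter hP hε, ← ract_mul, ← word_singleton, word_mul_word]
    split_ifs with h
    · rw [ract_units_smul]
      refine smul_units_mem _ _ ⟨elementary O (S ∪ {a}) ?_ μ, fromDerived_elementary _ _ _ _ _⟩
      rw [shift, shift, Finset.card_union_of_disjoint h]
      ext
      · simp
        ring
      · simp
    · rw [ract_zero]
      exact Submodule.zero_mem _

theorem map_mem_range {r : ℕ} {d : Deg} (μ : O.carrier r d) :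
    j.toFun r d μ ∈ LinearMap.range (fromDerived hP hε j r d) := by
  refine ⟨elementary O ∅ (by simp [shift]) μ, ?_⟩
  rw [fromDerived_elementary, word_empty, ract_one, Pi.single_eq_same]

end Section
end DerivedOperad

namespace DerivedOperad

/-! ### Composition with `ε` as a signed derivation -/

section Derivation

variable {k : Type u} [CommRing k] {P : OperadData.{u, w} k}

/-- The relation `ε ∘ y = (-1)^{|y|} ∑ᵢ y ∘ᵢ ε`. -/
def Derives (ε : P.carrier 1 (-1, 0)) {r : ℕ} {e : Deg} (y : P.carrier r e) : Prop :=
  ∀ (d : Deg) (h : r + 1 = 1 + r) (hd : d = (-1, 0) + e) (hd' : d = e + (-1, 0)),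
    P.comp h hd 0 ε y = Int.negOnePow (tot e) • ∑ i : Fin r, P.comp rfl hd' i y ε

variable {ε : P.carrier 1 (-1, 0)}

theorem Derives.zero {r : ℕ} {e : Deg} : Derives ε (0 : P.carrier r e) := by
  intro d h hd hd'
  simp

theorem Derives.add {r : ℕ} {e : Deg} {x y : P.carrier r e} (hx : Derives ε x)
    (hy : Derives ε y) : Derives ε (x + y) := by
  intro d h hd hd'
  rw [map_add, hx d h hd hd', hy d h hd hd', ← smul_add, ← Finset.sum_add_distrib]
  simp only [map_add, LinearMap.add_apply]

theorem Derives.smul {r : ℕ} {e : Deg} {x : P.carrier r e} (c : k) (hx : Derives ε x) :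
    Derives ε (c • x) := by
  intro d h hd hd'
  rw [map_smul, hx d h hd hd', smul_comm, Finset.smul_sum]
  simp only [map_smul, LinearMap.smul_apply]

theorem Derives.one (hP : IsOperad P) : Derives ε P.one := by
  intro d h hd hd'
  obtain rfl : d = (-1, 0) := by simpa using hd
  rw [hP.comp_one, Fin.sum_univ_one, hP.one_comp]
  simp [tot]

theorem Derives.perm (hP : IsOperad P) {r : ℕ} {e : Deg} {y : P.carrier r e}
    (σ : Equiv.Perm (Fin r)) (hy : Derives ε y) : Derives ε (P.perm σ y) := by
  intro d h hd hd'
  have h1 := hP.comp_perm h hd 0 1 σ ε y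
  rw [hP.perm_one, blockPerm_one_left, hy d h hd hd', units_smul_map, map_sum] at h1
  refine h1.trans ?_
  rw [← Equiv.sum_comp σ (fun i => P.comp rfl hd' i (P.perm σ y) ε)]
  congr 1
  refine Finset.sum_congr rfl fun i _ => ?_
  have h2 := hP.comp_perm rfl hd' i σ 1 y ε
  rw [hP.perm_one, blockPerm_one_right] at h2
  exact h2.symm

theorem koszul_eps_left (e : Deg) : koszul (-1, 0) e = Int.negOnePow (tot e) := by
  rw [koszul, show tot (-1, 0) * tot e = -tot e by simp [tot], Int.negOnePow_neg]

theorem comp_eps_comp_of_ne (hP : IsOperad P) {m n l : ℕ} {d e f d' : Deg} (h : l + 1 = m + n)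
    (hd : d = d' + (-1, 0)) (hf : f = d + e) {g : Deg} (hg : g = d' + e) (hfg : f = g + (-1, 0))
    {a i : Fin m} (hia : i ≠ a) (x : P.carrier m d') (y : P.carrier n e) :
    P.comp h hf i (P.comp rfl hd a x ε) y = Int.negOnePow (tot e) •
      P.comp rfl hfg (slot h i (Sum.inl ⟨a, hia.symm⟩)) (P.comp h hg i x y) ε := by
  have := hP.assoc_par (p := m) rfl h h rfl hd hf hg hfg a i hia hia.symm x ε y
  rwa [slot_inl_one, koszul_eps_left] at this

/-- Associativity turns the left side into `x ∘ᵢ (ε ∘ y)`; the derivation property moves `ε` to the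
inputs of `y`, and associativity is used backwards on each term. -/
theorem comp_eps_comp_self (hP : IsOperad P) {m n l : ℕ} {d e f d' : Deg} (h : l + 1 = m + n)
    (hd : d = d' + (-1, 0)) (hf : f = d + e) {g : Deg} (hg : g = d' + e) (hfg : f = g + (-1, 0))
    (i : Fin m) (x : P.carrier m d') {y : P.carrier n e} (hy : Derives ε y) :
    P.comp h hf i (P.comp rfl hd i x ε) y = Int.negOnePow (tot e) •
      ∑ b : Fin n, P.comp rfl hfg (slot h i (Sum.inr b)) (P.comp h hg i x y) ε := by
  have h1 := hP.assoc_seq (p := m) (q := n) rfl h (Nat.add_comm n 1) h hd hf rfl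
    (by rw [hf, hd, add_assoc]) i 0 x ε y
  rw [slot_inr_one, hy _ _ rfl (add_comm _ _), units_smul_map, map_sum] at h1
  rw [h1]
  congr 1
  refine Finset.sum_congr rfl fun b _ => ?_
  exact (hP.assoc_seq h rfl rfl h hg hfg (add_comm _ _) (by rw [hf, hd, add_assoc]) i b x y ε).symm

/-- The Leibniz rule: `ε` is first moved to the inputs of `x`. At the input `i` it goes on through
`y`, at the other inputs it passes `y` with a Koszul sign, and the results are all inputs of the
composite. -/
theorem Derives.comp (hP : IsOperad P) {m n l : ℕ} {d e f : Deg} (h : l + 1 = m + n)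
    (hf : f = d + e) (i : Fin m) {x : P.carrier m d} {y : P.carrier n e} (hx : Derives ε x)
    (hy : Derives ε y) : Derives ε (P.comp h hf i x y) := by
  intro g h' hg hg'
  have e1 : g = (-1, 0) + d + e := by rw [hg, hf, add_assoc]
  have h1 := hP.assoc_seq (Nat.add_comm m 1) h h h' rfl e1 hf hg 0 i ε x y
  rw [slot_one_inr, hx _ _ rfl (add_comm _ _), units_smul_map₂, map_sum, LinearMap.sum_apply] at h1
  rw [← h1, Fintype.sum_eq_add_sum_subtype_ne _ i,
    comp_eps_comp_self hP h (add_comm _ _) e1 hf hg' i x hy,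
    Finset.sum_congr rfl fun (a : {a : Fin m // a ≠ i}) _ =>
      comp_eps_comp_of_ne (ε := ε) hP h (add_comm _ _) e1 hf hg' (Ne.symm a.2) x y,
    ← Finset.smul_sum, ← smul_add, smul_smul, ← Int.negOnePow_add, ← tot_add, ← hf,
    ← Equiv.sum_comp (slot h i), Fintype.sum_sum_type, add_comm (∑ b : Fin n, _)]

/-- If generators satisfy the derivation property, then so does the image of the free operad. -/
theorem derives_of_gen (hP : IsOperad P) {E : SMod.{u, v} k} (φ : OperadHom (Free E) P)
    (hgen : ∀ {r d} (x : E.carrier r d), Derives ε (φ.toFun r d (gen E r d x)))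
    {r : ℕ} {d : Deg} (z : (Free E).carrier r d) : Derives ε (φ.toFun r d z) := by
  refine Free.induction (motive := fun {r d} z => Derives ε (φ.toFun r d z))
    hgen ?_ ?_ ?_ ?_ ?_ ?_ z
  · rw [φ.map_one]
    exact Derives.one hP
  · intro r d σ x hx
    rw [φ.map_perm]
    exact hx.perm hP σ
  · intro m n l d e f h hd i x y hx hy
    rw [φ.map_comp]
    exact hx.comp hP h hd i hy
  · intro r d
    rw [map_zero]
    exact Derives.zero
  · intro r d x y hx hy
    rw [map_add]
    exact hx.add hy
  · intro r d c x hx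
    rw [map_smul]
    exact hx.smul c

end Derivation

/-! ### Elements obtained by insertions of `ε` exhaust the operad -/

section Generated

variable {k : Type u} [CommRing k] {O : OperadData.{u, v} k} {P : OperadData.{u, w} k}

/-- The elements obtained from the image of a morphism by insertions of `ε` and sums. -/
inductive Generated (j : OperadHom O P) (ε : P.carrier 1 (-1, 0)) :
    ∀ {r : ℕ} {d : Deg}, P.carrier r d → Prop
  | base {r : ℕ} {d : Deg} (μ : O.carrier r d) : Generated j ε (j.toFun r d μ)
  | add {r : ℕ} {d : Deg} {x y : P.carrier r d} : Generated j ε x → Generated j ε y →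
      Generated j ε (x + y)
  | insert {r : ℕ} {d e : Deg} (hd : d = e + (-1, 0)) (a : Fin r) {x : P.carrier r e} :
      Generated j ε x → Generated j ε (P.comp rfl hd a x ε)

variable {j : OperadHom O P} {ε : P.carrier 1 (-1, 0)}

theorem Generated.zero {r : ℕ} {d : Deg} : Generated j ε (0 : P.carrier r d) := by
  have := Generated.base (j := j) (ε := ε) (0 : O.carrier r d)
  rwa [map_zero] at this

theorem Generated.sum {ι : Type*} {r : ℕ} {d : Deg} (s : Finset ι) (x : ι → P.carrier r d)
    (h : ∀ a ∈ s, Generated j ε (x a)) : Generated j ε (∑ a ∈ s, x a) :=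
  Finset.sum_induction _ _ (fun _ _ => Generated.add) Generated.zero h

theorem Generated.smul {r : ℕ} {d : Deg} {x : P.carrier r d} (c : k) (hx : Generated j ε x) :
    Generated j ε (c • x) := by
  induction hx with
  | base μ =>
    rw [← map_smul]
    exact Generated.base _
  | add _ _ ihx ihy =>
    rw [smul_add]
    exact Generated.add ihx ihy
  | insert hd a _ ih =>
    rw [← LinearMap.smul_apply, ← map_smul]
    exact Generated.insert hd a ih

theorem Generated.units_smul {r : ℕ} {d : Deg} {x : P.carrier r d} (s : ℤˣ)
    (hx : Generated j ε x) : Generated j ε (s • x) := by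
  rw [Units.smul_def, ← Int.cast_smul_eq_zsmul k]
  exact hx.smul _

theorem Generated.perm (hP : IsOperad P) {r : ℕ} {d : Deg} {x : P.carrier r d}
    (σ : Equiv.Perm (Fin r)) (hx : Generated j ε x) : Generated j ε (P.perm σ x) := by
  induction hx with
  | base μ =>
    rw [← j.map_perm]
    exact Generated.base _
  | add _ _ ihx ihy =>
    rw [map_add]
    exact Generated.add ihx ihy
  | @insert d e hd a x _ ih =>
    have h := hP.comp_perm rfl hd a σ 1 x ε
    rw [hP.perm_one, blockPerm_one_right] at h
    rw [← h]
    exact Generated.insert hd _ ih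

/-- An `ε` already inserted in `x` is moved out past `ν`: by the derivation property if it sits at
the input `i`, and by parallel associativity otherwise. -/
theorem Generated.comp_base (hP : IsOperad P)
    (hj : ∀ {r d} (μ : O.carrier r d), Derives ε (j.toFun r d μ)) {m n l : ℕ} {d e f : Deg}
    (h : l + 1 = m + n) (hf : f = d + e) (i : Fin m) {x : P.carrier m d} (ν : O.carrier n e)
    (hx : Generated j ε x) : Generated j ε (P.comp h hf i x (j.toFun n e ν)) := by
  induction hx generalizing l f with
  | base μ =>
    rw [← j.map_comp]
    exact Generated.base _
  | add _ _ ihx ihy =>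
    rw [map_add, LinearMap.add_apply]
    exact Generated.add (ihx h hf) (ihy h hf)
  | @insert d d' hd a x _ ih =>
    have hfg : f = (d' + e) + (-1, 0) := by rw [hf, hd, add_right_comm]
    by_cases hia : i = a
    · subst hia
      rw [comp_eps_comp_self hP h hd hf rfl hfg i x (hj ν)]
      exact (Generated.sum _ _ fun b _ => Generated.insert hfg _ (ih h rfl)).units_smul _
    · rw [comp_eps_comp_of_ne hP h hd hf rfl hfg hia]
      exact (Generated.insert hfg _ (ih h rfl)).units_smul _

/-- An `ε` at an input of `y` is an `ε` at an input of the composite, by sequential associativity.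
Stripping these off reduces to `y` in the image of `j`. -/
theorem Generated.comp (hP : IsOperad P)
    (hj : ∀ {r d} (μ : O.carrier r d), Derives ε (j.toFun r d μ)) {m n l : ℕ} {d e f : Deg}
    (h : l + 1 = m + n) (hf : f = d + e) (i : Fin m) {x : P.carrier m d} {y : P.carrier n e}
    (hx : Generated j ε x) (hy : Generated j ε y) : Generated j ε (P.comp h hf i x y) := by
  induction hy generalizing l f with
  | base ν => exact Generated.comp_base hP hj h hf i ν hx
  | add _ _ ihx ihy =>
    rw [map_add]
    exact Generated.add (ihx h hf) (ihy h hf)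
  | @insert e e' he b y _ ih =>
    have hfg : f = (d + e') + (-1, 0) := by rw [hf, he, add_assoc]
    rw [← hP.assoc_seq h rfl rfl h rfl hfg he hf i b x y ε]
    exact Generated.insert hfg _ (ih h rfl)

/-- The elements of an operad with generators in the image of a morphism and `ε`. -/
theorem generated_of_gen (hP : IsOperad P)
    (hj : ∀ {r d} (μ : O.carrier r d), Derives ε (j.toFun r d μ)) {E : SMod.{u, x} k}
    (φ : OperadHom (Free E) P)
    (hgen : ∀ {r d} (x : E.carrier r d), Generated j ε (φ.toFun r d (gen E r d x)))
    {r : ℕ} {d : Deg} (z : (Free E).carrier r d) : Generated j ε (φ.toFun r d z) := by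
  refine Free.induction (motive := fun {r d} z => Generated j ε (φ.toFun r d z))
    hgen ?_ ?_ ?_ ?_ ?_ ?_ z
  · rw [φ.map_one, ← j.map_one]
    exact Generated.base _
  · intro r d σ x hx
    rw [φ.map_perm]
    exact hx.perm hP σ
  · intro m n l d e f h hd i x y hx hy
    rw [φ.map_comp]
    exact hx.comp hP hj h hd i hy
  · intro r d
    rw [map_zero]
    exact Generated.zero
  · intro r d x y hx hy
    rw [map_add]
    exact hx.add hy
  · intro r d c x hx
    rw [map_smul]
    exact hx.smul c

theorem Generated.mem_range (hP : IsOperad P)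
    (hε : ∀ (d : Deg) (hd : d = (-1, 0) + (-1, 0)), P.comp (l := 1) rfl hd 0 ε ε = 0)
    {r : ℕ} {d : Deg} {x : P.carrier r d} (hx : Generated j ε x) :
    x ∈ LinearMap.range (fromDerived hP hε j r d) := by
  induction hx with
  | base μ => exact map_mem_range hP hε j μ
  | add _ _ ihx ihy => exact Submodule.add_mem _ ihx ihy
  | insert hd a _ ih => exact comp_eps_mem_range hP hε j hd a ih

end Generated
end DerivedOperad

namespace DerivedOperad

/-! ### Directness of the sum of the relations -/

section Independence

variable {k : Type u} [CommRing k]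

theorem iSupIndep_three {M : Type*} [AddCommGroup M] [Module k M] {A B C : Submodule k M}
    (hA : Disjoint A (B ⊔ C)) (hB : Disjoint B (A ⊔ C)) (hC : Disjoint C (A ⊔ B)) :
    iSupIndep ![A, B, C] := by
  intro i
  fin_cases i
  · refine hA.mono_right (iSup₂_le fun j hj => ?_)
    fin_cases j
    · exact absurd rfl hj
    · exact le_sup_left
    · exact le_sup_right
  · refine hB.mono_right (iSup₂_le fun j hj => ?_)
    fin_cases j
    · exact le_sup_left
    · exact absurd rfl hj
    · exact le_sup_right
  · refine hC.mono_right (iSup₂_le fun j hj => ?_)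
    fin_cases j
    · exact le_sup_left
    · exact le_sup_right
    · exact absurd rfl hj

/-- The projection `E ⊕ k · ε → E`. -/
def fstHom (E : SMod.{u, v} k) : (addEps E).Hom E where
  toFun _ _ := LinearMap.fst k _ _
  map_perm _ _ := rfl

/-- The projection `E ⊕ k · ε → k · ε`, as an endomorphism. -/
def epsHom (E : SMod.{u, v} k) : (addEps E).Hom (addEps E) where
  toFun r d := LinearMap.prodMap (0 : E.carrier r d →ₗ[k] E.carrier r d) LinearMap.id
  map_perm {r d} σ _ := Prod.ext (map_zero (E.perm r d σ)).symm rfl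

/-- The identity morphism of an operad. -/
def OperadHom.refl (P : OperadData.{u, v} k) : OperadHom P P where
  toFun _ _ := LinearMap.id
  map_one := rfl
  map_perm _ _ := rfl
  map_comp _ _ _ _ _ := rfl

theorem fstHom_eps (E : SMod.{u, v} k) : (Free.mapHom (fstHom E)).toFun _ _ (eps E) = 0 :=
  map_zero (gen E 1 (-1, 0))

theorem epsHom_genInl (E : SMod.{u, v} k) {r : ℕ} {d : Deg} (x : E.carrier r d) :
    (Free.mapHom (epsHom E)).toFun _ _ (genInl E r d x) = 0 :=
  map_zero (gen (addEps E) r d)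

theorem map_relMap {E : SMod.{u, v} k} {Q : OperadData.{u, w} k}
    (φ : OperadHom (Free (addEps E)) Q) {r : ℕ} {d : Deg} (x : E.carrier r (d + (1, 0))) :
    φ.toFun r d (relMap E r d x) =
      Q.comp (Nat.add_comm r 1) (by ext <;> simp) 0 (φ.toFun _ _ (eps E))
        (φ.toFun _ _ (genInl E r (d + (1, 0)) x)) -
      Int.negOnePow (tot (d + (1, 0))) • ∑ i : Fin r,
        Q.comp rfl (deg_eps d) i (φ.toFun _ _ (genInl E r (d + (1, 0)) x))
          (φ.toFun _ _ (eps E)) := by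
  rw [relMap_apply, map_sub, φ.map_comp, units_smul_map, map_sum]
  congr 2
  exact Finset.sum_congr rfl fun i _ => φ.map_comp _ _ _ _ _

theorem fstHom_map_inlHom (E : SMod.{u, v} k) {r : ℕ} {d : Deg} (z : (Free E).carrier r d) :
    (Free.mapHom (fstHom E)).toFun r d (Free.map (inlHom E) r d z) = z :=
  Free.hom_ext (φ := (Free.mapHom (inlHom E)).trans (Free.mapHom (fstHom E)))
    (ψ := OperadHom.refl _) (fun _ _ _ => rfl) z

/-- Weight two is essential: the unit of the free operad is not killed. -/
theorem epsHom_map_inlHom (E : SMod.{u, v} k) {r : ℕ} {d : Deg} {z : (Free E).carrier r d}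
    (hz : z ∈ weightTwo E r d) :
    (Free.mapHom (epsHom E)).toFun r d (Free.map (inlHom E) r d z) = 0 := by
  let ψ := (Free.mapHom (inlHom E)).trans (Free.mapHom (epsHom E))
  suffices h : weightTwo E r d ≤ LinearMap.ker (ψ.toFun r d) from h hz
  refine Submodule.span_le.2 ?_
  rintro _ ⟨m, n, e, f, h, hd, i, x, y, σ, rfl⟩
  have hx : ψ.toFun m e (gen E m e x) = 0 := epsHom_genInl E x
  rw [SetLike.mem_coe, LinearMap.mem_ker, ψ.map_perm, ψ.map_comp, hx, map_zero,
    LinearMap.zero_apply, map_zero]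

theorem epsHom_of_mem_relEpsSq (E : SMod.{u, v} k) {r : ℕ} {d : Deg}
    {z : (Free (addEps E)).carrier r d} (hz : z ∈ relEpsSq E r d) :
    (Free.mapHom (epsHom E)).toFun r d z = z := by
  suffices h : relEpsSq E r d ≤
      LinearMap.eqLocus ((Free.mapHom (epsHom E)).toFun r d) LinearMap.id from h hz
  refine Submodule.span_le.2 ?_
  rintro _ ⟨h, hd, rfl⟩
  exact (Free.mapHom (epsHom E)).map_comp h hd 0 (eps E) (eps E)

theorem fstHom_of_mem_relEpsSq (E : SMod.{u, v} k) {r : ℕ} {d : Deg}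
    {z : (Free (addEps E)).carrier r d} (hz : z ∈ relEpsSq E r d) :
    (Free.mapHom (fstHom E)).toFun r d z = 0 := by
  suffices h : relEpsSq E r d ≤
      LinearMap.ker ((Free.mapHom (fstHom E)).toFun r d) from h hz
  refine Submodule.span_le.2 ?_
  rintro _ ⟨h, hd, rfl⟩
  rw [SetLike.mem_coe, LinearMap.mem_ker, OperadHom.map_comp, fstHom_eps, map_zero]

theorem fstHom_of_mem_relD (E : SMod.{u, v} k) {r : ℕ} {d : Deg}
    {z : (Free (addEps E)).carrier r d} (hz : z ∈ relD E r d) :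
    (Free.mapHom (fstHom E)).toFun r d z = 0 := by
  obtain ⟨x, rfl⟩ := hz
  rw [map_relMap, fstHom_eps]
  simp

theorem epsHom_of_mem_relD (E : SMod.{u, v} k) {r : ℕ} {d : Deg}
    {z : (Free (addEps E)).carrier r d} (hz : z ∈ relD E r d) :
    (Free.mapHom (epsHom E)).toFun r d z = 0 := by
  obtain ⟨x, rfl⟩ := hz
  rw [map_relMap, epsHom_genInl]
  simp

theorem epsHom_of_mem_relR (X : QuadraticData.{u, v} k) {r : ℕ} {d : Deg}
    {z : (Free (addEps X.E)).carrier r d} (hz : z ∈ relR X r d) :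
    (Free.mapHom (epsHom X.E)).toFun r d z = 0 := by
  obtain ⟨z, hz, rfl⟩ := hz
  exact epsHom_map_inlHom X.E (X.R_le r d hz)

theorem eq_zero_of_mem_relR (X : QuadraticData.{u, v} k) {r : ℕ} {d : Deg}
    {z : (Free (addEps X.E)).carrier r d} (hz : z ∈ relR X r d)
    (h : (Free.mapHom (fstHom X.E)).toFun r d z = 0) : z = 0 := by
  obtain ⟨z, -, rfl⟩ := hz
  rw [fstHom_map_inlHom] at h
  rw [h, map_zero]

/-- The sum of the relations is direct. -/
theorem iSupIndep_relations (X : QuadraticData.{u, v} k) (r : ℕ) (d : Deg) :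
    iSupIndep ![relR X r d, relD X.E r d, relEpsSq X.E r d] := by
  refine iSupIndep_three ?_ ?_ ?_
  · refine Submodule.disjoint_def.2 fun x hx hx' => ?_
    obtain ⟨y, hy, z, hz, rfl⟩ := Submodule.mem_sup.1 hx'
    refine eq_zero_of_mem_relR X hx ?_
    rw [map_add, fstHom_of_mem_relD _ hy, fstHom_of_mem_relEpsSq _ hz, add_zero]
  -- Here an element of `D` is written as `y + z` with `y` in `R` and `z` in `k · ε²`. Killing `ε`
  -- gives `y = 0`, and killing `E` gives `z = 0`.
  · refine Submodule.disjoint_def.2 fun x hx hx' => ?_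
    obtain ⟨y, hy, z, hz, rfl⟩ := Submodule.mem_sup.1 hx'
    have h1 := fstHom_of_mem_relD _ hx
    rw [map_add, fstHom_of_mem_relEpsSq _ hz, add_zero] at h1
    have h2 := epsHom_of_mem_relD _ hx
    rw [map_add, epsHom_of_mem_relR X hy, epsHom_of_mem_relEpsSq _ hz, zero_add] at h2
    rw [eq_zero_of_mem_relR X hy h1, h2, add_zero]
  · refine Submodule.disjoint_def.2 fun x hx hx' => ?_
    obtain ⟨y, hy, z, hz, rfl⟩ := Submodule.mem_sup.1 hx'
    rw [← epsHom_of_mem_relEpsSq _ hx, map_add, epsHom_of_mem_relR X hy, epsHom_of_mem_relD _ hz,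
      add_zero]

end Independence

/-! ### The isomorphism with the presented operad -/

section Presentation

variable {k : Type u} [CommRing k]

/-- The family of elements with the single nonzero component `ε`. -/
def epsFamily {P : OperadData.{u, v} k} (ε : P.carrier 1 (-1, 0)) (r : ℕ) (d : Deg) :
    P.carrier r d :=
  if h : r = 1 ∧ d = (-1, 0) then h.1 ▸ h.2 ▸ ε else 0

theorem epsFamily_self {P : OperadData.{u, v} k} (ε : P.carrier 1 (-1, 0)) :
    epsFamily ε 1 (-1, 0) = ε := by
  rw [epsFamily, dif_pos ⟨rfl, rfl⟩]

theorem perm_epsFamily {P : OperadData.{u, v} k} (hP : IsOperad P) (ε : P.carrier 1 (-1, 0))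
    {r : ℕ} {d : Deg} (σ : Equiv.Perm (Fin r)) :
    P.perm σ (epsFamily ε r d) = epsFamily ε r d := by
  by_cases h : r = 1 ∧ d = (-1, 0)
  · obtain ⟨rfl, rfl⟩ := h
    rw [Subsingleton.elim σ 1, hP.perm_one]
  · rw [epsFamily, dif_neg h, map_zero]

/-- The map from the generators `E ⊕ k · ε` to an operad, given by a map from `E` and an element
`ε`. -/
def generatorMap {E : SMod.{u, v} k} {P : OperadData.{u, w} k}
    (φ : ∀ r d, E.carrier r d →ₗ[k] P.carrier r d) (ε : P.carrier 1 (-1, 0)) (r : ℕ) (d : Deg) :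
    (addEps E).carrier r d →ₗ[k] P.carrier r d :=
  LinearMap.coprod (φ r d)
    ((LinearMap.toSpanSingleton k _ (epsFamily ε r d)).comp (epsCarrier k r d).subtype)

theorem generatorMap_perm {E : SMod.{u, v} k} {P : OperadData.{u, w} k} (hP : IsOperad P)
    (φ : ∀ r d, E.carrier r d →ₗ[k] P.carrier r d) (ε : P.carrier 1 (-1, 0))
    (hφ : ∀ r d (σ : Equiv.Perm (Fin r)) (x : E.carrier r d),
      φ r d (E.perm r d σ x) = P.perm σ (φ r d x)) (r : ℕ) (d : Deg) (σ : Equiv.Perm (Fin r))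
    (x : (addEps E).carrier r d) :
    generatorMap φ ε r d ((addEps E).perm r d σ x) = P.perm σ (generatorMap φ ε r d x) := by
  obtain ⟨x, c⟩ := x
  change φ r d (E.perm r d σ x) + c.1 • epsFamily ε r d =
    P.perm σ (φ r d x + c.1 • epsFamily ε r d)
  rw [hφ, map_add, map_smul, perm_epsFamily hP]

theorem epsCarrier_eq_zero {r : ℕ} {d : Deg} (h : ¬(r = 1 ∧ d = (-1, 0))) (c : epsCarrier k r d) :
    c = 0 := by
  obtain ⟨c, hc⟩ := c
  refine Subtype.ext ?_
  rwa [epsCarrier, if_neg h, Submodule.mem_bot] at hc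

variable (X : QuadraticData.{u, v} k)

theorem operad_isOperad : IsOperad X.operad := quotient_isOperad (free_isOperad _) _

theorem ι_perm (r : ℕ) (d : Deg) (σ : Equiv.Perm (Fin r)) (x : X.E.carrier r d) :
    X.ι r d (X.E.perm r d σ x) = X.operad.perm σ (X.ι r d x) := by
  change (mkHom _ _).toFun r d (gen X.E r d _) = _
  rw [gen_perm, OperadHom.map_perm]
  rfl

/-- The morphism `F(E ⊕ k · ε) → D(P(E, R))`. -/
noncomputable def freeToDerived : OperadHom (Free (addEps X.E)) (derived X.operad) :=
  Free.lift (derived_isOperad (operad_isOperad X))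
    (generatorMap (fun r d => (derivedInl X.operad r d).comp (X.ι r d)) (derivedEps X.operad))
    (generatorMap_perm (derived_isOperad (operad_isOperad X)) _ _ fun r d σ x => by
      rw [LinearMap.comp_apply, ι_perm]
      exact (derivedInlHom X.operad).map_perm σ _)

theorem freeToDerived_genInl {r : ℕ} {d : Deg} (x : X.E.carrier r d) :
    (freeToDerived X).toFun r d (genInl X.E r d x) = derivedInl X.operad r d (X.ι r d x) := by
  change derivedInl X.operad r d (X.ι r d x) +
    (0 : k) • epsFamily (derivedEps X.operad) r d = _
  rw [zero_smul, add_zero]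

theorem freeToDerived_eps :
    (freeToDerived X).toFun 1 (-1, 0) (eps X.E) = derivedEps X.operad := by
  change (derivedInl X.operad 1 (-1, 0)).comp (X.ι 1 (-1, 0)) 0 +
    (1 : k) • epsFamily (derivedEps X.operad) 1 (-1, 0) = _
  rw [map_zero, zero_add, one_smul, epsFamily_self]

theorem freeToDerived_map_inlHom {r : ℕ} {d : Deg} (z : (Free X.E).carrier r d) :
    (freeToDerived X).toFun r d (Free.map (inlHom X.E) r d z) =
      derivedInl X.operad r d ((mkHom (Free X.E) (idealSpan (Free X.E) X.R)).toFun r d z) :=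
  Free.hom_ext (φ := (Free.mapHom (inlHom X.E)).trans (freeToDerived X))
    (ψ := (mkHom (Free X.E) (idealSpan (Free X.E) X.R)).trans (derivedInlHom X.operad))
    (fun _ _ x => freeToDerived_genInl X x) z

theorem freeToDerived_relMap {r : ℕ} {d : Deg} (x : X.E.carrier r (d + (1, 0))) :
    (freeToDerived X).toFun r d (relMap X.E r d x) = 0 := by
  rw [map_relMap, freeToDerived_eps, freeToDerived_genInl,
    derivedEps_comp_inl (operad_isOperad X)]
  simp only [derivedInl_comp_eps (operad_isOperad X)]
  exact sub_self _

/-- The relations `R ⊕ D ⊕ k · ε²`. -/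
abbrev derivedRelations (r : ℕ) (d : Deg) : Submodule k ((Free (addEps X.E)).carrier r d) :=
  relR X r d ⊔ relD X.E r d ⊔ relEpsSq X.E r d

theorem freeToDerived_relations (r : ℕ) (d : Deg) (z : (Free (addEps X.E)).carrier r d)
    (hz : z ∈ derivedRelations X r d) : (freeToDerived X).toFun r d z = 0 := by
  suffices h : derivedRelations X r d ≤ LinearMap.ker ((freeToDerived X).toFun r d) from h hz
  refine sup_le (sup_le ?_ ?_) ?_
  · rintro _ ⟨z, hz, rfl⟩
    rw [LinearMap.mem_ker, freeToDerived_map_inlHom, mkHom_eq_zero hz]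
    exact map_zero _
  · rintro _ ⟨x, rfl⟩
    exact freeToDerived_relMap X x
  · refine Submodule.span_le.2 ?_
    rintro _ ⟨h, hd, rfl⟩
    rw [SetLike.mem_coe, LinearMap.mem_ker, OperadHom.map_comp, freeToDerived_eps]
    obtain rfl : r = 1 := by omega
    exact derivedEps_comp_eps h hd

/-- The morphism `P(E ⊕ k · ε, R ⊕ D ⊕ k · ε²) → D(P(E, R))`. -/
noncomputable def toDerived : OperadHom X.derived.operad (derived X.operad) :=
  quotientLift (freeToDerived X) (derivedRelations X) (freeToDerived_relations X)

/-- The projection of `F(E ⊕ k · ε)`. -/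
def derivedMk : OperadHom (Free (addEps X.E)) X.derived.operad :=
  mkHom (Free (addEps X.E)) (idealSpan (Free (addEps X.E)) (derivedRelations X))

/-- The morphism `P(E, R) → P(E ⊕ k · ε, R ⊕ D ⊕ k · ε²)`. -/
def operadInl : OperadHom X.operad X.derived.operad :=
  quotientLift ((Free.mapHom (inlHom X.E)).trans (derivedMk X)) X.R fun _ _ z hz =>
    mkHom_eq_zero (R := derivedRelations X)
      (Submodule.mem_sup_left (Submodule.mem_sup_left ⟨z, hz, rfl⟩))

/-- The image of `ε`. -/
def operadEps : X.derived.operad.carrier 1 (-1, 0) := (derivedMk X).toFun _ _ (eps X.E)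

theorem operadEps_comp (d : Deg) (hd : d = (-1, 0) + (-1, 0)) :
    X.derived.operad.comp (l := 1) rfl hd 0 (operadEps X) (operadEps X) = 0 := by
  rw [operadEps, ← (derivedMk X).map_comp]
  exact mkHom_eq_zero (R := derivedRelations X)
    (Submodule.mem_sup_right (Submodule.subset_span ⟨rfl, hd, rfl⟩))

theorem derives_genInl {r : ℕ} {e : Deg} (x : X.E.carrier r e) :
    Derives (operadEps X) ((derivedMk X).toFun r e (genInl X.E r e x)) := by
  intro d h hd hd'
  obtain rfl : e = d + (1, 0) := by
    rw [hd]
    ext <;> simp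
  have h1 : (derivedMk X).toFun r d (relMap X.E r d x) = 0 :=
    mkHom_eq_zero (R := derivedRelations X)
    (Submodule.mem_sup_left (Submodule.mem_sup_right ⟨x, rfl⟩))
  rw [map_relMap] at h1
  exact sub_eq_zero.1 h1

theorem derives_operadInl {r : ℕ} {d : Deg} (μ : X.operad.carrier r d) :
    Derives (operadEps X) ((operadInl X).toFun r d μ) := by
  obtain ⟨z, rfl⟩ := mkHom_surjective _ r d μ
  exact derives_of_gen (operad_isOperad X.derived)
    ((Free.mapHom (inlHom X.E)).trans (derivedMk X)) (fun x => derives_genInl X x) z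

theorem generated_operad {r : ℕ} {d : Deg} (z : X.derived.operad.carrier r d) :
    Generated (operadInl X) (operadEps X) z := by
  obtain ⟨z, rfl⟩ := mkHom_surjective _ r d z
  refine generated_of_gen (operad_isOperad X.derived) (derives_operadInl X) (derivedMk X) ?_ z
  rintro r d ⟨x, c⟩
  have e1 : gen (addEps X.E) r d (x, c) =
      genInl X.E r d x + gen (addEps X.E) r d ((0 : X.E.carrier r d), c) :=
    (congrArg (gen (addEps X.E) r d) (Prod.ext (add_zero x).symm (zero_add c).symm)).trans
      (map_add (gen (addEps X.E) r d) _ _)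
  rw [e1, map_add]
  refine Generated.add (Generated.base (j := operadInl X) (X.ι r d x)) ?_
  by_cases h : r = 1 ∧ d = (-1, 0)
  · obtain ⟨rfl, rfl⟩ := h
    have e2 : gen (addEps X.E) 1 (-1, 0) ((0 : X.E.carrier 1 (-1, 0)), c) = c.1 • eps X.E :=
      (congrArg (gen (addEps X.E) 1 (-1, 0))
        (Prod.ext (smul_zero _).symm (Subtype.ext (mul_one _).symm))).trans
          (map_smul (gen (addEps X.E) 1 (-1, 0)) c.1 _)
    rw [e2, map_smul]
    refine Generated.smul _ ?_
    -- The generator `ε` arises by inserting `ε` in the unit, which lies in the image of `P(E, R)`.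
    have h1 := Generated.insert (j := operadInl X) (ε := operadEps X) (d := (-1, 0))
      (zero_add _).symm 0 (Generated.base X.operad.one)
    rwa [(operadInl X).map_one, (operad_isOperad X.derived).one_comp] at h1
  · rw [epsCarrier_eq_zero h c]
    have e2 : gen (addEps X.E) r d ((0 : X.E.carrier r d), (0 : epsCarrier k r d)) = 0 :=
      map_zero _
    rw [e2, map_zero]
    exact Generated.zero

theorem toDerived_operadInl (r : ℕ) (d : Deg) (μ : X.operad.carrier r d) :
    (toDerived X).toFun r d ((operadInl X).toFun r d μ) = derivedInl X.operad r d μ := by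
  obtain ⟨z, rfl⟩ := mkHom_surjective _ r d μ
  exact freeToDerived_map_inlHom X z

/-- The section `fromDerived` gives surjectivity. It is itself onto, by `generated_operad` and
`Generated.mem_range`, so an element is recovered from its image and injectivity follows. -/
theorem toDerived_bijective (r : ℕ) (d : Deg) :
    Function.Bijective ((toDerived X).toFun r d) := by
  have hP := operad_isOperad X.derived
  have key : ∀ x, (toDerived X).toFun r d
      (fromDerived hP (operadEps_comp X) (operadInl X) r d x) = x := fun x =>
    apply_fromDerived hP (operadEps_comp X) (operadInl X) (operad_isOperad X) (toDerived X)
      (freeToDerived_eps X) (toDerived_operadInl X) x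
  refine ⟨fun x y hxy => ?_, fun x => ⟨_, key x⟩⟩
  obtain ⟨x, rfl⟩ := (generated_operad X x).mem_range hP (operadEps_comp X)
  obtain ⟨y, rfl⟩ := (generated_operad X y).mem_range hP (operadEps_comp X)
  rw [key, key] at hxy
  rw [hxy]

/-- The isomorphism `P(E ⊕ k · ε, R ⊕ D ⊕ k · ε²) ≅ D(P(E, R))`. -/
noncomputable def derivedIso : OperadIso X.derived.operad (derived X.operad) where
  toEquiv r d := LinearEquiv.ofBijective ((toDerived X).toFun r d) (toDerived_bijective X r d)
  map_one := (toDerived X).map_one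
  map_perm σ x := (toDerived X).map_perm σ x
  map_comp h hd i x y := (toDerived X).map_comp h hd i x y

end Presentation
end DerivedOperad

theorem proposition3p7 {k : Type u} [CommRing k] (X : DerivedOperad.QuadraticData.{u, v} k) :
    DerivedOperad.IsOperad (DerivedOperad.derived X.operad) ∧
    (∀ (r : ℕ) (d : DerivedOperad.Deg),
      iSupIndep ![DerivedOperad.relR X r d, DerivedOperad.relD X.E r d,
        DerivedOperad.relEpsSq X.E r d]) ∧
    ∃ Φ : DerivedOperad.OperadIso X.derived.operad (DerivedOperad.derived X.operad),
      (∀ (r : ℕ) (d : DerivedOperad.Deg) (μ : X.E.carrier r d),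
        Φ.toEquiv r d (X.derived.ι r d (μ, 0)) =
          DerivedOperad.derivedInl X.operad r d (X.ι r d μ)) ∧
      Φ.toEquiv 1 (-1, 0) (X.derived.ι 1 (-1, 0)
          (0, ⟨1, by simp [DerivedOperad.epsCarrier]⟩)) =
        DerivedOperad.derivedEps X.operad :=
  ⟨DerivedOperad.derived_isOperad (DerivedOperad.operad_isOperad X),
    DerivedOperad.iSupIndep_relations X, DerivedOperad.derivedIso X,
    -- On classes of generators the isomorphism is by definition `freeToDerived`.
    fun _ _ μ => DerivedOperad.freeToDerived_genInl X μ, DerivedOperad.freeToDerived_eps X⟩
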